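/- \textbf{Theorem.} For every fixed $\delta>0$ there are a program $\Pi$ and constants $\kappa, C$, depending only on $\delta$, such that for every $n\ge 2$ every set $P\subset\mathbb{R}^2$ of $n$ points can be stored in a data structure of size at most $C\,n\log^{\delta} n$ with which $\Pi$ answers every exact rectilinear $3$-center range query on $P$ in time at most $C\log^2 n$. Here a \emph{rectilinear $3$-center query} specifies an axis-aligned rectangle $Q=[x_1,x_2]\times[y_1,y_2]$ ($x_1\le x_2$, $y_1\le y_2$), and the answer consists of three (not necessarily distinct) closed axis-aligned squares of equal side length $s\ge 0$ whose union contains $P\cap Q$, where $s$ is the minimum side length for which such squares exist; the squares are reported by their common side length and their lower left corners. The \emph{model of computation} is a random access machine with words of $\kappa\lceil\log_2 n\rceil$ bits and with exact real numbers. The data structure, which may depend on $P$ but not on $Q$, is a read-only memory consisting of an array of words and an array of reals, where each stored real is a coordinate of a point of $P$; its size is the total number of cells. The program is a finite list of instructions working on finitely many word registers and real registers; the coordinates of $Q$ are initially given in real registers. In one time unit the machine can load a word constant, copy a register, perform $+,-,\times$ modulo the word range or integer division with remainder on words, perform $+,-$ on reals, load the memory cell of a given address, compare two words or two reals and branch,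 or jump. There is no conversion between reals and words. -/

import Mathlib

/-! ### Rectilinear `k`-center -/

namespace RangeCenter

/-- The closed axis-aligned square with lower left corner `c` and side length `s`
(`Set.Icc` for the coordinatewise order of the plane). -/
def square (c : ℝ × ℝ) (s : ℝ) : Set (ℝ × ℝ) :=
  Set.Icc c (c + (s, s))

/-- The `k` squares of side length `s` with lower left corners `c i` together cover `S`. -/
def Covers {k : ℕ} (S : Set (ℝ × ℝ)) (c : Fin k → ℝ × ℝ) (s : ℝ) : Prop :=
  0 ≤ s ∧ S ⊆ ⋃ i, square (c i) s

/-- The `k` congruent squares given by `c` and `s` are an optimal solution of the rectilinear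
`k`-center problem on `S`: they cover `S`, and no `k` congruent squares of smaller size do. The
squares need not be distinct, so that solutions with fewer than `k` squares are included. -/
def IsOptimalCenter {k : ℕ} (S : Set (ℝ × ℝ)) (c : Fin k → ℝ × ℝ) (s : ℝ) : Prop :=
  Covers S c s ∧ ∀ (c' : Fin k → ℝ × ℝ) (s' : ℝ), Covers S c' s' → s ≤ s'

/-! ### A random access machine with words of `w` bits and real numbers

The machine has word registers and real registers, and random access to a read-only memory that
holds the data structure and consists of an array of words and an array of reals. There is no
conversion between reals and words: reals can be copied, added, subtracted and compared only.
Every executed instruction costs one time unit. -/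

/-- Arithmetic on words: modulo `2 ^ w`, with the quotient and remainder of unsigned division. -/
inductive WordOp where
  | add
  | sub
  | mul
  | div
  | mod

/-- The value of a word operation. -/
def WordOp.eval {w : ℕ} : WordOp → BitVec w → BitVec w → BitVec w
  | .add, a, b => a + b
  | .sub, a, b => a - b
  | .mul, a, b => a * b
  | .div, a, b => a / b
  | .mod, a, b => a % b

/-- The instructions. Arguments `d`, `a`, `b` are numbers of registers, `target` is the position
in the program at which execution continues if the tested inequality holds. -/
inductive Instr where
  | wordConst (d : ℕ) (value : ℕ)
  | wordMove (d a : ℕ)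
  | wordOp (op : WordOp) (d a b : ℕ)
  | wordLoad (d a : ℕ)
  | realMove (d a : ℕ)
  | realAdd (d a b : ℕ)
  | realSub (d a b : ℕ)
  | realLoad (d a : ℕ)
  | jump (target : ℕ)
  | jumpWordLt (a b target : ℕ)
  | jumpRealLt (a b target : ℕ)
  | halt

/-- A program is a finite list of instructions; it uses finitely many registers. -/
abbrev Program := List Instr

/-- The memory contents: an array of words of `w` bits and an array of reals. -/
structure Memory (w : ℕ) where
  numWords : ℕ
  numReals : ℕ
  word : Fin numWords → BitVec w
  real : Fin numReals → ℝ

/-- The storage used: the number of memory cells. -/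
def Memory.size {w : ℕ} (M : Memory w) : ℕ := M.numWords + M.numReals

/-- A configuration: the position in the program, and the contents of the registers. -/
structure Config (w : ℕ) where
  pc : ℕ
  wordReg : ℕ → BitVec w
  realReg : ℕ → ℝ

/-- Write a word register and go to the next instruction. -/
def Config.setWord {w : ℕ} (s : Config w) (d : ℕ) (v : BitVec w) : Config w :=
  { s with pc := s.pc + 1, wordReg := Function.update s.wordReg d v }

/-- Write a real register and go to the next instruction. -/
def Config.setReal {w : ℕ} (s : Config w) (d : ℕ) (v : ℝ) : Config w :=
  { s with pc := s.pc + 1, realReg := Function.update s.realReg d v }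

/-- The effect of one instruction. The value `none` means that there is no next configuration:
the instruction is `halt`, or a memory access is out of bounds. -/
noncomputable def Instr.exec {w : ℕ} (M : Memory w) (s : Config w) : Instr → Option (Config w)
  | .wordConst d value => some (s.setWord d (BitVec.ofNat w value))
  | .wordMove d a => some (s.setWord d (s.wordReg a))
  | .wordOp op d a b => some (s.setWord d (op.eval (s.wordReg a) (s.wordReg b)))
  | .wordLoad d a =>
      if h : (s.wordReg a).toNat < M.numWords then
        some (s.setWord d (M.word ⟨(s.wordReg a).toNat, h⟩))
      else none
  | .realMove d a => some (s.setReal d (s.realReg a))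
  | .realAdd d a b => some (s.setReal d (s.realReg a + s.realReg b))
  | .realSub d a b => some (s.setReal d (s.realReg a - s.realReg b))
  | .realLoad d a =>
      if h : (s.wordReg a).toNat < M.numReals then
        some (s.setReal d (M.real ⟨(s.wordReg a).toNat, h⟩))
      else none
  | .jump target => some { s with pc := target }
  | .jumpWordLt a b target =>
      some { s with pc := if (s.wordReg a).toNat < (s.wordReg b).toNat then target else s.pc + 1 }
  | .jumpRealLt a b target =>
      some { s with pc := if s.realReg a < s.realReg b then target else s.pc + 1 }
  | .halt => none

/-- One step of the program; there is no step from outside the program. -/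
noncomputable def step {w : ℕ} (prog : Program) (M : Memory w) (s : Config w) :
    Option (Config w) :=
  prog[s.pc]?.bind (Instr.exec M s)

/-- The configuration after exactly `t` steps. -/
noncomputable def run {w : ℕ} (prog : Program) (M : Memory w) : ℕ → Config w → Option (Config w)
  | 0, s => some s
  | t + 1, s => (step prog M s).bind (run prog M t)

/-- Started in `s`, the program properly halts in `s'` after exactly `t` steps. -/
def HaltsIn {w : ℕ} (prog : Program) (M : Memory w) (s : Config w) (t : ℕ) (s' : Config w) :
    Prop :=
  run prog M t s = some s' ∧ prog[s'.pc]? = some Instr.halt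

/-! ### Queries -/

/-- The initial configuration for the query rectangle `[a.1, b.1] × [a.2, b.2]`: its four
coordinates are in the first real registers, and all other registers are zero. -/
def queryConfig (w : ℕ) (a b : ℝ × ℝ) : Config w where
  pc := 0
  wordReg := fun _ => 0
  realReg := fun i =>
    match i with
    | 0 => a.1
    | 1 => a.2
    | 2 => b.1
    | 3 => b.2
    | _ => 0

/-- The output side length: real register `0`. -/
def outSide {w : ℕ} (s : Config w) : ℝ := s.realReg 0

/-- The output lower left corners: the `i`-th one is in real registers `2 i + 1` and
`2 i + 2`. -/
def outCorner {w : ℕ} (k : ℕ) (s : Config w) (i : Fin k) : ℝ × ℝ :=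
  (s.realReg (2 * (i : ℕ) + 1), s.realReg (2 * (i : ℕ) + 2))

/-- The only real numbers stored in the memory are coordinates of points of `P`. -/
def Memory.RealsFrom {w : ℕ} (M : Memory w) (P : Finset (ℝ × ℝ)) : Prop :=
  ∀ i, ∃ p ∈ P, M.real i = p.1 ∨ M.real i = p.2

/-- With memory `M`, the program answers every rectilinear `k`-center query on `P` exactly, in
time at most `T`: for every query rectangle it outputs `k` congruent squares that are an optimal
solution for the points of `P` in the rectangle. -/
def AnswersCenterQueries {w : ℕ} (k : ℕ) (prog : Program) (M : Memory w) (P : Finset (ℝ × ℝ))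
    (T : ℝ) : Prop :=
  ∀ a b : ℝ × ℝ, a ≤ b → ∃ (t : ℕ) (s : Config w),
    HaltsIn prog M (queryConfig w a b) t s ∧ (t : ℝ) ≤ T ∧
      IsOptimalCenter ((P : Set (ℝ × ℝ)) ∩ Set.Icc a b) (outCorner k s) (outSide s)

end RangeCenter

namespace RangeCenter

/-! ### Executing code fragments -/

/-! Geometry. A nonempty finite set has a bounding box with four sides. If three squares of side `s`
cover the set, one of them contains points on two sides, and it follows that a corner square of side
`s` can take over the task of one of the three (`exists_rest_covered`). Applying this again to the
points left over, `s` suffices only if, for one of 16 pairs of corners, two corner squares placed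
one after the other leave a set that fits into a third square (`exists_feasible`). The second corner
belongs to the bounding box of the first remainder. For fixed corners this condition is monotone in
`s` (`Feasible.mono`).

Search. Fix the corners. The first remainder changes only when `s` passes a distance from a
coordinate of a point to a side of the bounding box. Binary search over the sorted coordinates
therefore confines the interesting values of `s` to an interval on which the first remainder is
constant. Then the second bounding box is known, and a second search makes the second remainder
constant as well. On the final interval from `lo` to `hi` the third square needs a constant side
length `e`, so the optimum is the minimum of `hi` and `max lo e` (`search_spec`). Each of the `O(log
n)` probes computes the bounding box of what two corner squares leave. That set is a union of four
rectangles (`isHull_hullRestRest`), so a bounded number of queries for the extreme points in a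
rectangle is enough.

Data structure. In rank space the points form a permutation, stored as a wavelet matrix with `L`,
about `log n`, levels, once for each direction. A descent with a few prefix counts per level counts
and selects in time `O(log n)` (`countLess_eq`, `select_spec`), and this yields the extreme points
in a rectangle (`extremes_spec`). One word per prefix count would take `n log n` words. Instead, `b
= L / L.size` consecutive counts share a word: a base value and increments as digits in base `b + 1`
(`packed_lookup`). They fit because `(b + 1) ^ b ≤ 2 ^ L`. The size becomes `O(n log log n)`, which
is `O(n log ^ δ n)` (`size_le_rpow`). The program does not depend on `δ`.

Machine. `Realizable d f` expresses computability by relocatable code in time `O((L + 1) ^ d)`. It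
is closed under composition, pairing and branching, and a loop of `L` rounds raises `d` by one. All
functions of the algorithm are defined by machine arithmetic, with wraparound and with value zero
outside the memory. Hence realizability (`realizable_answer`, exponent 2) needs no preconditions and
is separate from correctness (`answer_spec`), which uses only `Represents`. -/

theorem run_add {w : ℕ} (prog : Program) (M : Memory w) (t u : ℕ) (s : Config w) :
    run prog M (t + u) s = (run prog M t s).bind (run prog M u) := by
  induction t generalizing s with
  | zero => simp [run]
  | succ t ih =>
    rw [Nat.add_right_comm]
    simp only [run]
    cases step prog M s with
    | none => rfl
    | some s' => simpa using ih s'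

/-- The program `prog` contains `code` at position `pos`. -/
def CodeAt (prog : Program) (pos : ℕ) (code : List Instr) : Prop :=
  ∀ k < code.length, prog[pos + k]? = code[k]?

theorem CodeAt.left {prog : Program} {pos : ℕ} {c d : List Instr} (h : CodeAt prog pos (c ++ d)) :
    CodeAt prog pos c := by
  intro k hk
  rw [h k (by rw [List.length_append]; omega), List.getElem?_append_left hk]

theorem CodeAt.right {prog : Program} {pos : ℕ} {c d : List Instr}
    (h : CodeAt prog pos (c ++ d)) : CodeAt prog (pos + c.length) d := by
  intro k hk
  rw [Nat.add_assoc, h (c.length + k) (by rw [List.length_append]; omega),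
    List.getElem?_append_right (by omega), Nat.add_sub_cancel_left]

theorem CodeAt.head {prog : Program} {pos : ℕ} {i : Instr} {d : List Instr}
    (h : CodeAt prog pos (i :: d)) : prog[pos]? = some i := by
  simpa using h 0 (by simp)

theorem CodeAt.tail {prog : Program} {pos : ℕ} {i : Instr} {d : List Instr}
    (h : CodeAt prog pos (i :: d)) : CodeAt prog (pos + 1) d :=
  CodeAt.right (c := [i]) h

/-- The memory word at an address, with value zero outside the memory. -/
def Memory.wordAt {w : ℕ} (M : Memory w) (a : ℕ) : ℕ :=
  if h : a < M.numWords then (M.word ⟨a, h⟩).toNat else 0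

/-- The memory real at an address, with value zero outside the memory. -/
noncomputable def Memory.realAt {w : ℕ} (M : Memory w) (a : ℕ) : ℝ :=
  if h : a < M.numReals then M.real ⟨a, h⟩ else 0

/-- A memory whose first three words are the numbers of its words and of its reals, and a number
`L`, the number of iterations of the loops. -/
structure Inst where
  w : ℕ
  M : Memory w
  L : ℕ
  four_le : 4 ≤ w
  two_lt : 2 < M.numWords
  wordAt_zero : M.wordAt 0 = M.numWords
  wordAt_one : M.wordAt 1 = M.numReals
  wordAt_two : M.wordAt 2 = L

/-- Register contents. -/
structure Regs (w : ℕ) where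
  word : ℕ → BitVec w
  real : ℕ → ℝ

/-- Write a word register. -/
def Regs.setWord {w : ℕ} (s : Regs w) (d : ℕ) (v : BitVec w) : Regs w :=
  { s with word := Function.update s.word d v }

/-- Write a real register. -/
def Regs.setReal {w : ℕ} (s : Regs w) (d : ℕ) (v : ℝ) : Regs w :=
  { s with real := Function.update s.real d v }

/-- The configuration with given position and register contents. -/
def Regs.at {w : ℕ} (s : Regs w) (pos : ℕ) : Config w := ⟨pos, s.word, s.real⟩

/-- A relocatable code fragment: the code as a function of its position in the program. -/
abbrev Frag := ℕ → List Instr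

/-- Wherever the fragment is placed in a program, it changes the register contents from `s` to
`s'` in at most `T` steps and then continues behind the fragment. -/
def Frag.Runs (F : Frag) (I : Inst) (T : ℕ) (s s' : Regs I.w) : Prop :=
  ∀ (prog : Program) (pos : ℕ), CodeAt prog pos (F pos) →
    ∃ t ≤ T, run prog I.M t (s.at pos) = some (s'.at (pos + (F pos).length))

/-- The fragment with a single instruction. -/
def Frag.single (i : Instr) : Frag := fun _ => [i]

/-- Sequential composition. -/
def Frag.seq (F G : Frag) : Frag := fun pos => F pos ++ G (pos + (F pos).length)

/-- Branching on an instruction `test target`. -/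
def Frag.ite (test : ℕ → Instr) (F G : Frag) : Frag := fun pos =>
  test (pos + 1 + (G (pos + 1)).length + 1) :: (G (pos + 1) ++
    (.jump (pos + 1 + (G (pos + 1)).length + 1 +
      (F (pos + 1 + (G (pos + 1)).length + 1)).length) ::
        F (pos + 1 + (G (pos + 1)).length + 1)))

/-- The loop that runs `F` as often as the memory says, with counter `t` and auxiliary
register `t + 1`. -/
def Frag.loop (t : ℕ) (F : Frag) : Frag := fun pos =>
  .wordConst t 2 :: .wordLoad t t :: .wordConst (t + 1) 0 :: .jumpWordLt (t + 1) t (pos + 5) ::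
    .jump (pos + 5 + (F (pos + 5)).length + 3) :: (F (pos + 5) ++
      [.wordConst (t + 1) 1, .wordOp .sub t t (t + 1), .jump (pos + 2)])

/-- Four bits suffice for the constants in the programs; all larger numbers are read from memory or
computed. -/
theorem Inst.toNat_ofNat (I : Inst) {c : ℕ} (hc : c < 16) : (BitVec.ofNat I.w c).toNat = c := by
  have h : 2 ^ 4 ≤ 2 ^ I.w := Nat.pow_le_pow_right (by norm_num) I.four_le
  rw [BitVec.toNat_ofNat, Nat.mod_eq_of_lt (by omega)]

theorem run_one {w : ℕ} {prog : Program} {M : Memory w} {s s' : Config w} {i : Instr}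
    (hi : prog[s.pc]? = some i) (he : i.exec M s = some s') : run prog M 1 s = some s' := by
  simp [run, step, hi, he]

theorem run_trans {w : ℕ} {prog : Program} {M : Memory w} {t u : ℕ} {s s' s'' : Config w}
    (h : run prog M t s = some s') (h' : run prog M u s' = some s'') :
    run prog M (t + u) s = some s'' := by
  rw [run_add, h, Option.bind_some, h']

namespace Frag.Runs

variable {I : Inst} {F G : Frag} {T U : ℕ} {s s' s'' : Regs I.w}

theorem mono (h : F.Runs I T s s') (hTU : T ≤ U) : F.Runs I U s s' := by
  intro prog pos hc
  obtain ⟨t, ht, h⟩ := h prog pos hc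
  exact ⟨t, ht.trans hTU, h⟩

theorem single {i : Instr} (h : ∀ pos, i.exec I.M (s.at pos) = some (s'.at (pos + 1))) :
    (Frag.single i).Runs I 1 s s' := by
  intro prog pos hc
  exact ⟨1, le_rfl, run_one (CodeAt.head hc) (h pos)⟩

theorem seq (h : F.Runs I T s s') (h' : G.Runs I U s' s'') :
    (F.seq G).Runs I (T + U) s s'' := by
  intro prog pos hc
  obtain ⟨t, ht, h⟩ := h prog pos hc.left
  obtain ⟨u, hu, h'⟩ := h' prog _ hc.right
  refine ⟨t + u, by omega, run_trans h ?_⟩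
  rw [h', Frag.seq, List.length_append, Nat.add_assoc]

/-- The code of `F` is placed behind that of `G`, so this branch costs only the test, whereas `G`
also pays for the jump over `F`. -/
theorem ite_true {test : ℕ → Instr}
    (ht : ∀ pos target, (test target).exec I.M (s.at pos) = some (s.at target))
    (h : F.Runs I T s s') : (Frag.ite test F G).Runs I (T + 1) s s' := by
  intro prog pos hc
  obtain ⟨t, htT, h⟩ := h prog _ hc.tail.right.tail
  refine ⟨1 + t, by omega, run_trans (run_one hc.head (ht _ _)) ?_⟩
  rw [h]
  simp only [Frag.ite, List.length_cons, List.length_append]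
  congr 2
  omega

theorem ite_false {test : ℕ → Instr}
    (ht : ∀ pos target, (test target).exec I.M (s.at pos) = some (s.at (pos + 1)))
    (h : G.Runs I T s s') : (Frag.ite test F G).Runs I (T + 2) s s' := by
  intro prog pos hc
  obtain ⟨t, htT, h⟩ := h prog _ hc.tail.left
  refine ⟨1 + (t + 1), by omega, run_trans (run_one hc.head (ht _ _)) (run_trans h
    (run_one hc.tail.right.head ?_))⟩
  simp only [Frag.ite, List.length_cons, List.length_append, Instr.exec, Regs.at]
  congr 2
  omega

end Frag.Runs

/-- The loop rule: `P k` holds after `k` iterations. -/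
theorem Frag.exists_runs_loop {I : Inst} {F : Frag} {T t : ℕ} (P : ℕ → Regs I.w → Prop)
    (hP : ∀ k s s', (∀ i, i ≠ t → i ≠ t + 1 → s'.word i = s.word i) → s'.real = s.real →
      P k s → P k s')
    (hF : ∀ k s, P k s → ∃ s', F.Runs I T s s' ∧ s'.word t = s.word t ∧ P (k + 1) s')
    {s : Regs I.w} (hs : P 0 s) :
    ∃ s', (Frag.loop t F).Runs I ((I.L + 1) * (T + 5)) s s' ∧ P I.L s' := by
  -- Induction on the counter, starting at the loop head `pos + 2`. A round costs five instructions
  -- besides `F`, and the final failing test costs three.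
  have key : ∀ m k (s : Regs I.w), P k s → (s.word t).toNat = m → ∃ s', P (k + m) s' ∧
      ∀ (prog : Program) (pos : ℕ), CodeAt prog pos (Frag.loop t F pos) →
      ∃ u ≤ m * (T + 5) + 3,
        run prog I.M u (s.at (pos + 2)) = some (s'.at (pos + (Frag.loop t F pos).length)) := by
    intro m
    induction m with
    | zero =>
      intro k s hs hm
      refine ⟨s.setWord (t + 1) (BitVec.ofNat I.w 0), hP k s _ ?_ rfl hs, ?_⟩
      · intro i _ hi
        simp [Regs.setWord, hi]
      · intro prog pos hc
        refine ⟨1 + (1 + 1), by omega, run_trans (run_one hc.tail.tail.head rfl) (run_trans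
          (run_one hc.tail.tail.tail.head (s' := (s.setWord (t + 1) (BitVec.ofNat I.w 0)).at
            (pos + 4)) ?_) (run_one hc.tail.tail.tail.tail.head ?_))⟩
        · simp [Instr.exec, Config.setWord, Regs.at, Regs.setWord, hm]
        · simp [Instr.exec, Regs.at, Frag.loop]
          omega
    | succ m ih =>
      intro k s hs hm
      set s₁ := s.setWord (t + 1) (BitVec.ofNat I.w 0) with hs₁
      have hP₁ : P k s₁ := hP k s _ (by intro i _ hi; simp [hs₁, Regs.setWord, hi]) rfl hs
      obtain ⟨s₂, hr, ht₂, hP₂⟩ := hF k s₁ hP₁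
      set s₃ := (s₂.setWord (t + 1) (BitVec.ofNat I.w 1)) with hs₃
      set s₄ := s₃.setWord t (s₃.word t - s₃.word (t + 1)) with hs₄
      have hP₄ : P (k + 1) s₄ := hP (k + 1) s₂ _
        (by intro i hi hi'; simp [hs₄, hs₃, Regs.setWord, hi, hi']) rfl hP₂
      have hone := I.toNat_ofNat (c := 1) (by norm_num)
      have ht₁ : s₁.word t = s.word t := by simp [hs₁, Regs.setWord]
      have ht₃ : (s₃.word t) = s.word t := by
        rw [← ht₁, ← ht₂]
        simp [hs₃, Regs.setWord]
      have hm₄ : (s₄.word t).toNat = m := by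
        have h1 : s₃.word (t + 1) = BitVec.ofNat I.w 1 := by simp [hs₃, Regs.setWord]
        have h2 : s₄.word t = s.word t - BitVec.ofNat I.w 1 := by
          rw [← ht₃, ← h1]
          simp [hs₄, Regs.setWord]
        rw [h2, BitVec.toNat_sub_of_le, hm, hone]
        · omega
        · rw [BitVec.le_def, hone, hm]
          omega
      obtain ⟨s', hP', hr'⟩ := ih (k + 1) s₄ hP₄ hm₄
      refine ⟨s', by rwa [← Nat.add_assoc, Nat.add_right_comm], ?_⟩
      intro prog pos hc
      obtain ⟨u, hu, hr⟩ := hr prog (pos + 5) hc.tail.tail.tail.tail.tail.left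
      obtain ⟨u', hu', hr'⟩ := hr' prog pos hc
      refine ⟨1 + (1 + (u + (1 + (1 + (1 + u'))))), ?_, run_trans
        (run_one hc.tail.tail.head rfl) (run_trans
          (run_one hc.tail.tail.tail.head (s' := s₁.at (pos + 5)) ?_)
          (run_trans hr (run_trans (run_one hc.tail.tail.tail.tail.tail.right.head rfl)
          (run_trans (run_one hc.tail.tail.tail.tail.tail.right.tail.head rfl)
          (run_trans (run_one hc.tail.tail.tail.tail.tail.right.tail.tail.head
            (s' := s₄.at (pos + 2)) ?_) hr')))))⟩
      · rw [Nat.add_mul]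
        omega
      · simp [Instr.exec, Config.setWord, Regs.at, hs₁, Regs.setWord, hm]
      · simp [Instr.exec, Config.setWord, Regs.at, hs₄, hs₃, Regs.setWord, WordOp.eval]
  have h2 := I.toNat_ofNat (c := 2) (by norm_num)
  have hL : (I.M.word ⟨2, I.two_lt⟩).toNat = I.L := by
    have := I.wordAt_two
    rwa [Memory.wordAt, dif_pos I.two_lt] at this
  set s₁ := (s.setWord t (BitVec.ofNat I.w 2)).setWord t (I.M.word ⟨2, I.two_lt⟩) with hs₁
  obtain ⟨s', hP', hr⟩ := key I.L 0 s₁ (hP 0 s _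
    (by intro i hi _; simp [hs₁, Regs.setWord, hi]) rfl hs) (by simp [hs₁, Regs.setWord, hL])
  refine ⟨s', ?_, by simpa using hP'⟩
  intro prog pos hc
  obtain ⟨u, hu, hr⟩ := hr prog pos hc
  refine ⟨1 + (1 + u), ?_, run_trans (run_one hc.head rfl)
    (run_trans (run_one hc.tail.head (s' := s₁.at (pos + 2)) ?_) hr)⟩
  · rw [Nat.add_mul]
    omega
  · have : ((s.setWord t (BitVec.ofNat I.w 2)).word t).toNat = 2 := by
      simp only [Regs.setWord, Function.update_self, h2]
    simp only [Instr.exec, Config.setWord, Regs.at, Regs.setWord, Function.update_self, h2, hs₁]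
    rw [dif_pos I.two_lt]

/-! ### Functions computed by code fragments -/

/-- The fragment that copies `n` consecutive word registers, in ascending order. -/
def Frag.moveWords (src dst : ℕ) : ℕ → Frag
  | 0 => fun _ => []
  | n + 1 => (Frag.moveWords src dst n).seq (.single (.wordMove (dst + n) (src + n)))

/-- The fragment that copies `n` consecutive real registers, in ascending order. -/
def Frag.moveReals (src dst : ℕ) : ℕ → Frag
  | 0 => fun _ => []
  | n + 1 => (Frag.moveReals src dst n).seq (.single (.realMove (dst + n) (src + n)))

theorem Frag.Runs.nil {I : Inst} (s : Regs I.w) : Frag.Runs (fun _ => []) I 0 s s :=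
  fun _ _ _ => ⟨0, le_rfl, rfl⟩

/-- In a move to lower registers, ascending order reads each register before overwriting it, so
overlap is harmless; moves upwards must be disjoint. -/
theorem Frag.runs_moveWords {I : Inst} (s : Regs I.w) {src dst n : ℕ}
    (h : dst ≤ src ∨ src + n ≤ dst) :
    (Frag.moveWords src dst n).Runs I n s
      { s with word := fun i => if dst ≤ i ∧ i < dst + n then s.word (src + (i - dst))
        else s.word i } := by
  induction n with
  | zero =>
    have h0 : (fun i => if dst ≤ i ∧ i < dst + 0 then s.word (src + (i - dst)) else s.word i) =
        s.word := funext fun i => if_neg (by omega)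
    rw [h0]
    exact Frag.Runs.nil s
  | succ n ih =>
    refine (ih (by omega)).seq (.single fun pos => ?_)
    simp only [Instr.exec, Config.setWord, Regs.at, Option.some.injEq, Config.mk.injEq, and_true,
      true_and]
    funext i
    by_cases hi : i = dst + n
    · subst hi
      simp only [Function.update_self]
      rw [if_neg (by omega), if_pos (by omega), Nat.add_sub_cancel_left]
    · simp only [Function.update_of_ne hi]
      congr 1
      simp only [eq_iff_iff]
      omega

theorem Frag.runs_moveReals {I : Inst} (s : Regs I.w) {src dst n : ℕ}
    (h : dst ≤ src ∨ src + n ≤ dst) :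
    (Frag.moveReals src dst n).Runs I n s
      { s with real := fun i => if dst ≤ i ∧ i < dst + n then s.real (src + (i - dst))
        else s.real i } := by
  induction n with
  | zero =>
    have h0 : (fun i => if dst ≤ i ∧ i < dst + 0 then s.real (src + (i - dst)) else s.real i) =
        s.real := funext fun i => if_neg (by omega)
    rw [h0]
    exact Frag.Runs.nil s
  | succ n ih =>
    refine (ih (by omega)).seq (.single fun pos => ?_)
    simp only [Instr.exec, Config.setReal, Regs.at, Option.some.injEq, Config.mk.injEq, true_and]
    funext i
    by_cases hi : i = dst + n
    · subst hi
      simp only [Function.update_self]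
      rw [if_neg (by omega), if_pos (by omega), Nat.add_sub_cancel_left]
    · simp only [Function.update_of_ne hi]
      congr 1
      simp only [eq_iff_iff]
      omega

/-- Types whose elements are stored in a fixed number of consecutive word and real registers. -/
class Enc (α : Type) where
  numWords : ℕ
  numReals : ℕ
  word : α → ℕ → ℕ
  real : α → ℕ → ℝ

instance : Enc ℕ := ⟨1, 0, fun a _ => a, fun _ _ => 0⟩

noncomputable instance : Enc ℝ := ⟨0, 1, fun _ _ => 0, fun a _ => a⟩

noncomputable instance {α β : Type} [Enc α] [Enc β] : Enc (α × β) where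
  numWords := Enc.numWords α + Enc.numWords β
  numReals := Enc.numReals α + Enc.numReals β
  word p k := if k < Enc.numWords α then Enc.word p.1 k else Enc.word p.2 (k - Enc.numWords α)
  real p k := if k < Enc.numReals α then Enc.real p.1 k else Enc.real p.2 (k - Enc.numReals α)

/-- The registers starting at `b` and `c` store `a`. -/
def Holds {w : ℕ} {α : Type} [Enc α] (s : Regs w) (b c : ℕ) (a : α) : Prop :=
  (∀ k < Enc.numWords α, (s.word (b + k)).toNat = Enc.word a k) ∧
    ∀ k < Enc.numReals α, s.real (c + k) = Enc.real a k

/-- The registers below `b` and `c` agree. -/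
def AgreeBelow {w : ℕ} (b c : ℕ) (s s' : Regs w) : Prop :=
  (∀ k < b, s'.word k = s.word k) ∧ ∀ k < c, s'.real k = s.real k

section

variable {α β γ σ : Type} [Enc α] [Enc β] [Enc γ] [Enc σ] {w b c b' c' : ℕ} {s s' s'' : Regs w}

theorem AgreeBelow.trans (h : AgreeBelow b c s s') (h' : AgreeBelow b c s' s'') :
    AgreeBelow b c s s'' :=
  ⟨fun k hk => (h'.1 k hk).trans (h.1 k hk), fun k hk => (h'.2 k hk).trans (h.2 k hk)⟩

theorem AgreeBelow.mono (h : AgreeBelow b c s s') (hb : b' ≤ b) (hc : c' ≤ c) :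
    AgreeBelow b' c' s s' :=
  ⟨fun k hk => h.1 k (hk.trans_le hb), fun k hk => h.2 k (hk.trans_le hc)⟩

theorem Holds.agree {a : α} (h : Holds s b c a) (hs : AgreeBelow b' c' s s')
    (hb : b + Enc.numWords α ≤ b') (hc : c + Enc.numReals α ≤ c') : Holds s' b c a :=
  ⟨fun k hk => by rw [hs.1 _ (by omega), h.1 k hk],
    fun k hk => by rw [hs.2 _ (by omega), h.2 k hk]⟩

theorem holds_nat {a : ℕ} : Holds s b c a ↔ (s.word b).toNat = a := by
  constructor
  · intro h
    exact h.1 0 Nat.zero_lt_one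
  · intro h
    refine ⟨fun k hk => ?_, fun k hk => absurd hk (Nat.not_lt_zero k)⟩
    obtain rfl : k = 0 := Nat.lt_one_iff.1 hk
    exact h

theorem holds_real {a : ℝ} : Holds s b c a ↔ s.real c = a := by
  constructor
  · intro h
    exact h.2 0 Nat.zero_lt_one
  · intro h
    refine ⟨fun k hk => absurd hk (Nat.not_lt_zero k), fun k hk => ?_⟩
    obtain rfl : k = 0 := Nat.lt_one_iff.1 hk
    exact h

theorem holds_prod {p : α × β} : Holds s b c p ↔
    Holds s b c p.1 ∧ Holds s (b + Enc.numWords α) (c + Enc.numReals α) p.2 := by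
  constructor
  · intro h
    refine ⟨⟨fun k hk => ?_, fun k hk => ?_⟩, ⟨fun k hk => ?_, fun k hk => ?_⟩⟩
    · exact (h.1 k (Nat.lt_add_right _ hk)).trans (if_pos hk)
    · exact (h.2 k (Nat.lt_add_right _ hk)).trans (if_pos hk)
    · rw [Nat.add_assoc]
      refine (h.1 _ (Nat.add_lt_add_left hk _)).trans ((if_neg (by omega)).trans ?_)
      rw [Nat.add_sub_cancel_left]
    · rw [Nat.add_assoc]
      refine (h.2 _ (Nat.add_lt_add_left hk _)).trans ((if_neg (by omega)).trans ?_)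
      rw [Nat.add_sub_cancel_left]
  · intro h
    refine ⟨fun k hk => ?_, fun k hk => ?_⟩
    · change k < Enc.numWords α + Enc.numWords β at hk
      change _ = if k < Enc.numWords α then _ else _
      split_ifs with h'
      · exact h.1.1 k h'
      · rw [← h.2.1 _ (by omega)]
        congr 2
        omega
    · change k < Enc.numReals α + Enc.numReals β at hk
      change _ = if k < Enc.numReals α then _ else _
      split_ifs with h'
      · exact h.1.2 k h'
      · rw [← h.2.2 _ (by omega)]
        congr 1
        omega

/-- There are code fragments, not depending on the memory, that compute `f` with the given
memory, in time `O((L + 1) ^ d)`. The argument is in the registers starting at `b` and `c`, the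
result is written to the registers starting at `p` and `q`, and all registers below these are
preserved. -/
def Realizable (d : ℕ) (f : Inst → α → β) : Prop :=
  ∃ (F : ℕ → ℕ → ℕ → ℕ → Frag) (A : ℕ), ∀ (I : Inst) (a : α) (s : Regs I.w) (b c p q : ℕ),
    b + Enc.numWords α ≤ p → c + Enc.numReals α ≤ q → Holds s b c a →
      ∃ s', (F b c p q).Runs I (A * (I.L + 1) ^ d) s s' ∧ Holds s' p q (f I a) ∧
        AgreeBelow p q s s'

theorem Frag.exists_runs_move {I : Inst} {s : Regs I.w} {a : α} {p q : ℕ}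
    (h : Holds s b c a) (hp : p ≤ b ∨ b + Enc.numWords α ≤ p)
    (hq : q ≤ c ∨ c + Enc.numReals α ≤ q) :
    ∃ s', ((Frag.moveWords b p (Enc.numWords α)).seq
        (Frag.moveReals c q (Enc.numReals α))).Runs I (Enc.numWords α + Enc.numReals α) s s' ∧
      Holds s' p q a ∧ AgreeBelow p q s s' := by
  refine ⟨_, (Frag.runs_moveWords s hp).seq (Frag.runs_moveReals _ hq), ⟨?_, ?_⟩, ⟨?_, ?_⟩⟩
  · intro k hk
    simp only
    rw [if_pos (by omega), Nat.add_sub_cancel_left, h.1 k hk]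
  · intro k hk
    simp only
    rw [if_pos (by omega), Nat.add_sub_cancel_left, h.2 k hk]
  · intro k hk
    simp only
    rw [if_neg (by omega)]
  · intro k hk
    simp only
    rw [if_neg (by omega)]

theorem le_mul_pow (T L d : ℕ) : T ≤ T * (L + 1) ^ d :=
  Nat.le_mul_of_pos_right _ (by positivity)

/-! ### Closure of realizable functions under pairing, composition and branching -/

namespace Realizable

variable {d : ℕ}

theorem id : Realizable d fun (_ : Inst) (a : α) => a := by
  refine ⟨fun b c p q => (Frag.moveWords b p (Enc.numWords α)).seq
    (Frag.moveReals c q (Enc.numReals α)), Enc.numWords α + Enc.numReals α,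
    fun I a s b c p q hb hc h => ?_⟩
  obtain ⟨s', hr, hs⟩ := Frag.exists_runs_move h (Or.inr hb) (Or.inr hc)
  exact ⟨s', hr.mono (le_mul_pow _ _ _), hs⟩

theorem pair {f : Inst → α → β} {g : Inst → α → γ} (hf : Realizable d f)
    (hg : Realizable d g) : Realizable d fun I a => (f I a, g I a) := by
  obtain ⟨F, A, hF⟩ := hf
  obtain ⟨G, B, hG⟩ := hg
  refine ⟨fun b c p q => (F b c p q).seq
    (G b c (p + Enc.numWords β) (q + Enc.numReals β)), A + B, fun I a s b c p q hb hc h => ?_⟩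
  obtain ⟨s', hr, hs, he⟩ := hF I a s b c p q hb hc h
  obtain ⟨s'', hr', hs', he'⟩ := hG I a s' b c (p + Enc.numWords β) (q + Enc.numReals β)
    (by omega) (by omega) (h.agree he hb hc)
  refine ⟨s'', (hr.seq hr').mono (by rw [Nat.add_mul]), holds_prod.2 ⟨?_, hs'⟩, ?_⟩
  · exact hs.agree he' le_rfl le_rfl
  · exact he.trans (he'.mono (by omega) (by omega))

/-- The intermediate value is written where the result belongs, `g` works above it, and its result
is then moved down over it. -/
theorem comp {g : Inst → β → γ} {f : Inst → α → β} (hg : Realizable d g)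
    (hf : Realizable d f) : Realizable d fun I a => g I (f I a) := by
  obtain ⟨F, A, hF⟩ := hf
  obtain ⟨G, B, hG⟩ := hg
  refine ⟨fun b c p q => (F b c p q).seq
    ((G p q (p + Enc.numWords β) (q + Enc.numReals β)).seq
      ((Frag.moveWords (p + Enc.numWords β) p (Enc.numWords γ)).seq
        (Frag.moveReals (q + Enc.numReals β) q (Enc.numReals γ)))),
    A + (B + (Enc.numWords γ + Enc.numReals γ)), fun I a s b c p q hb hc h => ?_⟩
  obtain ⟨s', hr, hs, he⟩ := hF I a s b c p q hb hc h
  obtain ⟨s'', hr', hs', he'⟩ := hG I (f I a) s' p q (p + Enc.numWords β) (q + Enc.numReals β)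
    (by omega) (by omega) hs
  obtain ⟨s₃, hr₃, hs₃, he₃⟩ := Frag.exists_runs_move (p := p) (q := q) hs'
    (by omega) (by omega)
  refine ⟨s₃, (hr.seq (hr'.seq hr₃)).mono ?_, hs₃,
    he.trans ((he'.mono (by omega) (by omega)).trans he₃)⟩
  have := le_mul_pow (Enc.numWords γ + Enc.numReals γ) I.L d
  rw [Nat.add_mul, Nat.add_mul B]
  omega

/-- The same code serves, as the first component occupies the initial registers of a pair and
registers above the result are free. -/
theorem fst {f : Inst → α → β × γ} (hf : Realizable d f) :
    Realizable d fun I a => (f I a).1 := by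
  obtain ⟨F, A, hF⟩ := hf
  refine ⟨F, A, fun I a s b c p q hb hc h => ?_⟩
  obtain ⟨s', hr, hs, he⟩ := hF I a s b c p q hb hc h
  exact ⟨s', hr, (holds_prod.1 hs).1, he⟩

theorem snd {f : Inst → α → β × γ} (hf : Realizable d f) :
    Realizable d fun I a => (f I a).2 := by
  refine comp (g := fun _ (p : β × γ) => p.2) ?_ hf
  refine ⟨fun b c p q => (Frag.moveWords (b + Enc.numWords β) p (Enc.numWords γ)).seq
    (Frag.moveReals (c + Enc.numReals β) q (Enc.numReals γ)), Enc.numWords γ + Enc.numReals γ,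
    fun I a s b c p q hb hc h => ?_⟩
  obtain ⟨s', hr, hs⟩ := Frag.exists_runs_move (p := p) (q := q) (holds_prod.1 h).2
    (Or.inr ((Nat.add_assoc b _ _).trans_le hb)) (Or.inr ((Nat.add_assoc c _ _).trans_le hc))
  exact ⟨s', hr.mono (le_mul_pow _ _ _), hs⟩

/-- Common form of the branches on words and on reals: `F` prepares the operands at `p`, `q`, and
one jump instruction decides `f`. -/
theorem ite_of_test {f : Inst → α → Prop} [∀ I a, Decidable (f I a)] {g h : Inst → α → β}
    (hf : ∃ (F : ℕ → ℕ → ℕ → ℕ → Frag) (test : ℕ → ℕ → ℕ → Instr) (A : ℕ),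
      ∀ (I : Inst) (a : α) (s : Regs I.w) (b c p q : ℕ),
      b + Enc.numWords α ≤ p → c + Enc.numReals α ≤ q → Holds s b c a →
      ∃ s', (F b c p q).Runs I (A * (I.L + 1) ^ d) s s' ∧
        (∀ pos target, (test p q target).exec I.M (s'.at pos) =
          some (s'.at (if f I a then target else pos + 1))) ∧
        AgreeBelow p q s s')
    (hg : Realizable d g) (hh : Realizable d h) :
    Realizable d fun I a => if f I a then g I a else h I a := by
  obtain ⟨F, test, A, hF⟩ := hf
  obtain ⟨G, B, hG⟩ := hg
  obtain ⟨H, C, hH⟩ := hh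
  refine ⟨fun b c p q => (F b c p q).seq (Frag.ite (test p q) (G b c p q) (H b c p q)),
    A + (B + C + 2), fun I a s b c p q hb hc h => ?_⟩
  obtain ⟨s', hr, ht, he⟩ := hF I a s b c p q hb hc h
  have h2 := le_mul_pow 2 I.L d
  simp only [Nat.add_mul]
  by_cases hfa : f I a
  · obtain ⟨s'', hr', hs', he'⟩ := hG I a s' b c p q hb hc (h.agree he hb hc)
    refine ⟨s'', (hr.seq (.ite_true (fun pos target => ?_) hr')).mono (by omega), ?_,
      he.trans he'⟩
    · rw [ht, if_pos hfa]
    · rwa [if_pos hfa]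
  · obtain ⟨s'', hr', hs', he'⟩ := hH I a s' b c p q hb hc (h.agree he hb hc)
    refine ⟨s'', (hr.seq (.ite_false (fun pos target => ?_) hr')).mono (by omega), ?_,
      he.trans he'⟩
    · rw [ht, if_neg hfa]
    · rwa [if_neg hfa]

theorem ite_nat {f f' : Inst → α → ℕ} {g h : Inst → α → β}
    [∀ I a, Decidable (f I a < f' I a)] (hf : Realizable d f) (hf' : Realizable d f')
    (hg : Realizable d g) (hh : Realizable d h) :
    Realizable d fun I a => if f I a < f' I a then g I a else h I a := by
  refine ite_of_test ?_ hg hh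
  obtain ⟨F, A, hF⟩ := hf.pair hf'
  refine ⟨F, fun p _ => Instr.jumpWordLt p (p + 1), A, fun I a s b c p q hb hc h => ?_⟩
  obtain ⟨s', hr, hs, he⟩ := hF I a s b c p q hb hc h
  refine ⟨s', hr, fun pos target => ?_, he⟩
  obtain ⟨h1, h2⟩ := holds_prod.1 hs
  simp only [Instr.exec, Regs.at, holds_nat.1 h1]
  rw [show (s'.word (p + 1)).toNat = f' I a from holds_nat.1 h2]
  congr

theorem ite_real {f f' : Inst → α → ℝ} {g h : Inst → α → β}
    [∀ I a, Decidable (f I a < f' I a)] (hf : Realizable d f) (hf' : Realizable d f')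
    (hg : Realizable d g) (hh : Realizable d h) :
    Realizable d fun I a => if f I a < f' I a then g I a else h I a := by
  refine ite_of_test ?_ hg hh
  obtain ⟨F, A, hF⟩ := hf.pair hf'
  refine ⟨F, fun _ q => Instr.jumpRealLt q (q + 1), A, fun I a s b c p q hb hc h => ?_⟩
  obtain ⟨s', hr, hs, he⟩ := hF I a s b c p q hb hc h
  refine ⟨s', hr, fun pos target => ?_, he⟩
  obtain ⟨h1, h2⟩ := holds_prod.1 hs
  simp only [Instr.exec, Regs.at, holds_real.1 h1]
  rw [show s'.real (q + 1) = f' I a from holds_real.1 h2]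
  congr

theorem of_instr {f : Inst → α → β} {g : Inst → β → γ} (hf : Realizable d f)
    (i : ℕ → ℕ → Instr)
    (hg : ∀ (I : Inst) (x : β) (s : Regs I.w) (p q : ℕ), Holds s p q x →
      ∃ s' : Regs I.w, (∀ pos, (i p q).exec I.M (s.at pos) = some (s'.at (pos + 1))) ∧
        Holds s' p q (g I x) ∧ AgreeBelow p q s s') :
    Realizable d fun I a => g I (f I a) := by
  obtain ⟨F, A, hF⟩ := hf
  refine ⟨fun b c p q => (F b c p q).seq (.single (i p q)), A + 1,
    fun I a s b c p q hb hc h => ?_⟩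
  obtain ⟨s', hr, hs, he⟩ := hF I a s b c p q hb hc h
  obtain ⟨s'', hi, hs', he'⟩ := hg I _ s' p q hs
  refine ⟨s'', (hr.seq (.single hi)).mono ?_, hs', he.trans he'⟩
  have := le_mul_pow 1 I.L d
  rw [Nat.add_mul]
  omega

end Realizable

theorem agreeBelow_setWord {v : BitVec w} (h : b ≤ b') :
    AgreeBelow b c s (s.setWord b' v) :=
  ⟨fun k hk => Function.update_of_ne (by omega) _ _, fun _ _ => rfl⟩

theorem agreeBelow_setReal {v : ℝ} (h : c ≤ c') : AgreeBelow b c s (s.setReal c' v) :=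
  ⟨fun _ _ => rfl, fun k hk => Function.update_of_ne (by omega) _ _⟩

theorem setWord_word_self {v : BitVec w} : (s.setWord b v).word b = v := Function.update_self ..

theorem setReal_real_self {v : ℝ} : (s.setReal b v).real b = v := Function.update_self ..

/-- Addition of words. -/
def wadd (I : Inst) (a b : ℕ) : ℕ := (a + b) % 2 ^ I.w

/-- Subtraction of words. -/
def wsub (I : Inst) (a b : ℕ) : ℕ := (2 ^ I.w - b + a) % 2 ^ I.w

/-- Multiplication of words. -/
def wmul (I : Inst) (a b : ℕ) : ℕ := a * b % 2 ^ I.w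

theorem wadd_eq {I : Inst} {a b : ℕ} (h : a + b < 2 ^ I.w) : wadd I a b = a + b :=
  Nat.mod_eq_of_lt h

theorem wmul_eq {I : Inst} {a b : ℕ} (h : a * b < 2 ^ I.w) : wmul I a b = a * b :=
  Nat.mod_eq_of_lt h

theorem wsub_eq {I : Inst} {a b : ℕ} (h : b ≤ a) (ha : a < 2 ^ I.w) : wsub I a b = a - b := by
  rw [wsub, show 2 ^ I.w - b + a = a - b + 2 ^ I.w by omega, Nat.add_mod_right,
    Nat.mod_eq_of_lt (by omega)]

/-! ### Machine operations, memory access and loops -/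

namespace Realizable

variable {d : ℕ}

theorem const {k : ℕ} (hk : k < 16) : Realizable d fun (_ : Inst) (_ : α) => k := by
  refine ⟨fun _ _ p _ => .single (.wordConst p k), 1, fun I a s b c p q hb hc h => ?_⟩
  refine ⟨s.setWord p (BitVec.ofNat I.w k),
    (Frag.Runs.single fun pos => rfl).mono (le_mul_pow _ _ _), ?_, agreeBelow_setWord le_rfl⟩
  rw [holds_nat, setWord_word_self, I.toNat_ofNat hk]

theorem zero : Realizable d fun (_ : Inst) (_ : α) => (0 : ℝ) := by
  -- The machine has no real constants; zero is obtained by subtracting a register from itself.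
  refine ⟨fun _ _ _ q => .single (.realSub q q q), 1, fun I a s b c p q hb hc h => ?_⟩
  refine ⟨s.setReal q (s.real q - s.real q),
    (Frag.Runs.single fun pos => rfl).mono (le_mul_pow _ _ _), ?_, agreeBelow_setReal le_rfl⟩
  rw [holds_real, setReal_real_self, sub_self]

theorem wordOp {f g : Inst → α → ℕ} (op : WordOp) {o : Inst → ℕ → ℕ → ℕ}
    (ho : ∀ (I : Inst) (x y : BitVec I.w), (op.eval x y).toNat = o I x.toNat y.toNat)
    (hf : Realizable d f) (hg : Realizable d g) :
    Realizable d fun I a => o I (f I a) (g I a) := by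
  refine of_instr (g := fun I (p : ℕ × ℕ) => o I p.1 p.2) (hf.pair hg)
    (fun p _ => .wordOp op p p (p + 1)) fun I x s p q hs => ?_
  obtain ⟨h1, h2⟩ := holds_prod.1 hs
  refine ⟨s.setWord p (op.eval (s.word p) (s.word (p + 1))), fun pos => rfl, ?_,
    agreeBelow_setWord le_rfl⟩
  rw [holds_nat, setWord_word_self, ho, holds_nat.1 h1]
  congr 1
  exact holds_nat.1 h2

theorem wadd {f g : Inst → α → ℕ} (hf : Realizable d f) (hg : Realizable d g) :
    Realizable d fun I a => wadd I (f I a) (g I a) :=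
  wordOp .add (fun _ x y => BitVec.toNat_add x y) hf hg

theorem wsub {f g : Inst → α → ℕ} (hf : Realizable d f) (hg : Realizable d g) :
    Realizable d fun I a => wsub I (f I a) (g I a) :=
  wordOp .sub (fun _ x y => BitVec.toNat_sub x y) hf hg

theorem wmul {f g : Inst → α → ℕ} (hf : Realizable d f) (hg : Realizable d g) :
    Realizable d fun I a => wmul I (f I a) (g I a) :=
  wordOp .mul (fun _ x y => BitVec.toNat_mul x y) hf hg

theorem div {f g : Inst → α → ℕ} (hf : Realizable d f) (hg : Realizable d g) :
    Realizable d fun I a => f I a / g I a :=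
  wordOp (o := fun _ x y => x / y) .div (fun _ _ _ => BitVec.toNat_udiv) hf hg

theorem mod {f g : Inst → α → ℕ} (hf : Realizable d f) (hg : Realizable d g) :
    Realizable d fun I a => f I a % g I a :=
  wordOp (o := fun _ x y => x % y) .mod (fun _ _ _ => BitVec.toNat_umod) hf hg

theorem add {f g : Inst → α → ℝ} (hf : Realizable d f) (hg : Realizable d g) :
    Realizable d fun I a => f I a + g I a := by
  refine of_instr (g := fun I (p : ℝ × ℝ) => p.1 + p.2) (hf.pair hg)
    (fun _ q => .realAdd q q (q + 1)) fun I x s p q hs => ?_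
  obtain ⟨h1, h2⟩ := holds_prod.1 hs
  refine ⟨s.setReal q (s.real q + s.real (q + 1)), fun pos => rfl, ?_,
    agreeBelow_setReal le_rfl⟩
  rw [holds_real, setReal_real_self, holds_real.1 h1]
  congr 1
  exact holds_real.1 h2

theorem sub {f g : Inst → α → ℝ} (hf : Realizable d f) (hg : Realizable d g) :
    Realizable d fun I a => f I a - g I a := by
  refine of_instr (g := fun I (p : ℝ × ℝ) => p.1 - p.2) (hf.pair hg)
    (fun _ q => .realSub q q (q + 1)) fun I x s p q hs => ?_
  obtain ⟨h1, h2⟩ := holds_prod.1 hs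
  refine ⟨s.setReal q (s.real q - s.real (q + 1)), fun pos => rfl, ?_,
    agreeBelow_setReal le_rfl⟩
  rw [holds_real, setReal_real_self, holds_real.1 h1]
  congr 1
  exact holds_real.1 h2

/-- A load out of bounds would stop the machine, so the address is first compared with the number of
words, stored in word 0. This makes memory access a total function. For reals the bound is in word
1. -/
theorem wordAt {f : Inst → α → ℕ} (hf : Realizable d f) :
    Realizable d fun I a => I.M.wordAt (f I a) := by
  obtain ⟨F, A, hF⟩ := hf
  refine ⟨fun b c p q => (F b c p q).seq ((Frag.single (.wordConst (p + 1) 0)).seq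
    ((Frag.single (.wordLoad (p + 1) (p + 1))).seq (Frag.ite (.jumpWordLt p (p + 1))
      (.single (.wordLoad p p)) (.single (.wordConst p 0))))), A + 5,
    fun I a s b c p q hb hc h => ?_⟩
  obtain ⟨s', hr, hs, he⟩ := hF I a s b c p q hb hc h
  have h0 : 0 < I.M.numWords := Nat.zero_lt_of_lt I.two_lt
  have hN : (I.M.word ⟨0, h0⟩).toNat = I.M.numWords := by
    have := I.wordAt_zero
    rwa [Memory.wordAt, dif_pos h0] at this
  set s₁ := s'.setWord (p + 1) (BitVec.ofNat I.w 0) with hs₁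
  set s₂ := s₁.setWord (p + 1) (I.M.word ⟨0, h0⟩) with hs₂
  have hp : s₂.word p = s'.word p := by simp [hs₂, hs₁, Regs.setWord]
  have hp' : s₂.word (p + 1) = I.M.word ⟨0, h0⟩ := by simp [hs₂, Regs.setWord]
  have hr₁ : (Frag.single (.wordConst (p + 1) 0)).Runs I 1 s' s₁ := .single fun _ => rfl
  have hr₂ : (Frag.single (.wordLoad (p + 1) (p + 1))).Runs I 1 s₁ s₂ := by
    refine .single fun pos => ?_
    have : ((s₁.at pos).wordReg (p + 1)).toNat = 0 := by simp [hs₁, Regs.at, Regs.setWord]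
    simp only [Instr.exec, this]
    rw [dif_pos h0]
    rfl
  have he₂ : AgreeBelow p q s' s₂ :=
    (agreeBelow_setWord (Nat.le_succ p)).trans (agreeBelow_setWord (Nat.le_succ p))
  have h5 := le_mul_pow 5 I.L d
  simp only [Nat.add_mul]
  rw [holds_nat] at hs
  by_cases hlt : f I a < I.M.numWords
  · refine ⟨s₂.setWord p (I.M.word ⟨f I a, hlt⟩), (hr.seq (hr₁.seq (hr₂.seq (.ite_true
      (fun pos target => ?_) (.single fun pos => ?_))))).mono (U := A * (I.L + 1) ^ d + 5 * _)
      (by omega), ?_, he.trans (he₂.trans (agreeBelow_setWord le_rfl))⟩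
    · simp only [Instr.exec, Regs.at, hp, hp', hs, hN]
      rw [if_pos hlt]
    · simp only [Instr.exec, Regs.at, hp, hs]
      rw [dif_pos hlt]
      rfl
    · rw [holds_nat, setWord_word_self, Memory.wordAt, dif_pos hlt]
  · refine ⟨s₂.setWord p (BitVec.ofNat I.w 0), (hr.seq (hr₁.seq (hr₂.seq (.ite_false
      (fun pos target => ?_) (.single fun pos => rfl))))).mono
      (U := A * (I.L + 1) ^ d + 5 * _) (by omega), ?_,
      he.trans (he₂.trans (agreeBelow_setWord le_rfl))⟩
    · simp only [Instr.exec, Regs.at, hp, hp', hs, hN]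
      rw [if_neg hlt]
    · rw [holds_nat, setWord_word_self, Memory.wordAt, dif_neg hlt]
      simp

theorem realAt {f : Inst → α → ℕ} (hf : Realizable d f) :
    Realizable d fun I a => I.M.realAt (f I a) := by
  obtain ⟨F, A, hF⟩ := hf
  refine ⟨fun b c p q => (F b c p q).seq ((Frag.single (.wordConst (p + 1) 1)).seq
    ((Frag.single (.wordLoad (p + 1) (p + 1))).seq (Frag.ite (.jumpWordLt p (p + 1))
      (.single (.realLoad q p)) (.single (.realSub q q q))))), A + 5,
    fun I a s b c p q hb hc h => ?_⟩
  obtain ⟨s', hr, hs, he⟩ := hF I a s b c p q hb hc h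
  have h1 : 1 < I.M.numWords := Nat.lt_of_succ_lt I.two_lt
  have hN : (I.M.word ⟨1, h1⟩).toNat = I.M.numReals := by
    have := I.wordAt_one
    rwa [Memory.wordAt, dif_pos h1] at this
  set s₁ := s'.setWord (p + 1) (BitVec.ofNat I.w 1) with hs₁
  set s₂ := s₁.setWord (p + 1) (I.M.word ⟨1, h1⟩) with hs₂
  have hp : s₂.word p = s'.word p := by simp [hs₂, hs₁, Regs.setWord]
  have hp' : s₂.word (p + 1) = I.M.word ⟨1, h1⟩ := by simp [hs₂, Regs.setWord]
  have hr₁ : (Frag.single (.wordConst (p + 1) 1)).Runs I 1 s' s₁ := .single fun _ => rfl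
  have hr₂ : (Frag.single (.wordLoad (p + 1) (p + 1))).Runs I 1 s₁ s₂ := by
    refine .single fun pos => ?_
    have : ((s₁.at pos).wordReg (p + 1)).toNat = 1 := by
      simp only [hs₁, Regs.at, Regs.setWord, Function.update_self]
      exact I.toNat_ofNat (by norm_num)
    simp only [Instr.exec, this]
    rw [dif_pos h1]
    rfl
  have he₂ : AgreeBelow p q s' s₂ :=
    (agreeBelow_setWord (Nat.le_succ p)).trans (agreeBelow_setWord (Nat.le_succ p))
  have h5 := le_mul_pow 5 I.L d
  simp only [Nat.add_mul]
  rw [holds_nat] at hs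
  by_cases hlt : f I a < I.M.numReals
  · refine ⟨s₂.setReal q (I.M.real ⟨f I a, hlt⟩), (hr.seq (hr₁.seq (hr₂.seq (.ite_true
      (fun pos target => ?_) (.single fun pos => ?_))))).mono (U := A * (I.L + 1) ^ d + 5 * _)
      (by omega), ?_, he.trans (he₂.trans (agreeBelow_setReal le_rfl))⟩
    · simp only [Instr.exec, Regs.at, hp, hp', hs, hN]
      rw [if_pos hlt]
    · simp only [Instr.exec, Regs.at, hp, hs]
      rw [dif_pos hlt]
      rfl
    · rw [holds_real, setReal_real_self, Memory.realAt, dif_pos hlt]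
  · refine ⟨s₂.setReal q (s₂.real q - s₂.real q), (hr.seq (hr₁.seq (hr₂.seq (.ite_false
      (fun pos target => ?_) (.single fun pos => rfl))))).mono
      (U := A * (I.L + 1) ^ d + 5 * _) (by omega), ?_,
      he.trans (he₂.trans (agreeBelow_setReal le_rfl))⟩
    · simp only [Instr.exec, Regs.at, hp, hp', hs, hN]
      rw [if_neg hlt]
    · rw [holds_real, setReal_real_self, Memory.realAt, dif_neg hlt, sub_self]

/-- Iterating a function `L` times costs a factor of `L + 1`. -/
theorem iterate {f : Inst → α → σ → σ} {g : Inst → α → σ}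
    (hf : Realizable d fun I (p : α × σ) => f I p.1 p.2) (hg : Realizable (d + 1) g) :
    Realizable (d + 1) fun I a => (f I a)^[I.L] (g I a) := by
  obtain ⟨F, A, hF⟩ := hf
  obtain ⟨G, B, hG⟩ := (id (d := d + 1)).pair hg
  set m := Enc.numWords σ + Enc.numReals σ with hm
  -- Word registers `p` and `p + 1` serve the loop counter. Above them lie the argument and the
  -- current state; each round computes the new state behind these and moves it down.
  refine ⟨fun b c p q =>
    (G b c (p + 2) q).seq ((Frag.loop p
      ((F (p + 2) q (p + 2 + Enc.numWords α + Enc.numWords σ)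
        (q + Enc.numReals α + Enc.numReals σ)).seq
      ((Frag.moveWords (p + 2 + Enc.numWords α + Enc.numWords σ) (p + 2 + Enc.numWords α)
        (Enc.numWords σ)).seq (Frag.moveReals (q + Enc.numReals α + Enc.numReals σ)
          (q + Enc.numReals α) (Enc.numReals σ))))).seq
      ((Frag.moveWords (p + 2 + Enc.numWords α) p (Enc.numWords σ)).seq
        (Frag.moveReals (q + Enc.numReals α) q (Enc.numReals σ)))),
    B + ((A + m + 5) + m), fun I a s b c p q hb hc h => ?_⟩
  obtain ⟨s₀, hr₀, hs₀, he₀⟩ := hG I a s b c (p + 2) q (by omega) hc h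
  have hloop := Frag.exists_runs_loop (I := I) (t := p)
    (F := (F (p + 2) q (p + 2 + Enc.numWords α + Enc.numWords σ)
        (q + Enc.numReals α + Enc.numReals σ)).seq
      ((Frag.moveWords (p + 2 + Enc.numWords α + Enc.numWords σ) (p + 2 + Enc.numWords α)
        (Enc.numWords σ)).seq (Frag.moveReals (q + Enc.numReals α + Enc.numReals σ)
          (q + Enc.numReals α) (Enc.numReals σ)))) (T := A * (I.L + 1) ^ d + m)
    (fun k s' => Holds s' (p + 2) q (a, (f I a)^[k] (g I a)) ∧ AgreeBelow p q s s')
    ?_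
    ?_ (s := s₀) ⟨hs₀, he₀.mono (Nat.le_add_right _ _) le_rfl⟩
  · obtain ⟨s₁, hr₁, hs₁, he₁⟩ := hloop
    obtain ⟨s₂, hr₂, hs₂, he₂⟩ := Frag.exists_runs_move (p := p) (q := q)
      (holds_prod.1 hs₁).2 (Or.inl (by omega)) (Or.inl (by omega))
    refine ⟨s₂, (hr₀.seq (hr₁.seq hr₂)).mono ?_, hs₂, he₁.trans he₂⟩
    have := le_mul_pow m I.L (d + 1)
    have h' : (I.L + 1) * (A * (I.L + 1) ^ d + m + 5) ≤ (A + m + 5) * (I.L + 1) ^ (d + 1) := by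
      have := Nat.mul_le_mul_left (I.L + 1) (le_mul_pow (m + 5) I.L d)
      calc _ = (I.L + 1) * (A * (I.L + 1) ^ d) + (I.L + 1) * (m + 5) := by ring
        _ ≤ (I.L + 1) * (A * (I.L + 1) ^ d) + (I.L + 1) * ((m + 5) * (I.L + 1) ^ d) := by omega
        _ = _ := by ring
    rw [Nat.add_mul B, Nat.add_mul (A + m + 5) m]
    omega
  · rintro k s' s'' hw hre ⟨h1, h2⟩
    refine ⟨⟨fun i hi => ?_, fun i hi => ?_⟩, ⟨fun i hi => ?_, fun i hi => ?_⟩⟩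
    · rw [hw _ (by omega) (by omega)]
      exact h1.1 i hi
    · rw [hre]
      exact h1.2 i hi
    · rw [hw _ (by omega) (by omega)]
      exact h2.1 i hi
    · rw [hre]
      exact h2.2 i hi
  · rintro k s' ⟨h1, h2⟩
    obtain ⟨s₂, hr₂, hs₂, he₂⟩ := hF I _ s' (p + 2) q
      (p + 2 + Enc.numWords α + Enc.numWords σ) (q + Enc.numReals α + Enc.numReals σ)
      (Nat.add_assoc _ _ _).ge (Nat.add_assoc _ _ _).ge h1
    obtain ⟨s₃, hr₃, hs₃, he₃⟩ := Frag.exists_runs_move (p := p + 2 + Enc.numWords α)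
      (q := q + Enc.numReals α) hs₂ (Or.inl (by omega)) (Or.inl (by omega))
    have he₄ : AgreeBelow (p + 2 + Enc.numWords α) (q + Enc.numReals α) s' s₃ :=
      (he₂.mono (by omega) (by omega)).trans he₃
    refine ⟨s₃, hr₂.seq hr₃, he₄.1 p (by omega), holds_prod.2 ⟨?_, ?_⟩,
      h2.trans (he₄.mono (by omega) (by omega))⟩
    · exact (holds_prod.1 h1).1.agree he₄ le_rfl le_rfl
    · rw [Function.iterate_succ_apply']
      exact hs₃

theorem of_eq {f g : Inst → α → β} (hf : Realizable d f) (h : ∀ I a, g I a = f I a) :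
    Realizable d g := by
  rwa [show g = f from funext fun I => funext (h I)]

theorem min_nat {f g : Inst → α → ℕ} (hf : Realizable d f) (hg : Realizable d g) :
    Realizable d fun I a => min (f I a) (g I a) :=
  (ite_nat hf hg hf hg).of_eq fun _ _ => by
    split_ifs with h
    · exact min_eq_left h.le
    · exact min_eq_right (not_lt.1 h)

theorem max_nat {f g : Inst → α → ℕ} (hf : Realizable d f) (hg : Realizable d g) :
    Realizable d fun I a => max (f I a) (g I a) :=
  (ite_nat hf hg hg hf).of_eq fun _ _ => by
    split_ifs with h
    · exact max_eq_right h.le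
    · exact max_eq_left (not_lt.1 h)

theorem min_real {f g : Inst → α → ℝ} (hf : Realizable d f) (hg : Realizable d g) :
    Realizable d fun I a => min (f I a) (g I a) :=
  (ite_real hf hg hf hg).of_eq fun _ _ => by
    split_ifs with h
    · exact min_eq_left h.le
    · exact min_eq_right (not_lt.1 h)

theorem max_real {f g : Inst → α → ℝ} (hf : Realizable d f) (hg : Realizable d g) :
    Realizable d fun I a => max (f I a) (g I a) :=
  (ite_real hf hg hg hf).of_eq fun _ _ => by
    split_ifs with h
    · exact max_eq_right h.le
    · exact max_eq_left (not_lt.1 h)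

end Realizable

end

/-- A realizable function of the query whose result is the answer gives a program. -/
theorem Realizable.exists_program {d : ℕ}
    {f : Inst → (ℝ × ℝ) × (ℝ × ℝ) → ℝ × (ℝ × ℝ) × (ℝ × ℝ) × (ℝ × ℝ)}
    (hf : Realizable d f) : ∃ (prog : Program) (A : ℕ), ∀ (I : Inst) (a b : ℝ × ℝ),
      ∃ (t : ℕ) (s : Config I.w), HaltsIn prog I.M (queryConfig I.w a b) t s ∧
        t ≤ A * (I.L + 1) ^ d ∧ outSide s = (f I (a, b)).1 ∧
        outCorner 3 s = ![(f I (a, b)).2.1, (f I (a, b)).2.2.1, (f I (a, b)).2.2.2] := by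
  obtain ⟨F, A, hF⟩ := hf
  -- The query occupies the real registers 0 to 3. The seven reals of the answer are computed from
  -- register 4 on and then moved down to the output registers.
  set G : Frag := (F 0 0 0 4).seq ((Frag.moveWords 0 0 0).seq (Frag.moveReals 4 0 7)) with hG
  refine ⟨G 0 ++ [.halt], A + 7, fun I a b => ?_⟩
  set s₀ : Regs I.w := ⟨(queryConfig I.w a b).wordReg, (queryConfig I.w a b).realReg⟩ with hs₀
  have h₀ : Holds s₀ 0 0 (a, b) := by
    simp only [holds_prod, holds_real]
    exact ⟨⟨rfl, rfl⟩, ⟨rfl, rfl⟩⟩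
  obtain ⟨s₁, hr₁, hs₁, -⟩ := hF I (a, b) s₀ 0 0 0 4 le_rfl le_rfl h₀
  obtain ⟨s₂, hr₂, hs₂, -⟩ := Frag.exists_runs_move (p := 0) (q := 0) hs₁ (Or.inl le_rfl)
    (Or.inl (Nat.zero_le _))
  obtain ⟨t, ht, hr⟩ := hr₁.seq hr₂ (G 0 ++ [.halt]) 0 (by
    intro k hk
    rw [Nat.zero_add]
    exact List.getElem?_append_left hk)
  refine ⟨t, s₂.at (G 0).length, ⟨?_, ?_⟩, ?_, ?_, ?_⟩
  · rw [Nat.zero_add] at hr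
    exact hr
  · simp [Regs.at]
  · have := le_mul_pow 7 I.L d
    rw [Nat.add_mul]
    exact ht.trans (Nat.add_le_add_left this _)
  · simp only [holds_prod, holds_real] at hs₂
    exact hs₂.1
  · simp only [holds_prod, holds_real] at hs₂
    obtain ⟨-, ⟨h1, h2⟩, ⟨h3, h4⟩, ⟨h5, h6⟩⟩ := hs₂
    funext i
    fin_cases i
    · exact Prod.ext h1 h2
    · exact Prod.ext h3 h4
    · exact Prod.ext h5 h6

/-! ### Wavelet matrices -/

/-- The predicate that the binary digit of `u` at position `h` is zero. -/
def lowBit (h u : ℕ) : Bool := u / 2 ^ h % 2 == 0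

/-- Stable partition of a list by the binary digit at position `h`. -/
def stableSplit (h : ℕ) (l : List ℕ) : List ℕ :=
  l.filter (lowBit h) ++ l.filter (fun u => !lowBit h u)

/-- The `ℓ`-th level of the wavelet matrix of a list of numbers with `L` binary digits. -/
def waveletLevel (L : ℕ) (A : List ℕ) : ℕ → List ℕ
  | 0 => A
  | ℓ + 1 => stableSplit (L - 1 - ℓ) (waveletLevel L A ℓ)

/-- The number of zeros among the first `i` digits of the `ℓ`-th level. -/
def zerosBefore (L : ℕ) (A : List ℕ) (ℓ i : ℕ) : ℕ :=
  ((waveletLevel L A ℓ).take i).countP (lowBit (L - 1 - ℓ))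

/-- The entries of a list at the positions from `i` to `j - 1`. -/
def segment (l : List ℕ) (i j : ℕ) : List ℕ := (l.take j).drop i

theorem length_stableSplit (h : ℕ) (l : List ℕ) : (stableSplit h l).length = l.length := by
  rw [stableSplit, List.length_append, ← List.countP_eq_length_filter,
    ← List.countP_eq_length_filter, List.length_eq_countP_add_countP (lowBit h)]
  simp

theorem length_waveletLevel (L : ℕ) (A : List ℕ) (ℓ : ℕ) :
    (waveletLevel L A ℓ).length = A.length := by
  induction ℓ with
  | zero => rfl
  | succ ℓ ih => rw [waveletLevel, length_stableSplit, ih]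

theorem segment_append (X Y Z : List ℕ) :
    segment (X ++ Y ++ Z) X.length (X.length + Y.length) = Y := by
  rw [segment, ← List.length_append, List.take_left, List.drop_left]

theorem take_append_segment_append_drop (l : List ℕ) {i j : ℕ} (h : i ≤ j) :
    l.take i ++ segment l i j ++ l.drop j = l := by
  have : l.take i = (l.take j).take i := by rw [List.take_take, min_eq_left h]
  rw [segment, this, List.take_append_drop, List.take_append_drop]

theorem countP_take_add_segment (p : ℕ → Bool) (l : List ℕ) {i j : ℕ} (h : i ≤ j) :
    (l.take i).countP p + (segment l i j).countP p = (l.take j).countP p := by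
  have : l.take i = (l.take j).take i := by rw [List.take_take, min_eq_left h]
  rw [segment, this, ← List.countP_append, List.take_append_drop]

/-- Filtering keeps the order, so a segment of `l` becomes a segment of the filtered list, whose
ends are the numbers of kept entries before the old ends. The two cases of a wavelet descent are
instances. -/
theorem segment_filter_append (p : ℕ → Bool) (U V l : List ℕ) {i j : ℕ} (h : i ≤ j) :
    segment (U ++ l.filter p ++ V) (U.length + (l.take i).countP p)
      (U.length + (l.take j).countP p) = (segment l i j).filter p := by
  have hl : U ++ l.filter p ++ V = (U ++ (l.take i).filter p) ++ (segment l i j).filter p ++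
      ((l.drop j).filter p ++ V) := by
    conv_lhs => rw [← take_append_segment_append_drop l h]
    simp only [List.filter_append, List.append_assoc]
  rw [hl, ← countP_take_add_segment p l h]
  have := segment_append (U ++ (l.take i).filter p) ((segment l i j).filter p)
    ((l.drop j).filter p ++ V)
  simpa only [List.length_append, ← List.countP_eq_length_filter, Nat.add_assoc] using this

/-- The segment of `l` from `i` to `j` consists of the entries of `A` whose digits above position
`h` are those of `v`, and `c` entries of `A` have smaller digits there. -/
structure Descended (A : List ℕ) (h : ℕ) (l : List ℕ) (i j c v : ℕ) : Prop where
  le : i ≤ j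
  le_length : j ≤ l.length
  segment_eq : segment l i j = A.filter fun u => u / 2 ^ h == v
  count_eq : c = A.countP fun u => decide (u / 2 ^ h < v)

theorem Descended.length {A l : List ℕ} {h i j c v : ℕ} (H : Descended A h l i j c v) :
    j - i = A.countP fun u => u / 2 ^ h == v := by
  have := congrArg List.length H.segment_eq
  rw [← List.countP_eq_length_filter] at this
  rw [← this, segment, List.length_drop, List.length_take, min_eq_left H.le_length]

theorem countP_not_take (p : ℕ → Bool) (l : List ℕ) {i : ℕ} (hi : i ≤ l.length) :
    (l.take i).countP (fun u => !p u) = i - (l.take i).countP p := by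
  have := List.length_eq_countP_add_countP p (l := l.take i)
  rw [List.length_take, min_eq_left hi] at this
  simp only [Bool.not_eq_true, Bool.decide_eq_false] at this
  omega

theorem countP_take_le (p : ℕ → Bool) (l : List ℕ) (i : ℕ) : (l.take i).countP p ≤ i :=
  List.countP_le_length.trans (by rw [List.length_take]; omega)

/-- Entries with digit zero come first in the next level in their old order, so both ends of the
segment are replaced by prefix counts of zeros. -/
theorem Descended.zero {A l : List ℕ} {h i j c v : ℕ} (H : Descended A (h + 1) l i j c v) :
    Descended A h (stableSplit h l) ((l.take i).countP (lowBit h)) ((l.take j).countP (lowBit h))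
      c (2 * v) where
  le := by
    have := countP_take_add_segment (lowBit h) l H.le
    omega
  le_length := (countP_take_le _ _ _).trans (H.le_length.trans (length_stableSplit h l).ge)
  segment_eq := by
    have := segment_filter_append (lowBit h) [] (l.filter fun u => !lowBit h u) l H.le
    simp only [List.length_nil, Nat.zero_add, List.nil_append] at this
    rw [stableSplit, this, H.segment_eq, List.filter_filter]
    refine List.filter_congr fun u _ => ?_
    rw [Bool.eq_iff_iff]
    simp only [lowBit, Bool.and_eq_true, beq_iff_eq, pow_succ, ← Nat.div_div_eq_div_mul]
    omega
  count_eq := by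
    rw [H.count_eq]
    refine List.countP_congr fun u _ => ?_
    simp only [decide_eq_true_eq, pow_succ, ← Nat.div_div_eq_div_mul]
    omega

/-- Entries with digit one follow all the zeros of the level, hence the offset. The zeros inside the
segment are left behind as smaller entries and enter the count. -/
theorem Descended.one {A l : List ℕ} {h i j c v : ℕ} (H : Descended A (h + 1) l i j c v) :
    Descended A h (stableSplit h l)
      ((l.take l.length).countP (lowBit h) + (i - (l.take i).countP (lowBit h)))
      ((l.take l.length).countP (lowBit h) + (j - (l.take j).countP (lowBit h)))
      (c + ((l.take j).countP (lowBit h) - (l.take i).countP (lowBit h))) (2 * v + 1) := by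
  have hn := @countP_not_take (lowBit h) l
  have hj := H.le_length
  have hi := H.le
  rw [← hn (hi.trans hj), ← hn hj]
  refine ⟨?_, ?_, ?_, ?_⟩
  · have := countP_take_add_segment (fun u => !lowBit h u) l hi
    omega
  · rw [length_stableSplit, List.take_length]
    have := List.length_eq_countP_add_countP (lowBit h) (l := l)
    simp only [Bool.not_eq_true, Bool.decide_eq_false] at this
    have := countP_take_add_segment (fun u => !lowBit h u) l hj
    rw [List.take_length] at this
    omega
  · have := segment_filter_append (fun u => !lowBit h u) (l.filter (lowBit h)) [] l hi
    rw [List.append_nil, ← List.countP_eq_length_filter] at this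
    rw [stableSplit, List.take_length, this, H.segment_eq, List.filter_filter]
    refine List.filter_congr fun u _ => ?_
    rw [Bool.eq_iff_iff]
    simp only [lowBit, Bool.and_eq_true, beq_iff_eq, pow_succ, ← Nat.div_div_eq_div_mul,
      Bool.not_eq_true', beq_eq_false_iff_ne]
    omega
  -- The zeros in the segment are the entries with leading digits `2 * v`, the only ones below `2 *
  -- v + 1` not yet counted.
  · have hz : (l.take j).countP (lowBit h) - (l.take i).countP (lowBit h) =
        A.countP fun u => u / 2 ^ h == 2 * v := by
      have h0 := H.zero.length
      exact h0
    rw [hz, H.count_eq]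
    clear hz H hn hj hi
    induction A with
    | nil => rfl
    | cons u A ih =>
      simp only [List.countP_cons, decide_eq_true_eq, beq_iff_eq, pow_succ,
        ← Nat.div_div_eq_div_mul] at ih ⊢
      rw [← ih]
      split_ifs <;> omega

/-! ### Range counting and selection -/

/-- Points in rank space: point `k` is the `k`-th one in the order of the first coordinates and the
`perm false k`-th one in the order of the second coordinates, and `coord false`, `coord true` are
the sorted sequences of the first and of the second coordinates. -/
structure PointSystem where
  n : ℕ
  perm : Bool → ℕ → ℕ
  coord : Bool → ℕ → ℝ
  perm_lt : ∀ a k, k < n → perm a k < n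
  perm_perm : ∀ a k, k < n → perm (!a) (perm a k) = k
  coord_mono : ∀ a i j, i ≤ j → j < n → coord a i ≤ coord a j

/-- The sequence of ranks stored in the wavelet matrix. -/
def PointSystem.ranks (D : PointSystem) (a : Bool) : List ℕ := (List.range D.n).map (D.perm a)

theorem PointSystem.length_ranks (D : PointSystem) (a : Bool) : (D.ranks a).length = D.n := by
  rw [PointSystem.ranks, List.length_map, List.length_range]

/-- The number of zeros among the first `i` digits of level `ℓ`, from the packed table. -/
def zerosLookup (I : Inst) (a : Bool) (ℓ i : ℕ) : ℕ :=
  wadd I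
    (I.M.wordAt (wadd I (I.M.wordAt (if a then 8 else 7))
      (wadd I (wmul I ℓ (I.M.wordAt 6)) (i / I.M.wordAt 4))) /
        I.M.wordAt (wadd I 10 (I.M.wordAt 4)))
    (I.M.wordAt (wadd I (I.M.wordAt (if a then 8 else 7))
      (wadd I (wmul I ℓ (I.M.wordAt 6)) (i / I.M.wordAt 4))) /
        I.M.wordAt (wadd I 10 (i % I.M.wordAt 4)) % I.M.wordAt 5)

/-- The `k`-th of the sorted first (`a = false`) or second coordinates. -/
noncomputable def coordAt (I : Inst) (a : Bool) (k : ℕ) : ℝ :=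
  if a then I.M.realAt (wadd I (I.M.wordAt 3) k) else I.M.realAt k

/-- The memory stores the data structure for a point system. -/
structure Represents (I : Inst) (D : PointSystem) : Prop where
  wordAt_three : I.M.wordAt 3 = D.n
  wordAt_nine : I.M.wordAt 9 = 2 ^ I.L
  lt_pow : D.n < 2 ^ I.L
  pow_le : 2 ^ (I.L + 3) ≤ 2 ^ I.w
  zeros : ∀ a ℓ i, ℓ < I.L → i ≤ D.n → zerosLookup I a ℓ i = zerosBefore I.L (D.ranks a) ℓ i
  coord : ∀ a k, k < D.n → coordAt I a k = D.coord a k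

/-- One step down in the wavelet matrix: the components of the state are the level, the two ends
of the segment, the number of smaller entries, and the digits read so far. -/
abbrev DescentState := ℕ × ℕ × ℕ × ℕ × ℕ

def descendZero (I : Inst) (a : Bool) (s : DescentState) : DescentState :=
  (wadd I s.1 1, zerosLookup I a s.1 s.2.1, zerosLookup I a s.1 s.2.2.1, s.2.2.2.1,
    wadd I s.2.2.2.2 s.2.2.2.2)

def descendOne (I : Inst) (a : Bool) (s : DescentState) : DescentState :=
  (wadd I s.1 1,
    wadd I (zerosLookup I a s.1 (I.M.wordAt 3)) (wsub I s.2.1 (zerosLookup I a s.1 s.2.1)),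
    wadd I (zerosLookup I a s.1 (I.M.wordAt 3)) (wsub I s.2.2.1 (zerosLookup I a s.1 s.2.2.1)),
    wadd I s.2.2.2.1 (wsub I (zerosLookup I a s.1 s.2.2.1) (zerosLookup I a s.1 s.2.1)),
    wadd I (wadd I s.2.2.2.2 s.2.2.2.2) 1)

/-- Descend along the binary digits of `y`; the first component is the current power of two. -/
def countStep (I : Inst) (a : Bool) (y : ℕ) (s : ℕ × DescentState) : ℕ × DescentState :=
  (s.1 / 2, if y / (s.1 / 2) % 2 < 1 then descendZero I a s.2 else descendOne I a s.2)

/-- Descend to the entry with given rank. -/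
def selectStep (I : Inst) (a : Bool) (k : ℕ) (s : DescentState) : DescentState :=
  if k < wadd I s.2.2.2.1 (wsub I (zerosLookup I a s.1 s.2.2.1) (zerosLookup I a s.1 s.2.1)) then
    descendZero I a s else descendOne I a s

/-- The number of entries less than `y` at the positions from `i` to `j - 1`, for
`x = (i, j, y)`. -/
def countLess (I : Inst) (a : Bool) (x : ℕ × ℕ × ℕ) : ℕ :=
  ((countStep I a x.2.2)^[I.L] (I.M.wordAt 9, 0, x.1, x.2.1, 0, 0)).2.2.2.2.1

/-- The `k`-th smallest entry at the positions from `i` to `j - 1`, for `x = (i, j, k)`. -/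
def select (I : Inst) (a : Bool) (x : ℕ × ℕ × ℕ) : ℕ :=
  ((selectStep I a x.2.2)^[I.L] (0, x.1, x.2.1, 0, 0)).2.2.2.2

/-! ### Correctness of counting and selection -/

section

variable {I : Inst} {D : PointSystem}

/-- The state `s` after `ℓ` steps of a descent. -/
def DescentInv (I : Inst) (D : PointSystem) (a : Bool) (A : List ℕ) (ℓ : ℕ)
    (s : DescentState) : Prop :=
  s.1 = ℓ ∧ Descended A (I.L - ℓ) (waveletLevel I.L (D.ranks a) ℓ) s.2.1 s.2.2.1 s.2.2.2.1
    s.2.2.2.2 ∧ s.2.2.2.2 < 2 ^ ℓ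

/-- The three spare bits in `Represents.pow_le` rule out wraparound in every addition made during a
descent. -/
theorem Represents.bounds (hR : Represents I D) {ℓ : ℕ} (hℓ : ℓ < I.L) {v : ℕ} (hv : v < 2 ^ ℓ) :
    2 * v + 1 < 2 ^ I.w ∧ ℓ + 1 < 2 ^ I.w ∧ 3 * D.n < 2 ^ I.w ∧ 2 * v + 1 < 2 ^ (ℓ + 1) := by
  have h1 := hR.pow_le
  have h2 := hR.lt_pow
  have h3 : 2 ^ (ℓ + 1) ≤ 2 ^ I.L := Nat.pow_le_pow_right (by norm_num) hℓ
  have h4 : I.L < 2 ^ I.L := Nat.lt_two_pow_self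
  rw [pow_add] at h1
  rw [pow_succ] at h3 ⊢
  omega

theorem DescentInv.lookup (hR : Represents I D) {a : Bool} {A : List ℕ} {ℓ : ℕ}
    {s : DescentState} (h : DescentInv I D a A ℓ s) (hℓ : ℓ < I.L) {i : ℕ} (hi : i ≤ D.n) :
    zerosLookup I a s.1 i =
      ((waveletLevel I.L (D.ranks a) ℓ).take i).countP (lowBit (I.L - (ℓ + 1))) := by
  rw [h.1, hR.zeros a ℓ i hℓ hi, zerosBefore, Nat.sub_sub, Nat.add_comm 1]

theorem DescentInv.le {a : Bool} {A : List ℕ} {ℓ : ℕ} {s : DescentState}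
    (h : DescentInv I D a A ℓ s) : s.2.1 ≤ s.2.2.1 ∧ s.2.2.1 ≤ D.n := by
  refine ⟨h.2.1.le, h.2.1.le_length.trans ?_⟩
  rw [length_waveletLevel, D.length_ranks]

theorem DescentInv.descended {a : Bool} {A : List ℕ} {ℓ : ℕ} {s : DescentState}
    (h : DescentInv I D a A ℓ s) (hℓ : ℓ < I.L) :
    Descended A (I.L - (ℓ + 1) + 1) (waveletLevel I.L (D.ranks a) ℓ) s.2.1 s.2.2.1 s.2.2.2.1
      s.2.2.2.2 := by
  have := h.2.1
  rwa [show I.L - ℓ = I.L - (ℓ + 1) + 1 by omega] at this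

theorem waveletLevel_succ (L : ℕ) (A : List ℕ) (ℓ : ℕ) :
    waveletLevel L A (ℓ + 1) = stableSplit (L - (ℓ + 1)) (waveletLevel L A ℓ) := by
  rw [waveletLevel, Nat.sub_sub, Nat.add_comm 1]

theorem DescentInv.zero (hR : Represents I D) {a : Bool} {A : List ℕ} {ℓ : ℕ}
    {s : DescentState} (h : DescentInv I D a A ℓ s) (hℓ : ℓ < I.L) :
    DescentInv I D a A (ℓ + 1) (descendZero I a s) := by
  obtain ⟨h1, h2⟩ := h.le
  obtain ⟨h3, h4, -, h5⟩ := hR.bounds hℓ h.2.2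
  have hv : wadd I s.2.2.2.2 s.2.2.2.2 = 2 * s.2.2.2.2 := by
    rw [wadd_eq] <;> omega
  refine ⟨?_, ?_, ?_⟩
  · rw [descendZero, h.1, wadd_eq h4]
  · rw [descendZero, hv, h.lookup hR hℓ (h1.trans h2), h.lookup hR hℓ h2, waveletLevel_succ]
    exact (h.descended hℓ).zero
  · simp only [descendZero, hv]
    omega

theorem DescentInv.zeros_sub (hR : Represents I D) {a : Bool} {A : List ℕ} {ℓ : ℕ}
    {s : DescentState} (h : DescentInv I D a A ℓ s) (hℓ : ℓ < I.L) :
    zerosLookup I a s.1 s.2.1 ≤ s.2.1 ∧ zerosLookup I a s.1 s.2.2.1 ≤ s.2.2.1 ∧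
      zerosLookup I a s.1 (I.M.wordAt 3) ≤ D.n ∧
      zerosLookup I a s.1 s.2.1 ≤ zerosLookup I a s.1 s.2.2.1 ∧
      zerosLookup I a s.1 s.2.2.1 - zerosLookup I a s.1 s.2.1 =
        A.countP fun u => u / 2 ^ (I.L - (ℓ + 1)) == 2 * s.2.2.2.2 := by
  obtain ⟨h1, h2⟩ := h.le
  rw [hR.wordAt_three, h.lookup hR hℓ (h1.trans h2), h.lookup hR hℓ h2, h.lookup hR hℓ le_rfl]
  exact ⟨countP_take_le _ _ _, countP_take_le _ _ _, countP_take_le _ _ _,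
    (h.descended hℓ).zero.le, (h.descended hℓ).zero.length⟩

theorem DescentInv.one (hR : Represents I D) {a : Bool} {A : List ℕ} (hA : A.length ≤ D.n)
    {ℓ : ℕ} {s : DescentState} (h : DescentInv I D a A ℓ s) (hℓ : ℓ < I.L) :
    DescentInv I D a A (ℓ + 1) (descendOne I a s) := by
  obtain ⟨h1, h2⟩ := h.le
  obtain ⟨h3, h4, h6, h5⟩ := hR.bounds hℓ h.2.2
  obtain ⟨z1, z2, z3, z4, -⟩ := h.zeros_sub hR hℓ
  have hc : s.2.2.2.1 ≤ D.n := by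
    rw [h.2.1.count_eq]
    exact List.countP_le_length.trans hA
  have hv : wadd I (wadd I s.2.2.2.2 s.2.2.2.2) 1 = 2 * s.2.2.2.2 + 1 := by
    rw [wadd_eq (a := s.2.2.2.2) (by omega), wadd_eq] <;> omega
  refine ⟨?_, ?_, ?_⟩
  · rw [descendOne, h.1, wadd_eq h4]
  · simp only [descendOne]
    rw [hv, wsub_eq z1 (by omega), wsub_eq z2 (by omega), wsub_eq z4 (by omega),
      wadd_eq (by omega), wadd_eq (by omega), wadd_eq (by omega), hR.wordAt_three,
      h.lookup hR hℓ (h1.trans h2), h.lookup hR hℓ h2, h.lookup hR hℓ le_rfl, waveletLevel_succ]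
    have hl : D.n = (waveletLevel I.L (D.ranks a) ℓ).length := by
      rw [length_waveletLevel, D.length_ranks]
    rw [hl]
    exact (h.descended hℓ).one
  · simp only [descendOne, hv]
    omega

theorem length_segment_le (l : List ℕ) (i j : ℕ) : (segment l i j).length ≤ l.length := by
  rw [segment, List.length_drop, List.length_take]
  omega

theorem length_segment_ranks_le (a : Bool) (i j : ℕ) :
    (segment (D.ranks a) i j).length ≤ D.n :=
  (length_segment_le _ _ _).trans (D.length_ranks a).le

theorem mem_segment_ranks {a : Bool} {i j u : ℕ} (hj : j ≤ D.n) :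
    u ∈ segment (D.ranks a) i j ↔ ∃ k, i ≤ k ∧ k < j ∧ D.perm a k = u := by
  rw [segment, PointSystem.ranks, ← List.map_take, ← List.map_drop, List.take_range,
    min_eq_left hj]
  simp only [List.mem_map]
  have : ∀ k, k ∈ (List.range j).drop i ↔ i ≤ k ∧ k < j := by
    intro k
    rw [List.mem_drop_iff_getElem]
    constructor
    · rintro ⟨m, hm, rfl⟩
      rw [List.length_range] at hm
      rw [List.getElem_range]
      omega
    · rintro ⟨h1, h2⟩
      refine ⟨k - i, ?_, ?_⟩
      · rw [List.length_range]
        omega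
      · rw [List.getElem_range]
        omega
  simp only [this, and_assoc]

theorem lt_of_mem_segment_ranks {a : Bool} {i j u : ℕ} (hj : j ≤ D.n)
    (hu : u ∈ segment (D.ranks a) i j) : u < D.n := by
  obtain ⟨k, -, hk, rfl⟩ := (mem_segment_ranks hj).1 hu
  exact D.perm_lt a k (hk.trans_le hj)

theorem descentInv_init (hR : Represents I D) (a : Bool) {i j : ℕ} (hij : i ≤ j) (hj : j ≤ D.n) :
    DescentInv I D a (segment (D.ranks a) i j) 0 (0, i, j, 0, 0) := by
  have h : ∀ u ∈ segment (D.ranks a) i j, u / 2 ^ I.L = 0 := fun u hu =>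
    Nat.div_eq_of_lt ((lt_of_mem_segment_ranks hj hu).trans hR.lt_pow)
  refine ⟨rfl, ⟨hij, ?_, ?_, ?_⟩, Nat.one_pos⟩
  · rw [length_waveletLevel, D.length_ranks]
    exact hj
  · rw [Nat.sub_zero, List.filter_eq_self.2]
    · rfl
    · intro u hu
      simp [h u hu]
  · simp

/-- What the descents need from the last state. -/
theorem DescentInv.final {a : Bool} {A : List ℕ} {s : DescentState}
    (h : DescentInv I D a A I.L s) : s.2.2.2.1 = A.countP fun u => decide (u < s.2.2.2.2) := by
  have := h.2.1.count_eq
  simpa using this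

/-- The descent follows the digits of `y`. When all are read, the number of entries with smaller
leading digits is the number of entries below `y`. -/
theorem countLess_eq (hR : Represents I D) (a : Bool) {i j y : ℕ} (hij : i ≤ j) (hj : j ≤ D.n)
    (hy : y < 2 ^ I.L) :
    countLess I a (i, j, y) = (segment (D.ranks a) i j).countP fun u => decide (u < y) := by
  set A := segment (D.ranks a) i j with hA
  have key : ∀ ℓ ≤ I.L, ∃ s, (countStep I a y)^[ℓ] (2 ^ I.L, 0, i, j, 0, 0) =
      (2 ^ (I.L - ℓ), s) ∧ DescentInv I D a A ℓ s ∧ s.2.2.2.2 = y / 2 ^ (I.L - ℓ) := by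
    intro ℓ
    induction ℓ with
    | zero =>
      intro _
      refine ⟨_, rfl, descentInv_init hR a hij hj, ?_⟩
      rw [Nat.sub_zero, Nat.div_eq_of_lt hy]
    | succ ℓ ih =>
      intro hℓ
      obtain ⟨s, hs, hinv, hv⟩ := ih (by omega)
      have hp : 2 ^ (I.L - ℓ) = 2 ^ (I.L - (ℓ + 1)) * 2 := by
        rw [← pow_succ]
        congr 1
        omega
      have hy2 : y / 2 ^ (I.L - ℓ) = y / 2 ^ (I.L - (ℓ + 1)) / 2 := by
        rw [hp, Nat.div_div_eq_div_mul]
      obtain ⟨h3, -, -, -⟩ := hR.bounds hℓ hinv.2.2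
      rw [Function.iterate_succ_apply', hs]
      simp only [countStep, hp, Nat.mul_div_cancel _ (Nat.zero_lt_two)]
      refine ⟨_, rfl, ?_, ?_⟩
      · split_ifs
        · exact hinv.zero hR hℓ
        · exact hinv.one hR (length_segment_ranks_le a i j) hℓ
      · split_ifs with h
        · simp only [descendZero]
          rw [wadd_eq (by omega)]
          omega
        · simp only [descendOne]
          rw [wadd_eq (a := s.2.2.2.2) (by omega), wadd_eq (by omega)]
          omega
  obtain ⟨s, hs, hinv, hv⟩ := key I.L le_rfl
  rw [countLess, hR.wordAt_nine]
  simp only [hs]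
  rw [hinv.final, hv]
  simp

/-- The descent keeps the invariant that the `k`-th entry, counted from zero in sorted order, is
among those with the current leading digits: at most `k` entries are smaller, and more than `k` are
smaller or share these digits. -/
theorem select_spec (hR : Represents I D) (a : Bool) {i j k : ℕ} (hij : i ≤ j) (hj : j ≤ D.n)
    (hk : k < j - i) :
    select I a (i, j, k) ∈ segment (D.ranks a) i j ∧
      (segment (D.ranks a) i j).countP (fun u => decide (u < select I a (i, j, k))) ≤ k ∧
      k < (segment (D.ranks a) i j).countP (fun u => decide (u ≤ select I a (i, j, k))) := by
  set A := segment (D.ranks a) i j with hA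
  have key : ∀ ℓ ≤ I.L, DescentInv I D a A ℓ ((selectStep I a k)^[ℓ] (0, i, j, 0, 0)) ∧
      ((selectStep I a k)^[ℓ] (0, i, j, 0, 0)).2.2.2.1 ≤ k ∧
      k < ((selectStep I a k)^[ℓ] (0, i, j, 0, 0)).2.2.2.1 + A.countP fun u =>
        u / 2 ^ (I.L - ℓ) == ((selectStep I a k)^[ℓ] (0, i, j, 0, 0)).2.2.2.2 := by
    intro ℓ
    induction ℓ with
    | zero =>
      intro _
      refine ⟨descentInv_init hR a hij hj, Nat.zero_le _, ?_⟩
      have := (descentInv_init hR a hij hj).2.1.length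
      simp only [Function.iterate_zero, id, ← hA] at this ⊢
      omega
    | succ ℓ ih =>
      intro hℓ
      obtain ⟨hinv, h1, h2⟩ := ih (by omega)
      rw [Function.iterate_succ_apply']
      set s := (selectStep I a k)^[ℓ] (0, i, j, 0, 0)
      obtain ⟨l1, l2⟩ := hinv.le
      obtain ⟨h3, h4, h6, h5⟩ := hR.bounds hℓ hinv.2.2
      obtain ⟨z1, z2, z3, z4, z5⟩ := hinv.zeros_sub hR hℓ
      have hc : s.2.2.2.1 ≤ D.n := by
        rw [hinv.2.1.count_eq]
        exact List.countP_le_length.trans (length_segment_ranks_le a i j)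
      have e1 : wadd I s.2.2.2.1 (wsub I (zerosLookup I a s.1 s.2.2.1)
          (zerosLookup I a s.1 s.2.1)) = s.2.2.2.1 + (zerosLookup I a s.1 s.2.2.1 -
          zerosLookup I a s.1 s.2.1) := by
        rw [wsub_eq z4 (by omega), wadd_eq (by omega)]
      have hadd : (A.countP fun u => u / 2 ^ (I.L - ℓ) == s.2.2.2.2) =
          (A.countP fun u => u / 2 ^ (I.L - (ℓ + 1)) == 2 * s.2.2.2.2) +
          A.countP fun u => u / 2 ^ (I.L - (ℓ + 1)) == 2 * s.2.2.2.2 + 1 := by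
        rw [show I.L - ℓ = I.L - (ℓ + 1) + 1 by omega]
        clear_value A
        clear * -
        induction A with
        | nil => rfl
        | cons u A ih =>
          simp only [List.countP_cons, beq_iff_eq, pow_succ, ← Nat.div_div_eq_div_mul] at ih ⊢
          rw [ih]
          split_ifs <;> omega
      rw [selectStep, e1]
      split_ifs with h
      · refine ⟨hinv.zero hR hℓ, h1, ?_⟩
        simp only [descendZero]
        rw [wadd_eq (by omega), ← two_mul, ← z5]
        exact h
      · refine ⟨hinv.one hR (length_segment_ranks_le a i j) hℓ, ?_, ?_⟩
        · simp only [descendOne]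
          rw [e1]
          omega
        · simp only [descendOne]
          rw [e1, wadd_eq (a := s.2.2.2.2) (by omega), wadd_eq (by omega), ← two_mul]
          omega
  obtain ⟨hinv, h1, h2⟩ := key I.L le_rfl
  have hdef : select I a (i, j, k) = ((selectStep I a k)^[I.L] (0, i, j, 0, 0)).2.2.2.2 := rfl
  rw [hinv.final, ← hdef] at h1 h2
  simp only [Nat.sub_self, pow_zero, Nat.div_one] at h2
  refine ⟨?_, h1, ?_⟩
  · by_contra hnot
    have : A.countP (fun u => u == select I a (i, j, k)) = 0 := by
      rw [List.countP_eq_zero]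
      rintro u hu h
      rw [beq_iff_eq] at h
      exact hnot (h ▸ hu)
    omega
  · refine h2.trans_le (le_of_eq ?_)
    clear_value A
    generalize select I a (i, j, k) = v
    clear * -
    induction A with
    | nil => rfl
    | cons u A ih =>
      simp only [List.countP_cons, decide_eq_true_eq, beq_iff_eq] at ih ⊢
      rw [← ih]
      split_ifs <;> omega

end

/-! ### Corner squares -/

/-- `t` or `-t`, for the lower or the upper end of a coordinate axis. -/
def signed (σ : Bool) (t : ℝ) : ℝ := if σ then -t else t

section

variable {ι κ : Type*} (v : Bool → ι → ℝ)

/-- The elements of `T` outside the square of side length `s` at the corner `c` of the bounding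
box of `T`; here `v false` and `v true` are the coordinates. -/
def rest (c : Bool → Bool) (s : ℝ) (T : Set ι) : Set ι :=
  {p ∈ T | ∃ a, ∃ q ∈ T, signed (c a) (v a q) + s < signed (c a) (v a p)}

/-- The bounding box has side lengths at most `s`. -/
def Narrow (s : ℝ) (T : Set ι) : Prop := ∀ a, ∀ p ∈ T, ∀ q ∈ T, v a p - v a q ≤ s

/-- Two corner squares, placed one after the other, leave a set that fits into a third one. -/
def Feasible (S : Set ι) (c : (Bool → Bool) × (Bool → Bool)) (s : ℝ) : Prop :=
  0 ≤ s ∧ Narrow v s (rest v c.2 s (rest v c.1 s S))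

/-- The point `p` is in the square with corner `o` and side length `s`. -/
def InSquare (o : Bool → ℝ) (s : ℝ) (p : ι) : Prop := ∀ a, o a ≤ v a p ∧ v a p ≤ o a + s

variable {v}

theorem rest_subset (c : Bool → Bool) (s : ℝ) (T : Set ι) : rest v c s T ⊆ T := fun _ hp => hp.1

/-- Shrinking the set moves its corner inwards, so the corner square loses no point of the smaller
set. This makes two successive cuts monotone in the side length. -/
theorem rest_mono (c : Bool → Bool) {s s' : ℝ} (h : s ≤ s') {T T' : Set ι} (hT : T' ⊆ T) :
    rest v c s' T' ⊆ rest v c s T := by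
  rintro p ⟨hp, a, q, hq, hpq⟩
  exact ⟨hT hp, a, q, hT hq, by linarith⟩

theorem Narrow.mono {s s' : ℝ} (h : s ≤ s') {T T' : Set ι} (hT : T' ⊆ T) (hn : Narrow v s T) :
    Narrow v s' T' := fun a p hp q hq => (hn a p (hT hp) q (hT hq)).trans h

theorem Feasible.mono {S : Set ι} {c : (Bool → Bool) × (Bool → Bool)} {s s' : ℝ} (h : s ≤ s')
    (hf : Feasible v S c s) : Feasible v S c s' :=
  ⟨hf.1.trans h, hf.2.mono h (rest_mono _ h (rest_mono _ h subset_rfl))⟩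

theorem signed_sub_le {s x y : ℝ} (σ : Bool) (h1 : x - y ≤ s) (h2 : y - x ≤ s) :
    signed σ x ≤ signed σ y + s := by
  cases σ
  · simpa [signed] using by linarith
  · simp only [signed, if_true]
    linarith

theorem InSquare.sub_le {o : Bool → ℝ} {s : ℝ} {p q : ι} (hp : InSquare v o s p)
    (hq : InSquare v o s q) (a : Bool) : v a p - v a q ≤ s := by
  linarith [(hp a).2, (hq a).1]

theorem rest_eq_empty_of_narrow {s : ℝ} {T : Set ι} (h : Narrow v s T) (c : Bool → Bool) :
    rest v c s T = ∅ := by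
  refine Set.eq_empty_of_forall_notMem ?_
  rintro p ⟨hp, a, q, hq, hpq⟩
  exact absurd (signed_sub_le (c a) (h a p hp q hq) (h a q hq p hp)) (not_le.2 hpq)

/-- If at most three squares cover a set, then one of them can be moved to a corner. -/
theorem exists_rest_covered [DecidableEq κ] {T : Set ι} (hfin : T.Finite) (hne : T.Nonempty)
    {s : ℝ} (o : κ → Bool → ℝ) {J : Finset κ} (hJ : J.card ≤ 3)
    (hcov : ∀ p ∈ T, ∃ j ∈ J, InSquare v (o j) s p) :
    ∃ c, ∃ j ∈ J, ∀ p ∈ rest v c s T, ∃ i ∈ J.erase j, InSquare v (o i) s p := by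
  -- Choose a point `e x` of `T` on each side of the bounding box, and a square `f x` containing it.
  have hext : ∀ x : Bool × Bool, ∃ e ∈ T, ∀ q ∈ T, signed x.2 (v x.1 e) ≤ signed x.2 (v x.1 q) :=
    fun x => Set.exists_min_image T (fun q => signed x.2 (v x.1 q)) hfin hne
  choose e heT he using hext
  choose f hfJ hf using fun x => hcov (e x) (heT x)
  -- A square can be dropped once its points of `T` all lie in the corner square.
  have hout : ∀ {c : Bool → Bool} {j : κ}, (∀ p ∈ T, InSquare v (o j) s p → ∀ a, ∀ q ∈ T,
      signed (c a) (v a p) ≤ signed (c a) (v a q) + s) →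
      ∀ p ∈ rest v c s T, ∃ i ∈ J.erase j, InSquare v (o i) s p := by
    rintro c j h p ⟨hp, a, q, hq, hpq⟩
    obtain ⟨i, hi, hin⟩ := hcov p hp
    refine ⟨i, Finset.mem_erase.2 ⟨?_, hi⟩, hin⟩
    rintro rfl
    exact absurd (h p hp hin a q hq) (not_le.2 hpq)
  -- Four sides but at most three squares, so two sides share a square.
  obtain ⟨⟨a, σ⟩, -, ⟨b, τ⟩, -, hne', hfe⟩ :=
    Finset.exists_ne_map_eq_of_card_lt_of_maps_to (s := (Finset.univ : Finset (Bool × Bool)))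
      (t := J) (f := f) (by simpa using Nat.lt_succ_of_le hJ) (fun x _ => hfJ x)
  -- For opposite sides the whole set has width at most `s` in direction `a`. Any square meeting a
  -- side in the other direction can then be moved to a corner.
  by_cases hab : a = b
  · subst hab
    have hτ : τ = !σ := by
      cases σ <;> cases τ <;> first | rfl | exact absurd rfl hne'
    have hw : ∀ p ∈ T, ∀ q ∈ T, v a p - v a q ≤ s := by
      intro p hp q hq
      have h1 := he (a, false) p hp
      have h2 := he (a, true) p hp
      have h3 := he (a, false) q hq
      have h4 := he (a, true) q hq
      have hs : f (a, false) = f (a, true) := by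
        subst hτ
        cases σ
        · exact hfe
        · exact hfe.symm
      have h5 := (hf (a, true)).sub_le (hs ▸ hf (a, false)) a
      simp only [signed, if_true, Bool.false_eq_true, if_false] at h1 h2 h3 h4
      linarith
    refine ⟨fun _ => false, f (!a, false), hfJ _, hout fun p hp hin b q hq => ?_⟩
    by_cases hb : b = a
    · subst hb
      exact signed_sub_le _ (hw p hp q hq) (hw q hq p hp)
    · obtain rfl : b = !a := by
        cases a <;> cases b <;> first | rfl | exact absurd rfl hb
      have h1 := he (!a, false) q hq
      have h2 := signed_sub_le false (hin.sub_le (hf (!a, false)) (!a))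
        ((hf (!a, false)).sub_le hin (!a))
      simp only at h1
      linarith
  -- For adjacent sides, the shared square is moved to the corner where they meet.
  · refine ⟨fun x => if x = a then σ else τ, f (a, σ), hfJ _, hout fun p hp hin x q hq => ?_⟩
    by_cases hx : x = a
    · subst hx
      simp only [if_true]
      have h1 := he (x, σ) q hq
      have h2 := signed_sub_le σ (hin.sub_le (hf (x, σ)) x) ((hf (x, σ)).sub_le hin x)
      simp only at h1
      linarith
    · obtain rfl : x = b := by
        cases a <;> cases b <;> cases x <;>
          first | rfl | exact absurd rfl hx | exact absurd rfl hab
      simp only [if_neg hx]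
      have h1 := he (x, τ) q hq
      have h2 := signed_sub_le τ (hin.sub_le (hfe ▸ hf (x, τ)) x)
        (InSquare.sub_le (hfe ▸ hf (x, τ)) hin x)
      simp only at h1
      linarith

/-- If three squares cover a set, then some pair of corners is feasible. -/
theorem exists_feasible {S : Set ι} (hfin : S.Finite) {s : ℝ} (hs : 0 ≤ s)
    (o : Fin 3 → Bool → ℝ) (hcov : ∀ p ∈ S, ∃ j, InSquare v (o j) s p) :
    ∃ c, Feasible v S c s := by
  have hempty : ∀ c, rest v c s (∅ : Set ι) = ∅ := fun c =>
    Set.subset_eq_empty (rest_subset c s ∅) rfl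
  have hn : Narrow v s (∅ : Set ι) := fun _ _ h => absurd h (Set.notMem_empty _)
  rcases S.eq_empty_or_nonempty with rfl | hne
  · exact ⟨(fun _ => false, fun _ => false), hs, by simpa only [hempty] using hn⟩
  obtain ⟨c, j, -, h₁⟩ := exists_rest_covered hfin hne o (J := Finset.univ) (by simp)
    (by simpa using hcov)
  rcases (rest v c s S).eq_empty_or_nonempty with he | hne₁
  · exact ⟨(c, fun _ => false), hs, by simpa only [he, hempty] using hn⟩
  have hc₁ : (Finset.univ.erase j : Finset (Fin 3)).card = 2 := by simp
  obtain ⟨c', j', hj', h₂⟩ := exists_rest_covered (hfin.subset (rest_subset c s S)) hne₁ o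
    (J := Finset.univ.erase j) (by omega) h₁
  have hc₂ : ((Finset.univ.erase j : Finset (Fin 3)).erase j').card = 1 := by
    rw [Finset.card_erase_of_mem hj', hc₁]
  obtain ⟨i, hi⟩ := Finset.card_eq_one.1 hc₂
  refine ⟨(c, c'), hs, fun a p hp q hq => ?_⟩
  obtain ⟨x, hx, hp⟩ := h₂ p hp
  obtain ⟨y, hy, hq⟩ := h₂ q hq
  rw [hi, Finset.mem_singleton] at hx hy
  subst hx hy
  exact hp.sub_le hq a

/-- The corner square contains what is not left over. -/
theorem inSquare_of_notMem_rest {c : Bool → Bool} {s : ℝ} {T : Set ι} {m : Bool → ℝ}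
    (hm : ∀ a, ∃ q ∈ T, v a q = m a)
    (hmin : ∀ a, ∀ p ∈ T, signed (c a) (m a) ≤ signed (c a) (v a p)) {p : ι} (hp : p ∈ T)
    (hpr : p ∉ rest v c s T) : InSquare v (fun a => if c a then m a - s else m a) s p := by
  intro a
  obtain ⟨q, hq, hqm⟩ := hm a
  have h1 := hmin a p hp
  have h2 : signed (c a) (v a p) ≤ signed (c a) (v a q) + s :=
    not_lt.1 fun h => hpr ⟨hp, a, q, hq, h⟩
  rw [hqm] at h2
  cases h : c a <;> simp only [h, signed, if_true, Bool.false_eq_true, if_false] at h1 h2 ⊢ <;>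
    constructor <;> linarith

end

/-! ### Boxes in rank space -/

/-- Half-open intervals of ranks in both coordinates. -/
abbrev Box := (ℕ × ℕ) × (ℕ × ℕ)

/-- The interval of a box in the direction `a`. -/
def side (a : Bool) (b : Box) : ℕ × ℕ := if a then b.2 else b.1

/-- Replace the interval of a box in the direction `a`. -/
def setSide (a : Bool) (b : Box) (x : ℕ × ℕ) : Box := if a then (b.1, x) else (x, b.2)

theorem side_setSide (a a' : Bool) (b : Box) (x : ℕ × ℕ) :
    side a' (setSide a b x) = if a' = a then x else side a' b := by
  cases a <;> cases a' <;> rfl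

namespace PointSystem

variable (D : PointSystem)

/-- The rank of point `k` with respect to the coordinate `a`. -/
def pos (a : Bool) (k : ℕ) : ℕ := if a then D.perm false k else k

/-- The coordinates of point `k`. -/
def val (a : Bool) (k : ℕ) : ℝ := D.coord a (D.pos a k)

/-- The points in a box. -/
def boxPoints (b : Box) : Set ℕ :=
  {k | k < D.n ∧ ∀ a, (side a b).1 ≤ D.pos a k ∧ D.pos a k < (side a b).2}

/-- `h` is the bounding box of `T`. -/
structure IsHull (h : Box) (T : Set ℕ) : Prop where
  sub : ∀ k ∈ T, k < D.n
  le : ∀ a, (side a h).1 ≤ D.n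
  lower : ∀ a, ∀ m ≤ D.n, m ≤ (side a h).1 ↔ ∀ k ∈ T, m ≤ D.pos a k
  upper : ∀ a m, (side a h).2 ≤ m ↔ ∀ k ∈ T, D.pos a k < m

variable {D}

theorem pos_lt (a : Bool) {k : ℕ} (hk : k < D.n) : D.pos a k < D.n := by
  cases a
  · exact hk
  · exact D.perm_lt false k hk

theorem perm_pos (a : Bool) {k : ℕ} (hk : k < D.n) : D.perm a (D.pos a k) = D.pos (!a) k := by
  cases a
  · rfl
  · exact D.perm_perm false k hk

theorem exists_pos_eq (a : Bool) {m : ℕ} (hm : m < D.n) : ∃ k < D.n, D.pos a k = m := by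
  cases a
  · exact ⟨m, hm, rfl⟩
  · exact ⟨D.perm true m, D.perm_lt true m hm, D.perm_perm true m hm⟩

theorem val_le_val (a : Bool) {k k' : ℕ} (hk' : k' < D.n) (h : D.pos a k ≤ D.pos a k') :
    D.val a k ≤ D.val a k' := D.coord_mono a _ _ h (pos_lt a hk')

/-- This box is neutral for `join`. The lower end of an empty hull is `n`, which is why
`IsHull.lower` is restricted to `m ≤ n`. -/
theorem isHull_empty : D.IsHull ((D.n, 0), (D.n, 0)) ∅ where
  sub := by simp
  le a := by cases a <;> simp [side]
  lower a m hm := by cases a <;> simp [side, hm]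
  upper a m := by cases a <;> simp [side]

/-- The smallest interval containing both intervals. -/
def _root_.RangeCenter.join (x y : ℕ × ℕ) : ℕ × ℕ := (min x.1 y.1, max x.2 y.2)

theorem side_join (a : Bool) (h h' : Box) :
    side a (join h.1 h'.1, join h.2 h'.2) = join (side a h) (side a h') := by
  cases a <;> rfl

theorem IsHull.union {h h' : Box} {T T' : Set ℕ} (H : D.IsHull h T) (H' : D.IsHull h' T') :
    D.IsHull (join h.1 h'.1, join h.2 h'.2) (T ∪ T') where
  sub k hk := hk.elim (H.sub k) (H'.sub k)
  le a := by
    rw [side_join]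
    exact (min_le_left _ _).trans (H.le a)
  lower a m hm := by
    rw [side_join]
    simp only [join, le_min_iff, H.lower a m hm, H'.lower a m hm, Set.mem_union, or_imp,
      forall_and]
  upper a m := by
    rw [side_join]
    simp only [join, max_le_iff, H.upper a m, H'.upper a m, Set.mem_union, or_imp, forall_and]

theorem IsHull.side_le {h : Box} {T : Set ℕ} (H : D.IsHull h T) (a : Bool) {k : ℕ} (hk : k ∈ T) :
    (side a h).1 ≤ D.pos a k ∧ D.pos a k < (side a h).2 :=
  ⟨(H.lower a _ (H.le a)).1 le_rfl k hk, (H.upper a _).1 le_rfl k hk⟩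

/-- Ranks are integers: were the lower end not attained, it could be increased by one. -/
theorem IsHull.exists_lower {h : Box} {T : Set ℕ} (H : D.IsHull h T) (hT : T.Nonempty)
    (a : Bool) : ∃ k ∈ T, D.pos a k = (side a h).1 := by
  obtain ⟨k₀, hk₀⟩ := hT
  have h0 := H.side_le a hk₀
  have h1 := pos_lt a (H.sub k₀ hk₀)
  by_contra! hne
  have := (H.lower a ((side a h).1 + 1) (by omega)).2 fun k hk => by
    have h2 := (H.side_le a hk).1
    have h3 := hne k hk
    omega
  omega

theorem IsHull.exists_upper {h : Box} {T : Set ℕ} (H : D.IsHull h T) (hT : T.Nonempty)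
    (a : Bool) : ∃ k ∈ T, D.pos a k + 1 = (side a h).2 := by
  obtain ⟨k₀, hk₀⟩ := hT
  have h0 := H.side_le a hk₀
  by_contra! hne
  have := (H.upper a ((side a h).2 - 1)).2 fun k hk => by
    have h2 := (H.side_le a hk).2
    have h3 := hne k hk
    omega
  omega

theorem IsHull.nonempty_iff {h : Box} {T : Set ℕ} (H : D.IsHull h T) (a : Bool) :
    (side a h).1 < (side a h).2 ↔ T.Nonempty := by
  constructor
  · intro hlt
    by_contra hne
    rw [Set.not_nonempty_iff_eq_empty] at hne
    subst hne
    have := (H.upper a 0).2 (by simp)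
    omega
  · rintro ⟨k, hk⟩
    have := H.side_le a hk
    omega

end PointSystem

open PointSystem

section

variable {I : Inst} {D : PointSystem}

/-- The number of points of the box, with all smaller ranks in the direction `!a` included or only
those below the box. -/
def countBelow (I : Inst) (a up : Bool) (b : Box) : ℕ :=
  countLess I a ((side a b).1, (side a b).2, if up then (side (!a) b).2 else (side (!a) b).1)

/-- The range of the points of a box in the direction `!a`. -/
def extremes (I : Inst) (a : Bool) (b : Box) : ℕ × ℕ :=
  (select I a ((side a b).1, (side a b).2, countBelow I a false b),
    wadd I (select I a ((side a b).1, (side a b).2, wsub I (countBelow I a true b) 1)) 1)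

/-- Enlarge the bounding box `x.2` to contain the points of the box `x.1`. -/
def addRange (I : Inst) (x : Box × Box) : Box :=
  if x.1.1.1 < x.1.1.2 then
    if x.1.2.1 < x.1.2.2 then
      if countBelow I false false x.1 < countBelow I false true x.1 then
        (join x.2.1 (extremes I true x.1), join x.2.2 (extremes I false x.1))
      else x.2
    else x.2
  else x.2

theorem countP_lt_countP {p q : ℕ → Bool} {l : List ℕ} (h : ∀ u, p u → q u) {u : ℕ}
    (hu : u ∈ l) (hq : q u) (hp : ¬ p u) : l.countP p < l.countP q := by
  induction l with
  | nil => simp at hu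
  | cons x l ih =>
    have hle : l.countP p ≤ l.countP q := List.countP_mono_left fun u _ => h u
    rw [List.countP_cons, List.countP_cons]
    rcases List.mem_cons.1 hu with rfl | hu
    · rw [if_neg hp, if_pos hq]
      omega
    · have := ih hu
      split_ifs with h1 h2
      · omega
      · exact absurd (h x h1) h2
      · omega
      · omega

theorem mem_segment_ranks_iff {a : Bool} {i j u : ℕ} (hj : j ≤ D.n) :
    u ∈ segment (D.ranks a) i j ↔
      ∃ k < D.n, i ≤ D.pos a k ∧ D.pos a k < j ∧ D.pos (!a) k = u := by
  rw [mem_segment_ranks hj]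
  constructor
  · rintro ⟨m, h1, h2, rfl⟩
    obtain ⟨k, hk, rfl⟩ := exists_pos_eq a (h2.trans_le hj)
    exact ⟨k, hk, h1, h2, (perm_pos a hk).symm⟩
  · rintro ⟨k, hk, h1, h2, rfl⟩
    exact ⟨_, h1, h2, perm_pos a hk⟩

/-- The intervals of the box end before `n`. -/
def ValidBox (D : PointSystem) (b : Box) : Prop := ∀ a, (side a b).2 ≤ D.n

theorem mem_boxPoints_iff (a : Bool) {b : Box} {k : ℕ} : k ∈ D.boxPoints b ↔ k < D.n ∧
    ((side a b).1 ≤ D.pos a k ∧ D.pos a k < (side a b).2) ∧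
      (side (!a) b).1 ≤ D.pos (!a) k ∧ D.pos (!a) k < (side (!a) b).2 := by
  simp only [boxPoints, Set.mem_ofPred_eq, Bool.forall_bool]
  cases a
  · rfl
  · exact and_congr_right fun _ => and_comm

theorem countBelow_eq (hR : Represents I D) (a up : Bool) {b : Box} (hb : ValidBox D b)
    (h : ∀ a, (side a b).1 < (side a b).2) :
    countBelow I a up b = (segment (D.ranks a) (side a b).1 (side a b).2).countP fun u =>
      decide (u < if up then (side (!a) b).2 else (side (!a) b).1) := by
  refine countLess_eq hR a (h a).le (hb a) (lt_of_le_of_lt ?_ hR.lt_pow)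
  have := hb (!a)
  have := h (!a)
  cases up
  · simp only [Bool.false_eq_true, if_false]
    omega
  · exact hb (!a)

/-- The two counts concern the same strip and differ by the number of its points in the box. -/
theorem countBelow_lt_iff (hR : Represents I D) (a : Bool) {b : Box} (hb : ValidBox D b)
    (h : ∀ a, (side a b).1 < (side a b).2) :
    countBelow I a false b < countBelow I a true b ↔ (D.boxPoints b).Nonempty := by
  rw [countBelow_eq hR a false hb h, countBelow_eq hR a true hb h]
  have hlt := h (!a)
  constructor
  · intro hc
    by_contra hne
    refine absurd hc (not_lt.2 (List.countP_mono_left fun u hu hlt => ?_))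
    obtain ⟨k, hk, h1, h2, rfl⟩ := (mem_segment_ranks_iff (hb a)).1 hu
    simp only [if_true, Bool.false_eq_true, if_false, decide_eq_true_eq] at hlt ⊢
    by_contra h3
    exact hne ⟨k, (mem_boxPoints_iff a).2 ⟨hk, ⟨h1, h2⟩, not_lt.1 h3, hlt⟩⟩
  · rintro ⟨k, hk⟩
    obtain ⟨hk, ⟨h1, h2⟩, h3, h4⟩ := (mem_boxPoints_iff a).1 hk
    refine countP_lt_countP (u := D.pos (!a) k) ?_
      ((mem_segment_ranks_iff (hb a)).2 ⟨k, hk, h1, h2, rfl⟩) ?_ ?_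
    · intro u hu
      simp only [if_true, Bool.false_eq_true, if_false, decide_eq_true_eq] at hu ⊢
      omega
    · simpa using h4
    · simpa using h3

/-- In the sorted strip, the points of the box are consecutive: they start at the index given by the
count below the box and end just before the count up to its upper end. Selecting at the first and
the last of these indices gives the extreme ranks. -/
theorem extremes_spec (hR : Represents I D) (a : Bool) {b : Box} (hb : ValidBox D b)
    (h : ∀ a, (side a b).1 < (side a b).2) (hne : (D.boxPoints b).Nonempty) :
    (extremes I a b).1 ≤ D.n ∧
    (∀ m, m ≤ (extremes I a b).1 ↔ ∀ k ∈ D.boxPoints b, m ≤ D.pos (!a) k) ∧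
      ∀ m, (extremes I a b).2 ≤ m ↔ ∀ k ∈ D.boxPoints b, D.pos (!a) k < m := by
  have hlt := (countBelow_lt_iff hR a hb h).2 hne
  have e1 := countBelow_eq hR a false hb h
  have e2 := countBelow_eq hR a true hb h
  simp only [if_true, Bool.false_eq_true, if_false] at e1 e2
  set A := segment (D.ranks a) (side a b).1 (side a b).2 with hA
  have hlen : countBelow I a true b ≤ (side a b).2 - (side a b).1 := by
    rw [e2]
    refine List.countP_le_length.trans ?_
    rw [hA, segment, List.length_drop, List.length_take, D.length_ranks, min_eq_left (hb a)]
  have hw : D.n + 1 < 2 ^ I.w := by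
    have h1 := hR.pow_le
    have h2 := hR.lt_pow
    rw [pow_add] at h1
    omega
  have hba := hb a
  have hs : wsub I (countBelow I a true b) 1 = countBelow I a true b - 1 :=
    wsub_eq (by omega) (by omega)
  obtain ⟨m1, c1, d1⟩ := select_spec hR a (h a).le (hb a) (k := countBelow I a false b) (by omega)
  obtain ⟨m2, c2, d2⟩ := select_spec hR a (h a).le (hb a) (k := countBelow I a true b - 1)
    (by omega)
  rw [← hA] at m1 c1 d1 m2 c2 d2
  rw [extremes, hs]
  set s1 := select I a ((side a b).1, (side a b).2, countBelow I a false b)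
  set s2 := select I a ((side a b).1, (side a b).2, countBelow I a true b - 1)
  have hs2n : s2 < D.n := lt_of_mem_segment_ranks (hb a) m2
  have hs1n : s1 < D.n := lt_of_mem_segment_ranks (hb a) m1
  have hmemA : ∀ k ∈ D.boxPoints b, D.pos (!a) k ∈ A := fun k hk =>
    have hk := (mem_boxPoints_iff a).1 hk
    (mem_segment_ranks_iff (hb a)).2 ⟨k, hk.1, hk.2.1.1, hk.2.1.2, rfl⟩
  have hlo : (side (!a) b).1 ≤ s1 := by
    by_contra hc
    have : (A.countP fun u => decide (u ≤ s1)) ≤ A.countP fun u => decide (u < (side (!a) b).1) :=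
      List.countP_mono_left fun u _ hu => by
        rw [decide_eq_true_eq] at hu ⊢
        omega
    omega
  have hmin : ∀ u ∈ A, (side (!a) b).1 ≤ u → s1 ≤ u := by
    intro u hu hlu
    by_contra hc
    have := countP_lt_countP (p := fun u => decide (u < (side (!a) b).1))
      (q := fun u => decide (u < s1)) (fun x hx => by
        rw [decide_eq_true_eq] at hx ⊢
        omega) hu (by simpa using hc) (by simpa using hlu)
    omega
  have hhi : s2 < (side (!a) b).2 := by
    by_contra hc
    have : (A.countP fun u => decide (u < (side (!a) b).2)) ≤ A.countP fun u => decide (u < s2) :=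
      List.countP_mono_left fun u _ hu => by
        rw [decide_eq_true_eq] at hu ⊢
        omega
    omega
  have hmax : ∀ u ∈ A, u < (side (!a) b).2 → u ≤ s2 := by
    intro u hu hlu
    by_contra hc
    have := countP_lt_countP (p := fun u => decide (u ≤ s2))
      (q := fun u => decide (u < (side (!a) b).2)) (fun x hx => by
        rw [decide_eq_true_eq] at hx ⊢
        omega) hu (by simpa using hlu) (by simpa using hc)
    omega
  obtain ⟨k₀, hk₀⟩ := hne
  have hk₀' := (mem_boxPoints_iff a).1 hk₀
  have h10 := hmin _ (hmemA k₀ hk₀) hk₀'.2.2.1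
  have h20 := hmax _ (hmemA k₀ hk₀) hk₀'.2.2.2
  obtain ⟨k1, hk1, p1, q1, r1⟩ := (mem_segment_ranks_iff (hb a)).1 m1
  obtain ⟨k2, hk2, p2, q2, r2⟩ := (mem_segment_ranks_iff (hb a)).1 m2
  have hk1' : k1 ∈ D.boxPoints b :=
    (mem_boxPoints_iff a).2 ⟨hk1, ⟨p1, q1⟩, by omega, by omega⟩
  have hk2' : k2 ∈ D.boxPoints b :=
    (mem_boxPoints_iff a).2 ⟨hk2, ⟨p2, q2⟩, by omega, by omega⟩
  refine ⟨hs1n.le, fun m => ⟨fun hm k hk => ?_, fun hm => ?_⟩, fun m => ⟨fun hm k hk => ?_,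
    fun hm => ?_⟩⟩
  · exact hm.trans (hmin _ (hmemA k hk) ((mem_boxPoints_iff a).1 hk).2.2.1)
  · exact (hm k1 hk1').trans r1.le
  · have := hmax _ (hmemA k hk) ((mem_boxPoints_iff a).1 hk).2.2.2
    simp only at hm
    rw [wadd_eq (by omega)] at hm
    omega
  · have := hm k2 hk2'
    simp only
    rw [wadd_eq (by omega)]
    omega

theorem isHull_addRange (hR : Represents I D) {b h : Box} {T : Set ℕ} (hb : ValidBox D b)
    (H : D.IsHull h T) : D.IsHull (addRange I (b, h)) (T ∪ D.boxPoints b) := by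
  have key : ∀ h' : Box, h' = h → ¬ (D.boxPoints b).Nonempty →
      D.IsHull h' (T ∪ D.boxPoints b) := by
    rintro _ rfl hne
    rwa [Set.not_nonempty_iff_eq_empty.1 hne, Set.union_empty]
  simp only [addRange]
  split_ifs with h1 h2 h3
  · have hlt : ∀ a, (side a b).1 < (side a b).2 := Bool.forall_bool.2 ⟨h1, h2⟩
    have hne := (countBelow_lt_iff hR false hb hlt).1 h3
    -- The sides appear exchanged because `extremes I a` yields the range in the direction `!a`.
    refine H.union (h' := (extremes I true b, extremes I false b)) ⟨fun k hk => hk.1, ?_, ?_, ?_⟩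
    · exact Bool.forall_bool.2 ⟨(extremes_spec hR true hb hlt hne).1,
        (extremes_spec hR false hb hlt hne).1⟩
    · exact Bool.forall_bool.2 ⟨fun m _ => (extremes_spec hR true hb hlt hne).2.1 m,
        fun m _ => (extremes_spec hR false hb hlt hne).2.1 m⟩
    · exact Bool.forall_bool.2 ⟨fun m => (extremes_spec hR true hb hlt hne).2.2 m,
        fun m => (extremes_spec hR false hb hlt hne).2.2 m⟩
  · have hlt : ∀ a, (side a b).1 < (side a b).2 := Bool.forall_bool.2 ⟨h1, h2⟩
    exact key h rfl fun hne => h3 ((countBelow_lt_iff hR false hb hlt).2 hne)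
  · exact key h rfl fun ⟨k, hk⟩ => h2 ((hk.2 true).1.trans_lt (hk.2 true).2)
  · exact key h rfl fun ⟨k, hk⟩ => h1 ((hk.2 false).1.trans_lt (hk.2 false).2)

end

/-! ### Cutting off corner squares -/

/-- The loops run exactly `L` rounds. A gap below `2 ^ L` that is halved in each round is zero at
the end; finished searches just repeat their state. -/
theorem iterate_gap_le {σ : Type*} {P : σ → Prop} {f : σ → σ} {gap : σ → ℕ}
    (hf : ∀ s, P s → P (f s) ∧ gap (f s) ≤ gap s / 2) {s : σ} (hs : P s) (k : ℕ) :
    P (f^[k] s) ∧ gap (f^[k] s) ≤ gap s / 2 ^ k := by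
  induction k with
  | zero => simpa using hs
  | succ k ih =>
    rw [Function.iterate_succ_apply', pow_succ, ← Nat.div_div_eq_div_mul]
    exact ⟨(hf _ ih.1).1, (hf _ ih.1).2.trans (Nat.div_le_div_right ih.2)⟩

/-- One step of binary search for the first coordinate greater than `t` (`σ = false`) or at least
`t` (`σ = true`). -/
noncomputable def bisectStep (I : Inst) (a σ : Bool) (t : ℝ) (s : ℕ × ℕ) : ℕ × ℕ :=
  if s.1 < s.2 then
    if σ then
      if coordAt I a (wadd I s.1 s.2 / 2) < t then (wadd I (wadd I s.1 s.2 / 2) 1, s.2)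
      else (s.1, wadd I s.1 s.2 / 2)
    else
      if t < coordAt I a (wadd I s.1 s.2 / 2) then (s.1, wadd I s.1 s.2 / 2)
      else (wadd I (wadd I s.1 s.2 / 2) 1, s.2)
  else s

/-- The first rank of a coordinate greater than `t` (`σ = false`) or at least `t` (`σ = true`). -/
noncomputable def firstRank (I : Inst) (a σ : Bool) (t : ℝ) : ℕ :=
  ((bisectStep I a σ t)^[I.L] (0, I.M.wordAt 3)).1

/-- Restrict the side `a` of a box to ranks from `u` on (`σ = false`) or below `u`. -/
def cut (a σ : Bool) (x : Box × ℕ) : Box :=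
  setSide a x.1 (if σ then ((side a x.1).1, min (side a x.1).2 x.2)
    else (max (side a x.1).1 x.2, (side a x.1).2))

/-- The coordinate of the lower (`σ = false`) or upper end of the side `a` of a bounding box. -/
noncomputable def anchor (I : Inst) (a σ : Bool) (h : Box) : ℝ :=
  if σ then coordAt I a (wsub I (side a h).2 1) else coordAt I a (side a h).1

/-- The part of the box `b` beyond the square with side length `s` at the corner of `h`, in the
direction `a`, for `x = ((b, h), s)`. -/
noncomputable def cutBeyond (I : Inst) (a σ : Bool) (x : (Box × Box) × ℝ) : Box :=
  cut a σ (x.1.1, firstRank I a σ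
    (if σ then anchor I a σ x.1.2 - x.2 else anchor I a σ x.1.2 + x.2))

/-- The bounding box of the points of `b` outside the corner square of side length `s`, where
`x = ((b, h), s)` and `h` is the bounding box. -/
noncomputable def hullRest (I : Inst) (c : Bool → Bool) (x : (Box × Box) × ℝ) : Box :=
  addRange I (cutBeyond I true (c true) x, addRange I (cutBeyond I false (c false) x,
    ((I.M.wordAt 3, 0), (I.M.wordAt 3, 0))))

/-- The bounding box of what two successive corner squares leave. -/
noncomputable def hullRestRest (I : Inst) (c : (Bool → Bool) × (Bool → Bool))
    (x : (Box × Box) × ℝ) : Box :=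
  let h := hullRest I c.1 x
  let b := fun a => cutBeyond I a (c.1 a) x
  addRange I (cutBeyond I true (c.2 true) ((b true, h), x.2),
    addRange I (cutBeyond I false (c.2 false) ((b true, h), x.2),
      addRange I (cutBeyond I true (c.2 true) ((b false, h), x.2),
        addRange I (cutBeyond I false (c.2 false) ((b false, h), x.2),
          ((I.M.wordAt 3, 0), (I.M.wordAt 3, 0))))))

/-- The larger side length of a bounding box. -/
noncomputable def extent (I : Inst) (h : Box) : ℝ :=
  if h.1.1 < h.1.2 then
    max (anchor I false true h - anchor I false false h)
      (anchor I true true h - anchor I true false h)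
  else 0

/-! ### Correctness of cutting off corner squares -/

section

variable {I : Inst} {D : PointSystem}

theorem Represents.lt_two_pow (hR : Represents I D) : 4 * D.n + 4 ≤ 2 ^ I.w := by
  have h1 := hR.pow_le
  have h2 := hR.lt_pow
  rw [pow_add] at h1
  omega

theorem firstRank_spec (hR : Represents I D) (a σ : Bool) (t : ℝ) :
    firstRank I a σ t ≤ D.n ∧ ∀ k < D.n, firstRank I a σ t ≤ k ↔
      if σ then t ≤ D.coord a k else t < D.coord a k := by
  set above : ℕ → Prop := fun k => if σ then t ≤ D.coord a k else t < D.coord a k with habove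
  have hmono : ∀ i j, i ≤ j → j < D.n → above i → above j := by
    intro i j hij hj hi
    have := D.coord_mono a i j hij hj
    cases σ <;> simp only [habove, if_true, Bool.false_eq_true, if_false] at hi ⊢ <;> linarith
  have hw := hR.lt_two_pow
  have hstep : ∀ s : ℕ × ℕ, (s.1 ≤ s.2 ∧ s.2 ≤ D.n ∧ (∀ k < s.1, ¬ above k) ∧
      ∀ k < D.n, s.2 ≤ k → above k) → ((bisectStep I a σ t s).1 ≤ (bisectStep I a σ t s).2 ∧
      (bisectStep I a σ t s).2 ≤ D.n ∧ (∀ k < (bisectStep I a σ t s).1, ¬ above k) ∧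
      ∀ k < D.n, (bisectStep I a σ t s).2 ≤ k → above k) ∧
      (bisectStep I a σ t s).2 - (bisectStep I a σ t s).1 ≤ (s.2 - s.1) / 2 := by
    rintro ⟨l, r⟩ ⟨h1, h2, h3, h4⟩
    simp only at h1 h2 h3 h4
    by_cases hlr : l < r
    · have hm : wadd I l r / 2 = (l + r) / 2 := by rw [wadd_eq (by omega)]
      have hm1 : wadd I ((l + r) / 2) 1 = (l + r) / 2 + 1 := wadd_eq (by omega)
      have hmn : (l + r) / 2 < D.n := by omega
      have hstep : bisectStep I a σ t (l, r) = if above ((l + r) / 2) then (l, (l + r) / 2)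
          else ((l + r) / 2 + 1, r) := by
        simp only [bisectStep, hm, hm1, if_pos hlr, hR.coord a _ hmn, habove]
        cases σ
        · simp
        · simp only [if_true]
          by_cases h : D.coord a ((l + r) / 2) < t
          · rw [if_pos h, if_neg (not_le.2 h)]
          · rw [if_neg h, if_pos (not_lt.1 h)]
      rw [hstep]
      split_ifs with h
      · refine ⟨⟨?_, ?_, h3, fun k hk hk' => hmono _ k hk' hk h⟩, ?_⟩
        all_goals simp only; omega
      · refine ⟨⟨?_, h2, fun k hk hk' => h (hmono k _ (by simp only at hk; omega) hmn hk'), h4⟩, ?_⟩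
        all_goals simp only; omega
    · rw [bisectStep, if_neg hlr]
      refine ⟨⟨h1, h2, h3, h4⟩, ?_⟩
      simp only
      omega
  obtain ⟨⟨h1, h2, h3, h4⟩, h5⟩ := iterate_gap_le (P := fun s : ℕ × ℕ =>
    s.1 ≤ s.2 ∧ s.2 ≤ D.n ∧ (∀ k < s.1, ¬ above k) ∧ ∀ k < D.n, s.2 ≤ k → above k)
    (gap := fun s => s.2 - s.1) hstep (s := (0, I.M.wordAt 3))
    ⟨Nat.zero_le _, hR.wordAt_three.le, by simp, fun k hk hk' => by
      rw [hR.wordAt_three] at hk'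
      omega⟩ I.L
  have hdef : ((bisectStep I a σ t)^[I.L] (0, I.M.wordAt 3)).1 = firstRank I a σ t := rfl
  have hgap : (0, I.M.wordAt 3).2 - (0, I.M.wordAt 3).1 < 2 ^ I.L := by
    rw [hR.wordAt_three]
    exact hR.lt_pow
  rw [Nat.div_eq_of_lt hgap] at h5
  refine ⟨h1.trans h2, fun k hk => ⟨fun hle => h4 k hk (le_trans (by omega) hle), fun hab => ?_⟩⟩
  by_contra hlt
  exact h3 k (not_le.1 hlt) hab

theorem validBox_cut (a σ : Bool) {b : Box} {u : ℕ} (hb : ValidBox D b) :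
    ValidBox D (cut a σ (b, u)) := by
  intro a'
  rw [cut, side_setSide]
  have := hb a
  have := hb a'
  split_ifs <;> simp only <;> omega

theorem mem_boxPoints_cut (a σ : Bool) {b : Box} {u k : ℕ} :
    k ∈ D.boxPoints (cut a σ (b, u)) ↔
      k ∈ D.boxPoints b ∧ if σ then D.pos a k < u else u ≤ D.pos a k := by
  simp only [mem_boxPoints_iff a, cut, side_setSide, if_true]
  cases σ <;> cases a <;> simp <;> tauto

/-- The hull consists of ranks, but sorted coordinates are monotone in the rank, so its ends give
the extreme coordinates even if there are ties. -/
theorem anchor_spec (hR : Represents I D) {h : Box} {T : Set ℕ} (H : D.IsHull h T)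
    (hT : T.Nonempty) (a σ : Bool) :
    (∃ q ∈ T, D.val a q = anchor I a σ h) ∧
      ∀ p ∈ T, signed σ (anchor I a σ h) ≤ signed σ (D.val a p) := by
  have hw := hR.lt_two_pow
  cases σ
  · obtain ⟨q, hq, hqe⟩ := H.exists_lower hT a
    have hqn := pos_lt a (H.sub q hq)
    have he : D.val a q = anchor I a false h := by
      simp only [anchor, Bool.false_eq_true, if_false]
      rw [val, ← hqe, hR.coord a _ hqn]
    refine ⟨⟨q, hq, he⟩, fun p hp => ?_⟩
    simp only [signed, Bool.false_eq_true, if_false]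
    rw [← he]
    exact val_le_val a (H.sub p hp) (hqe.trans_le (H.side_le a hp).1)
  · obtain ⟨q, hq, hqe⟩ := H.exists_upper hT a
    have hqn := pos_lt a (H.sub q hq)
    have he : D.val a q = anchor I a true h := by
      simp only [anchor, if_true]
      rw [val, ← hqe, wsub_eq (by omega) (by omega), Nat.add_sub_cancel, hR.coord a _ hqn]
    refine ⟨⟨q, hq, he⟩, fun p hp => ?_⟩
    simp only [signed, if_true, neg_le_neg_iff]
    rw [← he]
    refine val_le_val a (H.sub q hq) ?_
    have := (H.side_le a hp).2
    omega

theorem validBox_cutBeyond (a σ : Bool) {b h : Box} {s : ℝ} (hb : ValidBox D b) :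
    ValidBox D (cutBeyond I a σ ((b, h), s)) :=
  validBox_cut a σ hb

/-- The hull belongs to a set `T` that may exceed the box `b`. This is needed in the second round,
where `b` is only one part of the remainder but the corner is that of the whole remainder. -/
theorem mem_boxPoints_cutBeyond (hR : Represents I D) (a σ : Bool) {b h : Box} {T : Set ℕ}
    (H : D.IsHull h T) (hbT : D.boxPoints b ⊆ T) {s : ℝ} {p : ℕ} :
    p ∈ D.boxPoints (cutBeyond I a σ ((b, h), s)) ↔
      p ∈ D.boxPoints b ∧ ∃ q ∈ T, signed σ (D.val a q) + s < signed σ (D.val a p) := by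
  rw [cutBeyond, mem_boxPoints_cut]
  refine and_congr_right fun hp => ?_
  have hT : T.Nonempty := ⟨p, hbT hp⟩
  obtain ⟨⟨q, hq, hqe⟩, hmin⟩ := anchor_spec hR H hT a σ
  have hex : (∃ q ∈ T, signed σ (D.val a q) + s < signed σ (D.val a p)) ↔
      signed σ (anchor I a σ h) + s < signed σ (D.val a p) := by
    constructor
    · rintro ⟨q, hq, hlt⟩
      linarith [hmin q hq]
    · intro hlt
      exact ⟨q, hq, by rwa [hqe]⟩
  have hpn := pos_lt a hp.1
  rw [hex]
  cases σ
  · simp only [signed, Bool.false_eq_true, if_false]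
    rw [(firstRank_spec hR a false _).2 _ hpn]
    rfl
  · simp only [signed, if_true]
    rw [← not_le, (firstRank_spec hR a true _).2 _ hpn, if_pos rfl, not_le]
    change D.val a p < _ ↔ _
    constructor <;> intro h <;> linarith

/-- A point outside the corner square exceeds it in at least one direction, so the remainder is a
union of two boxes. They may overlap, which does not matter for hulls. -/
theorem isHull_hullRest (hR : Represents I D) (c : Bool → Bool) {b h : Box} (hb : ValidBox D b)
    (H : D.IsHull h (D.boxPoints b)) (s : ℝ) :
    D.IsHull (hullRest I c ((b, h), s)) (rest D.val c s (D.boxPoints b)) := by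
  have := isHull_addRange hR (validBox_cutBeyond (I := I) (h := h) (s := s) true (c true) hb)
    (isHull_addRange hR (validBox_cutBeyond (I := I) (h := h) (s := s) false (c false) hb)
      (isHull_empty (D := D)))
  rw [hullRest, hR.wordAt_three]
  convert this using 1
  ext p
  simp only [Set.mem_union, Set.mem_empty_iff_false, false_or,
    mem_boxPoints_cutBeyond hR _ _ H subset_rfl, rest, Set.mem_ofPred_eq, Bool.exists_bool,
    ← and_or_left]

theorem boxPoints_cutBeyond_subset (hR : Represents I D) (c : Bool → Bool) (a : Bool) {b h : Box}
    (H : D.IsHull h (D.boxPoints b)) (s : ℝ) :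
    D.boxPoints (cutBeyond I a (c a) ((b, h), s)) ⊆ rest D.val c s (D.boxPoints b) := by
  intro p hp
  have := (mem_boxPoints_cutBeyond hR a (c a) H subset_rfl).1 hp
  exact ⟨this.1, a, this.2⟩

/-- Each of the two boxes left by the first square is cut in both directions by the second, which
gives four boxes. -/
theorem isHull_hullRestRest (hR : Represents I D) (c : (Bool → Bool) × (Bool → Bool)) {b h : Box}
    (hb : ValidBox D b) (H : D.IsHull h (D.boxPoints b)) (s : ℝ) :
    D.IsHull (hullRestRest I c ((b, h), s))
      (rest D.val c.2 s (rest D.val c.1 s (D.boxPoints b))) := by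
  set b' : Bool → Box := fun a => cutBeyond I a (c.1 a) ((b, h), s) with hb'
  have hv : ∀ a, ValidBox D (b' a) := fun a => validBox_cutBeyond a (c.1 a) hb
  have H' := isHull_hullRest hR c.1 hb H s
  have hsub : ∀ a, D.boxPoints (b' a) ⊆ rest D.val c.1 s (D.boxPoints b) := fun a =>
    boxPoints_cutBeyond_subset hR c.1 a H s
  have := isHull_addRange hR (validBox_cutBeyond (I := I) (h := hullRest I c.1 ((b, h), s))
      (s := s) true (c.2 true) (hv true))
    (isHull_addRange hR (validBox_cutBeyond (I := I) (h := hullRest I c.1 ((b, h), s))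
      (s := s) false (c.2 false) (hv true))
    (isHull_addRange hR (validBox_cutBeyond (I := I) (h := hullRest I c.1 ((b, h), s))
      (s := s) true (c.2 true) (hv false))
    (isHull_addRange hR (validBox_cutBeyond (I := I) (h := hullRest I c.1 ((b, h), s))
      (s := s) false (c.2 false) (hv false))
      (isHull_empty (D := D)))))
  rw [hullRestRest, hR.wordAt_three]
  convert this using 1
  ext p
  have hmem : p ∈ rest D.val c.1 s (D.boxPoints b) ↔
      p ∈ D.boxPoints (b' false) ∨ p ∈ D.boxPoints (b' true) := by
    simp only [hb', mem_boxPoints_cutBeyond hR _ _ H subset_rfl, rest, Set.mem_ofPred_eq,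
      Bool.exists_bool, ← and_or_left]
  simp only [Set.mem_union, Set.mem_empty_iff_false, false_or,
    mem_boxPoints_cutBeyond hR _ _ H' (hsub _)]
  rw [rest, Set.mem_ofPred_eq, hmem, Bool.exists_bool, or_and_right, and_or_left, and_or_left]
  simp only [or_assoc]

/-- The restriction to `0 ≤ s` accounts for the empty set, which is narrow for every `s` but has
extent zero by convention. -/
theorem extent_spec (hR : Represents I D) {h : Box} {T : Set ℕ} (H : D.IsHull h T) :
    0 ≤ extent I h ∧ ∀ s, 0 ≤ s → (extent I h ≤ s ↔ Narrow D.val s T) := by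
  have hne : h.1.1 < h.1.2 ↔ T.Nonempty := H.nonempty_iff false
  rw [extent]
  split_ifs with hlt
  · have hT := hne.1 hlt
    have hlo := fun a => anchor_spec hR H hT a false
    have hhi := fun a => anchor_spec hR H hT a true
    simp only [signed, if_true, Bool.false_eq_true, if_false, neg_le_neg_iff] at hlo hhi
    refine ⟨le_max_of_le_left ?_, fun s hs => ?_⟩
    · obtain ⟨q, hq, hqe⟩ := (hlo false).1
      linarith [(hhi false).2 q hq]
    · rw [max_le_iff]
      constructor
      · rintro ⟨h0, h1⟩ a p hp q hq
        have e1 := (hlo a).2 q hq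
        have e2 := (hhi a).2 p hp
        cases a <;> linarith
      · intro hn
        constructor
        · obtain ⟨q, hq, hqe⟩ := (hlo false).1
          obtain ⟨p, hp, hpe⟩ := (hhi false).1
          rw [← hqe, ← hpe]
          exact hn false p hp q hq
        · obtain ⟨q, hq, hqe⟩ := (hlo true).1
          obtain ⟨p, hp, hpe⟩ := (hhi true).1
          rw [← hqe, ← hpe]
          exact hn true p hp q hq
  · refine ⟨le_rfl, fun s hs => ⟨fun _ a p hp => ?_, fun _ => hs⟩⟩
    exact absurd (hne.2 ⟨p, hp⟩) hlt

end

/-! ### Searching the side length -/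

/-- The side length needed for the third square if the first two are corner squares of given side
length, for `x = ((b, h), s)`. -/
noncomputable def leftover (I : Inst) (c : (Bool → Bool) × (Bool → Bool))
    (x : (Box × Box) × ℝ) : ℝ := extent I (hullRestRest I c x)

/-- The distances from `t` to all coordinates, in ascending order. -/
noncomputable def candidate (I : Inst) (a σ : Bool) (x : ℝ × ℕ) : ℝ :=
  if σ then x.1 - coordAt I a (wsub I (I.M.wordAt 3) (wadd I x.2 1)) else coordAt I a x.2 - x.1

/-- One step of binary search among the candidates. The first two components of the state are a
lower and an upper bound, the others enclose the candidates that remain. -/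
noncomputable def probeStep (I : Inst) (c : (Bool → Bool) × (Bool → Bool)) (a σ : Bool)
    (x : (Box × Box) × ℝ) (s : (ℝ × ℝ) × (ℕ × ℕ)) : (ℝ × ℝ) × (ℕ × ℕ) :=
  if s.2.1 < s.2.2 then
    if s.1.1 < candidate I a σ (x.2, wadd I s.2.1 s.2.2 / 2) then
      if candidate I a σ (x.2, wadd I s.2.1 s.2.2 / 2) <
          leftover I c (x.1, candidate I a σ (x.2, wadd I s.2.1 s.2.2 / 2)) then
        ((candidate I a σ (x.2, wadd I s.2.1 s.2.2 / 2), s.1.2),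
          (wadd I (wadd I s.2.1 s.2.2 / 2) 1, s.2.2))
      else ((s.1.1, min s.1.2 (candidate I a σ (x.2, wadd I s.2.1 s.2.2 / 2))),
        (s.2.1, wadd I s.2.1 s.2.2 / 2))
    else (s.1, (wadd I (wadd I s.2.1 s.2.2 / 2) 1, s.2.2))
  else s

/-- Improve the bounds `x.2` by all distances from the anchor of the box `x.1.2` in the
direction `a`. -/
noncomputable def searchAxis (I : Inst) (c : (Bool → Bool) × (Bool → Bool)) (a σ : Bool)
    (x : ((Box × Box) × Box) × (ℝ × ℝ)) : ℝ × ℝ :=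
  ((probeStep I c a σ (x.1.1, anchor I a σ x.1.2))^[I.L] (x.2, (0, I.M.wordAt 3))).1

/-- Improve the bounds `x.2` by all distances from the corner `d` of the box `x.1.2`. -/
noncomputable def searchCorner (I : Inst) (c : (Bool → Bool) × (Bool → Bool)) (d : Bool → Bool)
    (x : ((Box × Box) × Box) × (ℝ × ℝ)) : ℝ × ℝ :=
  searchAxis I c true (d true) (x.1, searchAxis I c false (d false) x)

/-- Bounds for the optimal side length with the corners `c` after the search for the first
square. -/
noncomputable def searchFirst (I : Inst) (c : (Bool → Bool) × (Bool → Bool))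
    (x : (Box × Box) × ℝ) : ℝ × ℝ :=
  searchCorner I c c.1 ((x.1, x.1.2),
    (0, if 0 < leftover I c (x.1, 0) then x.2 else min x.2 0))

/-- Bounds for the optimal side length with the corners `c` after the search for the second
square. -/
noncomputable def searchSecond (I : Inst) (c : (Bool → Bool) × (Bool → Bool))
    (x : (Box × Box) × ℝ) : ℝ × ℝ :=
  searchCorner I c c.2 ((x.1, hullRest I c.1 (x.1, (searchFirst I c x).1)), searchFirst I c x)

/-- The minimum of `x.2` and the optimal side length with the corners `c`. -/
noncomputable def search (I : Inst) (c : (Bool → Bool) × (Bool → Bool))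
    (x : (Box × Box) × ℝ) : ℝ :=
  min (searchSecond I c x).2
    (max (searchSecond I c x).1 (leftover I c (x.1, (searchSecond I c x).1)))

/-- The minimum of `x.2` and the optimal side lengths for a list of corners. -/
noncomputable def searchAll (I : Inst) :
    List ((Bool → Bool) × (Bool → Bool)) → (Box × Box) × ℝ → ℝ
  | [], x => x.2
  | c :: cs, x => searchAll I cs (x.1, search I c x)

/-- The lower left vertex of the square of side length `x.2` at the corner `d` of the box `x.1`. -/
noncomputable def cornerPoint (I : Inst) (d : Bool → Bool) (x : Box × ℝ) : ℝ × ℝ :=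
  (if d false then anchor I false true x.1 - x.2 else anchor I false false x.1,
    if d true then anchor I true true x.1 - x.2 else anchor I true false x.1)

/-- The side length and the three squares for the corners `c`. -/
noncomputable def squaresAt (I : Inst) (c : (Bool → Bool) × (Bool → Bool))
    (x : (Box × Box) × ℝ) : ℝ × (ℝ × ℝ) × (ℝ × ℝ) × (ℝ × ℝ) :=
  (x.2, cornerPoint I c.1 (x.1.2, x.2), cornerPoint I c.2 (hullRest I c.1 x, x.2),
    cornerPoint I (fun _ => false) (hullRestRest I c x, x.2))

/-- The squares for the first feasible pair of corners in the list. -/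
noncomputable def firstSquares (I : Inst) :
    List ((Bool → Bool) × (Bool → Bool)) → (Box × Box) × ℝ → ℝ × (ℝ × ℝ) × (ℝ × ℝ) × (ℝ × ℝ)
  | [], _ => (0, (0, 0), (0, 0), (0, 0))
  | c :: cs, x => if x.2 < leftover I c x then firstSquares I cs x else squaresAt I c x

/-- The ranks of the coordinates in the query rectangle. -/
noncomputable def queryBox (I : Inst) (q : (ℝ × ℝ) × (ℝ × ℝ)) : Box :=
  ((firstRank I false true q.1.1, firstRank I false false q.2.1),
    (firstRank I true true q.1.2, firstRank I true false q.2.2))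

/-- All pairs of corners. -/
noncomputable def cornerPairs : List ((Bool → Bool) × (Bool → Bool)) := Finset.univ.toList

/-- The answer for a box and its bounding box. -/
noncomputable def answerBox (I : Inst) (x : Box × Box) : ℝ × (ℝ × ℝ) × (ℝ × ℝ) × (ℝ × ℝ) :=
  if x.2.1.1 < x.2.1.2 then
    firstSquares I cornerPairs (x, searchAll I cornerPairs (x, extent I x.2))
  else (0, (0, 0), (0, 0), (0, 0))

/-- The answer to a query. -/
noncomputable def answer (I : Inst) (q : (ℝ × ℝ) × (ℝ × ℝ)) :
    ℝ × (ℝ × ℝ) × (ℝ × ℝ) × (ℝ × ℝ) :=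
  answerBox I (queryBox I q,
    addRange I (queryBox I q, ((I.M.wordAt 3, 0), (I.M.wordAt 3, 0))))

/-! ### Correctness of the search and of the answer -/

section

variable {I : Inst} {D : PointSystem} {b h : Box}

theorem leftover_spec (hR : Represents I D) (c : (Bool → Bool) × (Bool → Bool))
    (hb : ValidBox D b) (H : D.IsHull h (D.boxPoints b)) (s : ℝ) :
    0 ≤ leftover I c ((b, h), s) ∧ ∀ s', 0 ≤ s' → (leftover I c ((b, h), s) ≤ s' ↔
      Narrow D.val s' (rest D.val c.2 s (rest D.val c.1 s (D.boxPoints b)))) :=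
  extent_spec hR (isHull_hullRestRest hR c hb H s)

theorem feasible_iff (hR : Represents I D) (c : (Bool → Bool) × (Bool → Bool))
    (hb : ValidBox D b) (H : D.IsHull h (D.boxPoints b)) {s : ℝ} (hs : 0 ≤ s) :
    Feasible D.val (D.boxPoints b) c s ↔ leftover I c ((b, h), s) ≤ s := by
  rw [(leftover_spec hR c hb H s).2 s hs, Feasible]
  exact and_iff_right hs

/-- The bounds of the search: `p.2` is feasible for some corners, and all feasible values for the
corners `c` are greater than `p.1` or at least `p.2`. -/
def Bounds (D : PointSystem) (S : Set ℕ) (c : (Bool → Bool) × (Bool → Bool)) (p : ℝ × ℝ) : Prop :=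
  0 ≤ p.1 ∧ (∃ c', Feasible D.val S c' p.2) ∧ ∀ s, Feasible D.val S c s → p.1 < s ∨ p.2 ≤ s

theorem candidate_mono (hR : Represents I D) (a σ : Bool) (t : ℝ) {i j : ℕ} (hij : i ≤ j)
    (hj : j < D.n) : candidate I a σ (t, i) ≤ candidate I a σ (t, j) := by
  have hw := hR.lt_two_pow
  cases σ
  · simp only [candidate, Bool.false_eq_true, if_false]
    rw [hR.coord a _ hj, hR.coord a _ (hij.trans_lt hj)]
    linarith [D.coord_mono a i j hij hj]
  · simp only [candidate, if_true]
    rw [hR.wordAt_three, wadd_eq (by omega), wadd_eq (by omega), wsub_eq (by omega) (by omega),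
      wsub_eq (by omega) (by omega), hR.coord a _ (by omega), hR.coord a _ (by omega)]
    linarith [D.coord_mono a (D.n - (j + 1)) (D.n - (i + 1)) (by omega) (by omega)]

/-- For `σ = true` the coordinates are listed from the largest on so that the distances ascend; the
index of a rank is therefore its reflection. -/
theorem exists_candidate_eq (hR : Represents I D) (a σ : Bool) (t : ℝ) {k : ℕ} (hk : k < D.n) :
    ∃ m < D.n, candidate I a σ (t, m) = signed σ (D.val a k) - signed σ t := by
  have hw := hR.lt_two_pow
  have hp := pos_lt a hk
  cases σ
  · refine ⟨D.pos a k, hp, ?_⟩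
    simp only [candidate, Bool.false_eq_true, if_false, signed]
    rw [hR.coord a _ hp, val]
  · refine ⟨D.n - (D.pos a k + 1), by omega, ?_⟩
    simp only [candidate, if_true, signed]
    rw [hR.wordAt_three, wadd_eq (by omega), wsub_eq (by omega) (by omega),
      show D.n - (D.n - (D.pos a k + 1) + 1) = D.pos a k by omega, hR.coord a _ hp, val]
    ring

theorem searchAxis_spec (hR : Represents I D) (c : (Bool → Bool) × (Bool → Bool)) (a σ : Bool)
    (hb : ValidBox D b) (H : D.IsHull h (D.boxPoints b)) (h' : Box) {p : ℝ × ℝ}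
    (hp : Bounds D (D.boxPoints b) c p) :
    Bounds D (D.boxPoints b) c (searchAxis I c a σ (((b, h), h'), p)) ∧
      p.1 ≤ (searchAxis I c a σ (((b, h), h'), p)).1 ∧
      (searchAxis I c a σ (((b, h), h'), p)).2 ≤ p.2 ∧
      ∀ k < D.n, signed σ (D.val a k) - signed σ (anchor I a σ h') ≤
          (searchAxis I c a σ (((b, h), h'), p)).1 ∨
        (searchAxis I c a σ (((b, h), h'), p)).2 ≤
          signed σ (D.val a k) - signed σ (anchor I a σ h') := by
  have hw := hR.lt_two_pow
  set t := anchor I a σ h' with ht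
  -- Candidates before the window are at most the lower bound, those behind it at least the upper
  -- bound. The bounds may cross, since the upper one may stem from other corners.
  set P : (ℝ × ℝ) × (ℕ × ℕ) → Prop := fun s => (Bounds D (D.boxPoints b) c s.1 ∧
    p.1 ≤ s.1.1 ∧ s.1.2 ≤ p.2) ∧ (s.2.1 ≤ s.2.2 ∧ s.2.2 ≤ D.n) ∧
    (∀ k < s.2.1, candidate I a σ (t, k) ≤ s.1.1) ∧
    ∀ k < D.n, s.2.2 ≤ k → s.1.2 ≤ candidate I a σ (t, k) with hP
  have hstep : ∀ s, P s → P (probeStep I c a σ ((b, h), t) s) ∧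
      (probeStep I c a σ ((b, h), t) s).2.2 - (probeStep I c a σ ((b, h), t) s).2.1 ≤
        (s.2.2 - s.2.1) / 2 := by
    rintro ⟨⟨lo, hi⟩, l, r⟩ hPs
    obtain ⟨⟨⟨h1, h2, h3⟩, h4, h5⟩, ⟨h6, h7⟩, h8, h9⟩ := id hPs
    simp only at h1 h2 h3 h4 h5 h6 h7 h8 h9
    by_cases hlr : l < r
    · have hm : wadd I l r / 2 = (l + r) / 2 := by rw [wadd_eq (by omega)]
      have hm1 : wadd I ((l + r) / 2) 1 = (l + r) / 2 + 1 := wadd_eq (by omega)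
      simp only [probeStep, hm, hm1, if_pos hlr]
      set m := (l + r) / 2 with hmdef
      have hmn : m < D.n := by omega
      set s := candidate I a σ (t, m)
      -- A candidate not above the lower bound needs no probe, which also keeps every probed value
      -- nonnegative. An infeasible candidate excludes all smaller values, and a feasible one
      -- becomes an upper bound.
      split_ifs with h10 h11
      · have hinf : ¬ Feasible D.val (D.boxPoints b) c s := by
          rw [feasible_iff hR c hb H (h1.trans h10.le)]
          exact not_le.2 h11
        refine ⟨⟨⟨⟨h1.trans h10.le, h2, fun s' hs' => ?_⟩, h4.trans h10.le, h5⟩,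
          ⟨?_, h7⟩, fun k hk => ?_, h9⟩, ?_⟩
        · left
          by_contra hle
          exact hinf (hs'.mono (not_lt.1 hle))
        · simp only
          omega
        · exact candidate_mono hR a σ t (Nat.lt_succ_iff.1 hk) hmn
        · simp only
          omega
      · have hfe : Feasible D.val (D.boxPoints b) c s := by
          rw [feasible_iff hR c hb H (h1.trans h10.le)]
          exact not_lt.1 h11
        refine ⟨⟨⟨⟨h1, ?_, fun s' hs' => ?_⟩, h4, (min_le_left _ _).trans h5⟩,
          ⟨?_, ?_⟩, h8, fun k hk hk' => ?_⟩, ?_⟩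
        · rcases min_choice hi s with he | he <;> simp only [he]
          · exact h2
          · exact ⟨c, hfe⟩
        · exact (h3 s' hs').imp_right (min_le_left _ _).trans
        · simp only
          omega
        · simp only
          omega
        · exact (min_le_right _ _).trans (candidate_mono hR a σ t hk' hk)
        · simp only
          omega
      · refine ⟨⟨⟨⟨h1, h2, h3⟩, h4, h5⟩, ⟨?_, h7⟩, fun k hk => ?_, h9⟩, ?_⟩
        · simp only
          omega
        · exact (candidate_mono hR a σ t (Nat.lt_succ_iff.1 hk) hmn).trans (not_lt.1 h10)
        · simp only
          omega
    · rw [probeStep, if_neg hlr]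
      refine ⟨hPs, ?_⟩
      simp only
      omega
  obtain ⟨⟨⟨h1, h2, h3⟩, ⟨h4, h5⟩, h6, h7⟩, h8⟩ := iterate_gap_le (P := P)
    (gap := fun s => s.2.2 - s.2.1) hstep (s := (p, (0, I.M.wordAt 3)))
    ⟨⟨hp, le_rfl, le_rfl⟩, ⟨Nat.zero_le _, hR.wordAt_three.le⟩, by simp, fun k hk hk' => by
      rw [hR.wordAt_three] at hk'
      simp only at hk'
      omega⟩ I.L
  have hdef : ((probeStep I c a σ ((b, h), t))^[I.L] (p, (0, I.M.wordAt 3))).1 =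
    searchAxis I c a σ (((b, h), h'), p) := rfl
  rw [hdef] at h1 h2 h3 h6 h7
  refine ⟨h1, h2, h3, fun k hk => ?_⟩
  obtain ⟨m, hm, he⟩ := exists_candidate_eq hR a σ t hk
  rw [← he]
  have hgap : (p, (0, I.M.wordAt 3)).2.2 - (p, (0, I.M.wordAt 3)).2.1 < 2 ^ I.L := by
    rw [hR.wordAt_three]
    exact hR.lt_pow
  rw [Nat.div_eq_of_lt hgap] at h8
  rcases Nat.lt_or_ge m ((probeStep I c a σ ((b, h), t))^[I.L] (p, (0, I.M.wordAt 3))).2.1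
    with hlt | hge
  · exact Or.inl (h6 m hlt)
  · exact Or.inr (h7 m hm (by omega))

theorem searchCorner_spec (hR : Represents I D) (c : (Bool → Bool) × (Bool → Bool))
    (d : Bool → Bool) (hb : ValidBox D b) (H : D.IsHull h (D.boxPoints b)) (h' : Box) {p : ℝ × ℝ}
    (hp : Bounds D (D.boxPoints b) c p) :
    Bounds D (D.boxPoints b) c (searchCorner I c d (((b, h), h'), p)) ∧
      p.1 ≤ (searchCorner I c d (((b, h), h'), p)).1 ∧
      (searchCorner I c d (((b, h), h'), p)).2 ≤ p.2 ∧
      ∀ a, ∀ k < D.n, signed (d a) (D.val a k) - signed (d a) (anchor I a (d a) h') ≤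
          (searchCorner I c d (((b, h), h'), p)).1 ∨
        (searchCorner I c d (((b, h), h'), p)).2 ≤
          signed (d a) (D.val a k) - signed (d a) (anchor I a (d a) h') := by
  obtain ⟨h1, h2, h3, h4⟩ := searchAxis_spec hR c false (d false) hb H h' hp
  obtain ⟨h5, h6, h7, h8⟩ := searchAxis_spec hR c true (d true) hb H h' h1
  exact ⟨h5, h2.trans h6, h7.trans h3, Bool.forall_bool.2
    ⟨fun k hk => (h4 k hk).imp (fun h => h.trans h6) (fun h => h7.trans h), h8⟩⟩

/-- The rest does not change between consecutive distances from the corner. -/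
theorem rest_eq_of_forall (hR : Represents I D) {T : Set ℕ} (H : D.IsHull h T) (c : Bool → Bool)
    {s s' : ℝ} (hs : s ≤ s') (hc : ∀ a, ∀ k < D.n,
      signed (c a) (D.val a k) - signed (c a) (anchor I a (c a) h) ≤ s ∨
        s' < signed (c a) (D.val a k) - signed (c a) (anchor I a (c a) h)) :
    rest D.val c s T = rest D.val c s' T := by
  refine Set.Subset.antisymm ?_ (rest_mono c hs subset_rfl)
  rintro p ⟨hp, a, q, hq, hpq⟩
  obtain ⟨⟨q', hq', he⟩, hmin⟩ := anchor_spec hR H ⟨p, hp⟩ a (c a)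
  have h1 := hmin q hq
  refine ⟨hp, a, q', hq', ?_⟩
  rw [he]
  rcases hc a p (H.sub p hp) with h2 | h2 <;> linarith

/-- Suppose some feasible `s` were smaller than the value found. Then `s` would lie strictly between
the final bounds, where both remainders are constant. So the third side length computed at the lower
bound would be at most `s`, and the value found would not exceed `s`. -/
theorem search_spec (hR : Represents I D) (c : (Bool → Bool) × (Bool → Bool))
    (hb : ValidBox D b) (H : D.IsHull h (D.boxPoints b)) {u : ℝ}
    (hu : ∃ c', Feasible D.val (D.boxPoints b) c' u) :
    (∃ c', Feasible D.val (D.boxPoints b) c' (search I c ((b, h), u))) ∧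
      search I c ((b, h), u) ≤ u ∧
      ∀ s, Feasible D.val (D.boxPoints b) c s → search I c ((b, h), u) ≤ s := by
  set S := D.boxPoints b with hS
  have h0 : Bounds D S c (0, if 0 < leftover I c ((b, h), 0) then u else min u 0) := by
    refine ⟨le_rfl, ?_, fun s hs => ?_⟩
    · split_ifs with hpos
      · exact hu
      · rcases min_choice u 0 with he | he <;> simp only [he]
        · exact hu
        · exact ⟨c, (feasible_iff hR c hb H le_rfl).2 (not_lt.1 hpos)⟩
    · split_ifs with hpos
      · left
        refine lt_of_le_of_ne hs.1 ?_
        rintro rfl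
        exact absurd ((feasible_iff hR c hb H le_rfl).1 hs) (not_le.2 hpos)
      · exact Or.inr ((min_le_right _ _).trans hs.1)
  have hu0 : (if 0 < leftover I c ((b, h), 0) then u else min u 0) ≤ u := by
    split_ifs
    · exact le_rfl
    · exact min_le_left _ _
  obtain ⟨p1, p2, p3, p4⟩ := searchCorner_spec hR c c.1 hb H h h0
  have hp : searchCorner I c c.1 (((b, h), h), (0, if 0 < leftover I c ((b, h), 0) then u else
    min u 0)) = searchFirst I c ((b, h), u) := rfl
  rw [hp] at p1 p2 p3 p4
  set p := searchFirst I c ((b, h), u)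
  obtain ⟨q1, q2, q3, q4⟩ := searchCorner_spec hR c c.2 hb H (hullRest I c.1 ((b, h), p.1)) p1
  have hq : searchCorner I c c.2 (((b, h), hullRest I c.1 ((b, h), p.1)), p) =
    searchSecond I c ((b, h), u) := rfl
  rw [hq] at q1 q2 q3 q4
  have hdef : search I c ((b, h), u) = min (searchSecond I c ((b, h), u)).2
    (max (searchSecond I c ((b, h), u)).1
      (leftover I c ((b, h), (searchSecond I c ((b, h), u)).1))) := rfl
  rw [hdef]
  set q := searchSecond I c ((b, h), u)
  obtain ⟨e0, e1⟩ := leftover_spec hR c hb H q.1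
  set e := leftover I c ((b, h), q.1)
  refine ⟨?_, (min_le_left _ _).trans (q3.trans (p3.trans hu0)), fun s hs => ?_⟩
  · rcases min_choice q.2 (max q.1 e) with he | he <;> rw [he]
    · exact q1.2.1
    -- Raising the side length from `q.1` to `max q.1 e` only shrinks the remainder, and that
    -- remainder fits into side length `e` already.
    · refine ⟨c, e0.trans (le_max_right _ _), ?_⟩
      exact ((e1 e e0).1 le_rfl).mono (le_max_right _ _)
        (rest_mono _ (le_max_left _ _) (rest_mono _ (le_max_left _ _) subset_rfl))
  · by_contra hlt
    rw [not_le, lt_min_iff] at hlt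
    have hqs : q.1 < s := (q1.2.2 s hs).resolve_right (not_le.2 hlt.1)
    -- No distance from the first corner lies strictly between the bounds, so the first remainder is
    -- the same at `p.1` and `s`, hence also at `q.1` in between.
    have r1 : rest D.val c.1 p.1 S = rest D.val c.1 s S :=
      rest_eq_of_forall hR H c.1 (q2.trans hqs.le) fun a k hk => (p4 a k hk).imp_right
        fun h => (hlt.1.trans_le q3).trans_le h
    have r2 : rest D.val c.1 q.1 S = rest D.val c.1 s S :=
      Set.Subset.antisymm ((rest_mono c.1 q2 subset_rfl).trans r1.subset)
        (rest_mono c.1 hqs.le subset_rfl)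
    -- The second search used the hull computed at `p.1`. It is also the hull at `s`, so its
    -- distances are the right ones.
    have r3 : rest D.val c.2 q.1 (rest D.val c.1 s S) = rest D.val c.2 s (rest D.val c.1 s S) := by
      have H1 := isHull_hullRest hR c.1 hb H p.1
      rw [← hS, r1] at H1
      exact rest_eq_of_forall hR H1 c.2 hqs.le fun a k hk => (q4 a k hk).imp_right
        fun h => hlt.1.trans_le h
    have hes : e ≤ s := by
      rw [e1 s hs.1, r2, r3]
      exact hs.2
    exact absurd hlt.2 (not_lt.2 (max_le hqs.le hes))

theorem searchAll_spec (hR : Represents I D) (hb : ValidBox D b)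
    (H : D.IsHull h (D.boxPoints b)) (cs : List ((Bool → Bool) × (Bool → Bool))) {u : ℝ}
    (hu : ∃ c', Feasible D.val (D.boxPoints b) c' u) :
    (∃ c', Feasible D.val (D.boxPoints b) c' (searchAll I cs ((b, h), u))) ∧
      searchAll I cs ((b, h), u) ≤ u ∧
      ∀ c ∈ cs, ∀ s, Feasible D.val (D.boxPoints b) c s → searchAll I cs ((b, h), u) ≤ s := by
  induction cs generalizing u with
  | nil => exact ⟨hu, le_rfl, by simp⟩
  | cons c cs ih =>
    obtain ⟨h1, h2, h3⟩ := search_spec hR c hb H hu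
    obtain ⟨h4, h5, h6⟩ := ih h1
    refine ⟨h4, h5.trans h2, fun c' hc' s hs => ?_⟩
    rcases List.mem_cons.1 hc' with rfl | hc'
    · exact h5.trans (h3 s hs)
    · exact h6 c' hc' s hs

/-- The search returns only a side length; corners that realize it are found afterwards by testing
all pairs. -/
theorem firstSquares_spec (hR : Represents I D) (hb : ValidBox D b)
    (H : D.IsHull h (D.boxPoints b)) (cs : List ((Bool → Bool) × (Bool → Bool))) {s : ℝ}
    (hs : ∃ c ∈ cs, Feasible D.val (D.boxPoints b) c s) :
    ∃ c, Feasible D.val (D.boxPoints b) c s ∧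
      firstSquares I cs ((b, h), s) = squaresAt I c ((b, h), s) := by
  induction cs with
  | nil => simp at hs
  | cons c cs ih =>
    obtain ⟨c', hc', hf⟩ := hs
    rw [firstSquares]
    split_ifs with hlt
    · refine ih ⟨c', ?_, hf⟩
      rcases List.mem_cons.1 hc' with rfl | hc'
      · exact absurd ((feasible_iff hR c' hb H hf.1).1 hf) (not_le.2 hlt)
      · exact hc'
    · exact ⟨c, (feasible_iff hR c hb H hf.1).2 (not_lt.1 hlt), rfl⟩

/-- A square of the output covers everything outside the rest. -/
theorem mem_square_cornerPoint (hR : Represents I D) {T : Set ℕ} (H : D.IsHull h T)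
    (d : Bool → Bool) (s : ℝ) {k : ℕ} (hk : k ∈ T) (hkr : k ∉ rest D.val d s T) :
    (D.val false k, D.val true k) ∈ square (cornerPoint I d (h, s)) s := by
  have := inSquare_of_notMem_rest (v := D.val) (m := fun a => anchor I a (d a) h)
    (fun a => (anchor_spec hR H ⟨k, hk⟩ a (d a)).1)
    (fun a => (anchor_spec hR H ⟨k, hk⟩ a (d a)).2) hk hkr
  have h0 := this false
  have h1 := this true
  simp only at h0 h1
  rw [square, Set.mem_Icc, Prod.le_def, Prod.le_def]
  simp only [cornerPoint, Prod.fst_add, Prod.snd_add]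
  cases h2 : d false <;> cases h3 : d true <;>
    simp only [h2, h3, if_true, Bool.false_eq_true, if_false] at h0 h1 ⊢ <;>
    exact ⟨⟨h0.1, h1.1⟩, h0.2, h1.2⟩

theorem answerBox_spec (hR : Represents I D) (hb : ValidBox D b)
    (H : D.IsHull h (D.boxPoints b)) {S : Set (ℝ × ℝ)}
    (hS : ∀ p, p ∈ S ↔ ∃ k ∈ D.boxPoints b, p = (D.val false k, D.val true k))
    {x : ℝ × (ℝ × ℝ) × (ℝ × ℝ) × (ℝ × ℝ)} (hx : answerBox I (b, h) = x) :
    IsOptimalCenter S ![x.2.1, x.2.2.1, x.2.2.2] x.1 := by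
  subst hx
  rw [answerBox]
  have hne : h.1.1 < h.1.2 ↔ (D.boxPoints b).Nonempty := H.nonempty_iff false
  split_ifs with hlt
  · have hfin : (D.boxPoints b).Finite := (Set.finite_Iio D.n).subset fun k hk => hk.1
    obtain ⟨x0, x1⟩ := extent_spec hR H
    -- Initial upper bound: one square of this size covers everything, whatever the corners are.
    have hu : ∃ c', Feasible D.val (D.boxPoints b) c' (extent I h) :=
      ⟨(fun _ => false, fun _ => false), x0, ((x1 _ x0).1 le_rfl).mono le_rfl
        ((rest_subset _ _ _).trans (rest_subset _ _ _))⟩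
    obtain ⟨h1, -, h2⟩ := searchAll_spec hR hb H cornerPairs hu
    simp only
    set s := searchAll I cornerPairs ((b, h), extent I h)
    have hall : ∀ c, c ∈ cornerPairs := fun c => by simp [cornerPairs]
    obtain ⟨c₀, hc₀⟩ := h1
    obtain ⟨c, hc, he⟩ := firstSquares_spec hR hb H cornerPairs ⟨c₀, hall c₀, hc₀⟩
    rw [he]
    refine ⟨⟨hc.1, fun p hp => ?_⟩, fun o s' hcov => ?_⟩
    · obtain ⟨k, hk, rfl⟩ := (hS p).1 hp
      rw [Set.mem_iUnion]
      by_cases k1 : k ∈ rest D.val c.1 s (D.boxPoints b)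
      · by_cases k2 : k ∈ rest D.val c.2 s (rest D.val c.1 s (D.boxPoints b))
        · refine ⟨2, mem_square_cornerPoint hR (isHull_hullRestRest hR c hb H s)
            (fun _ => false) s k2 ?_⟩
          rw [rest_eq_empty_of_narrow hc.2]
          exact Set.notMem_empty k
        · exact ⟨1, mem_square_cornerPoint hR (isHull_hullRest hR c.1 hb H s) _ s k1 k2⟩
      · exact ⟨0, mem_square_cornerPoint hR H _ s hk k1⟩
    -- Any competing three squares yield a feasible pair of corners for their side length, and the
    -- search has minimized over all pairs.
    · obtain ⟨c', hc'⟩ := exists_feasible (v := D.val) hfin hcov.1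
        (fun j a => if a then (o j).2 else (o j).1) fun k hk => by
          obtain ⟨j, hj⟩ := Set.mem_iUnion.1 (hcov.2 ((hS _).2 ⟨k, hk, rfl⟩))
          rw [square, Set.mem_Icc, Prod.le_def, Prod.le_def] at hj
          exact ⟨j, Bool.forall_bool.2 ⟨⟨hj.1.1, hj.2.1⟩, ⟨hj.1.2, hj.2.2⟩⟩⟩
      exact h2 c' (hall c') s' hc'
  · refine ⟨⟨le_rfl, fun p hp => ?_⟩, fun _ _ hcov => hcov.1⟩
    obtain ⟨k, hk, -⟩ := (hS p).1 hp
    exact absurd (hne.2 ⟨k, hk⟩) hlt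

/-- The query becomes a box of ranks: a lower end is the first rank with coordinate at least the
given value, and an upper end the first rank with coordinate greater than it. -/
theorem answer_spec (hR : Represents I D) {P : Set (ℝ × ℝ)}
    (hP : ∀ p, p ∈ P ↔ ∃ k < D.n, p = (D.val false k, D.val true k)) (q₁ q₂ : ℝ × ℝ) :
    IsOptimalCenter (P ∩ Set.Icc q₁ q₂) ![(answer I (q₁, q₂)).2.1, (answer I (q₁, q₂)).2.2.1,
      (answer I (q₁, q₂)).2.2.2] (answer I (q₁, q₂)).1 := by
  have hb : ValidBox D (queryBox I (q₁, q₂)) := Bool.forall_bool.2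
    ⟨(firstRank_spec hR false false q₂.1).1, (firstRank_spec hR true false q₂.2).1⟩
  have H := isHull_addRange hR hb (isHull_empty (D := D))
  rw [Set.empty_union, ← hR.wordAt_three] at H
  refine answerBox_spec hR hb H (fun p => ?_) rfl
  have hmem : ∀ k, k ∈ D.boxPoints (queryBox I (q₁, q₂)) ↔ k < D.n ∧
      (D.val false k, D.val true k) ∈ Set.Icc q₁ q₂ := by
    intro k
    rw [Set.mem_Icc, Prod.le_def, Prod.le_def]
    refine and_congr_right fun hk => ?_
    rw [Bool.forall_bool]
    have h0 := (firstRank_spec hR false true q₁.1).2 _ (pos_lt false hk)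
    have h1 := (firstRank_spec hR false false q₂.1).2 _ (pos_lt false hk)
    have h2 := (firstRank_spec hR true true q₁.2).2 _ (pos_lt true hk)
    have h3 := (firstRank_spec hR true false q₂.2).2 _ (pos_lt true hk)
    rw [← not_iff_not, not_le] at h1 h3
    simp only [if_true, Bool.false_eq_true, if_false, not_lt] at h0 h1 h2 h3
    simp only [queryBox, side, if_true, Bool.false_eq_true, if_false, h0, h1, h2, h3]
    simp only [val]
    tauto
  rw [Set.mem_inter_iff, hP]
  constructor
  · rintro ⟨⟨k, hk, rfl⟩, hq⟩
    exact ⟨k, (hmem k).2 ⟨hk, hq⟩, rfl⟩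
  · rintro ⟨k, hk, rfl⟩
    exact ⟨⟨k, hk.1, rfl⟩, ((hmem k).1 hk).2⟩

end

open Realizable

/-! ### The query algorithm is realizable -/

section

variable {d : ℕ} {α : Type} [Enc α]

theorem Realizable.wordAt_const {k : ℕ} (hk : k < 16) :
    Realizable d fun I (_ : α) => I.M.wordAt k := wordAt (const hk)

theorem realizable_zerosLookup (a : Bool) {f g : Inst → α → ℕ} (hf : Realizable d f)
    (hg : Realizable d g) : Realizable d fun I x => zerosLookup I a (f I x) (g I x) := by
  have h4 : Realizable d fun I (_ : α) => I.M.wordAt 4 := wordAt_const (by norm_num)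
  have h5 : Realizable d fun I (_ : α) => I.M.wordAt 5 := wordAt_const (by norm_num)
  have h6 : Realizable d fun I (_ : α) => I.M.wordAt 6 := wordAt_const (by norm_num)
  have hb : Realizable d fun I (_ : α) => I.M.wordAt (if a then 8 else 7) :=
    wordAt_const (by split_ifs <;> norm_num)
  have h10 : Realizable d fun (_ : Inst) (_ : α) => 10 := const (by norm_num)
  have hw := wordAt (hb.wadd ((hf.wmul h6).wadd (hg.div h4)))
  exact (hw.div (wordAt (h10.wadd h4))).wadd ((hw.div (wordAt (h10.wadd (hg.mod h4)))).mod h5)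

theorem realizable_coordAt (a : Bool) {f : Inst → α → ℕ} (hf : Realizable d f) :
    Realizable d fun I x => coordAt I a (f I x) := by
  cases a
  · exact realAt hf
  · exact realAt ((wordAt_const (by norm_num)).wadd hf)

theorem realizable_descendZero (a : Bool) : Realizable d fun I s => descendZero I a s := by
  have h1 : Realizable d fun _ (s : DescentState) => s.1 := fst id
  have h2 : Realizable d fun _ (s : DescentState) => s.2.1 := fst (snd id)
  have h3 : Realizable d fun _ (s : DescentState) => s.2.2.1 := fst (snd (snd id))
  have h4 : Realizable d fun _ (s : DescentState) => s.2.2.2.1 := fst (snd (snd (snd id)))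
  have h5 : Realizable d fun _ (s : DescentState) => s.2.2.2.2 := snd (snd (snd (snd id)))
  exact (h1.wadd (const (by norm_num))).pair ((realizable_zerosLookup a h1 h2).pair
    ((realizable_zerosLookup a h1 h3).pair (h4.pair (h5.wadd h5))))

theorem realizable_descendOne (a : Bool) : Realizable d fun I s => descendOne I a s := by
  have h1 : Realizable d fun _ (s : DescentState) => s.1 := fst id
  have h2 : Realizable d fun _ (s : DescentState) => s.2.1 := fst (snd id)
  have h3 : Realizable d fun _ (s : DescentState) => s.2.2.1 := fst (snd (snd id))
  have h4 : Realizable d fun _ (s : DescentState) => s.2.2.2.1 := fst (snd (snd (snd id)))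
  have h5 : Realizable d fun _ (s : DescentState) => s.2.2.2.2 := snd (snd (snd (snd id)))
  have hn : Realizable d fun I (_ : DescentState) => I.M.wordAt 3 := wordAt_const (by norm_num)
  have hZ := realizable_zerosLookup a h1 hn
  have hi := realizable_zerosLookup a h1 h2
  have hj := realizable_zerosLookup a h1 h3
  exact (h1.wadd (const (by norm_num))).pair ((hZ.wadd (h2.wsub hi)).pair
    ((hZ.wadd (h3.wsub hj)).pair ((h4.wadd (hj.wsub hi)).pair
      ((h5.wadd h5).wadd (const (by norm_num))))))

theorem realizable_countLess (a : Bool) :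
    Realizable (d + 1) fun I (x : ℕ × ℕ × ℕ) => countLess I a x := by
  have h0 : Realizable (d + 1) fun _ (_ : ℕ × ℕ × ℕ) => 0 := const (by norm_num)
  have hy : Realizable d fun _ (p : (ℕ × ℕ × ℕ) × (ℕ × DescentState)) => p.1.2.2 :=
    snd (snd (fst id))
  have hs : Realizable d fun _ (p : (ℕ × ℕ × ℕ) × (ℕ × DescentState)) => p.2.2 := snd (snd id)
  have hp : Realizable d fun _ (p : (ℕ × ℕ × ℕ) × (ℕ × DescentState)) => p.2.1 / 2 :=
    (fst (snd id)).div (const (by norm_num))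
  refine fst (snd (snd (snd (snd (iterate (f := fun I (x : ℕ × ℕ × ℕ) => countStep I a x.2.2)
    ?_ ((wordAt_const (by norm_num)).pair (h0.pair ((fst id).pair ((fst (snd id)).pair
      (h0.pair h0))))))))))
  exact hp.pair (ite_nat ((hy.div hp).mod (const (by norm_num))) (const (by norm_num))
    ((realizable_descendZero a).comp hs) ((realizable_descendOne a).comp hs))

theorem realizable_select (a : Bool) :
    Realizable (d + 1) fun I (x : ℕ × ℕ × ℕ) => select I a x := by
  have h0 : Realizable (d + 1) fun _ (_ : ℕ × ℕ × ℕ) => 0 := const (by norm_num)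
  have hk : Realizable d fun _ (p : (ℕ × ℕ × ℕ) × DescentState) => p.1.2.2 :=
    snd (snd (fst id))
  have hs : Realizable d fun _ (p : (ℕ × ℕ × ℕ) × DescentState) => p.2 := snd id
  refine snd (snd (snd (snd (iterate (f := fun I (x : ℕ × ℕ × ℕ) => selectStep I a x.2.2)
    ?_ (h0.pair ((fst id).pair ((fst (snd id)).pair (h0.pair h0))))))))
  exact ite_nat hk ((fst (snd (snd (snd hs)))).wadd
    ((realizable_zerosLookup a (fst hs) (fst (snd (snd hs)))).wsub
      (realizable_zerosLookup a (fst hs) (fst (snd hs)))))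
    ((realizable_descendZero a).comp hs) ((realizable_descendOne a).comp hs)

theorem realizable_side (a : Bool) {f : Inst → α → Box} (hf : Realizable d f) :
    Realizable d fun I x => side a (f I x) := by
  cases a
  · exact fst hf
  · exact snd hf

theorem realizable_countBelow (a up : Bool) :
    Realizable (d + 1) fun I b => countBelow I a up b := by
  refine (realizable_countLess a).comp ((fst (realizable_side a id)).pair
    ((snd (realizable_side a id)).pair ?_))
  cases up
  · exact fst (realizable_side (!a) id)
  · exact snd (realizable_side (!a) id)

theorem realizable_extremes (a : Bool) : Realizable (d + 1) fun I b => extremes I a b := by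
  have h1 : Realizable (d + 1) fun _ (b : Box) => (side a b).1 := fst (realizable_side a id)
  have h2 : Realizable (d + 1) fun _ (b : Box) => (side a b).2 := snd (realizable_side a id)
  exact ((realizable_select a).comp (h1.pair (h2.pair (realizable_countBelow a false)))).pair
    (((realizable_select a).comp (h1.pair (h2.pair ((realizable_countBelow a true).wsub
      (const (by norm_num)))))).wadd (const (by norm_num)))

theorem realizable_join {f g : Inst → α → ℕ × ℕ} (hf : Realizable d f) (hg : Realizable d g) :
    Realizable d fun I x => join (f I x) (g I x) :=
  ((fst hf).min_nat (fst hg)).pair ((snd hf).max_nat (snd hg))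

theorem realizable_addRange : Realizable (d + 1) fun I x => addRange I x := by
  have h1 : Realizable (d + 1) fun _ (x : Box × Box) => x.1 := fst id
  have h2 : Realizable (d + 1) fun _ (x : Box × Box) => x.2 := snd id
  exact ite_nat (fst (fst h1)) (snd (fst h1)) (ite_nat (fst (snd h1)) (snd (snd h1))
    (ite_nat ((realizable_countBelow false false).comp h1)
      ((realizable_countBelow false true).comp h1)
      ((realizable_join (fst h2) ((realizable_extremes true).comp h1)).pair
        (realizable_join (snd h2) ((realizable_extremes false).comp h1))) h2) h2) h2

theorem realizable_firstRank (a σ : Bool) :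
    Realizable (d + 1) fun I t => firstRank I a σ t := by
  refine fst (iterate (f := fun I (t : ℝ) => bisectStep I a σ t) ?_
    ((const (by norm_num)).pair (wordAt_const (by norm_num))))
  have ht : Realizable d fun _ (p : ℝ × (ℕ × ℕ)) => p.1 := fst id
  have hl : Realizable d fun _ (p : ℝ × (ℕ × ℕ)) => p.2.1 := fst (snd id)
  have hr : Realizable d fun _ (p : ℝ × (ℕ × ℕ)) => p.2.2 := snd (snd id)
  have hm := (hl.wadd hr).div (const (k := 2) (by norm_num))
  have hm1 := hm.wadd (const (k := 1) (by norm_num))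
  have hc := realizable_coordAt a hm
  refine ite_nat hl hr ?_ (snd id)
  cases σ
  · exact ite_real ht hc (hl.pair hm) (hm1.pair hr)
  · exact ite_real hc ht (hm1.pair hr) (hl.pair hm)

theorem realizable_cut (a σ : Bool) {f : Inst → α → Box} {g : Inst → α → ℕ}
    (hf : Realizable d f) (hg : Realizable d g) :
    Realizable d fun I x => cut a σ (f I x, g I x) := by
  have hs := realizable_side a hf
  have hx : Realizable d fun I x => if σ then ((side a (f I x)).1, min (side a (f I x)).2 (g I x))
      else (max (side a (f I x)).1 (g I x), (side a (f I x)).2) := by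
    cases σ
    · exact ((fst hs).max_nat hg).pair (snd hs)
    · exact (fst hs).pair ((snd hs).min_nat hg)
  cases a
  · exact hx.pair (snd hf)
  · exact (fst hf).pair hx

theorem realizable_anchor (a σ : Bool) {f : Inst → α → Box} (hf : Realizable d f) :
    Realizable d fun I x => anchor I a σ (f I x) := by
  have hs := realizable_side a hf
  cases σ
  · exact realizable_coordAt a (fst hs)
  · exact realizable_coordAt a ((snd hs).wsub (const (by norm_num)))

theorem realizable_cutBeyond (a σ : Bool) :
    Realizable (d + 1) fun I x => cutBeyond I a σ x := by
  have hA : Realizable (d + 1) fun I (x : (Box × Box) × ℝ) => anchor I a σ x.1.2 :=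
    realizable_anchor a σ (snd (fst id))
  have hs : Realizable (d + 1) fun _ (x : (Box × Box) × ℝ) => x.2 := snd id
  refine realizable_cut a σ (fst (fst id)) ((realizable_firstRank a σ).comp ?_)
  cases σ
  · exact hA.add hs
  · exact hA.sub hs

theorem realizable_emptyBox :
    Realizable d fun I (_ : α) => (((I.M.wordAt 3, 0), (I.M.wordAt 3, 0)) : Box) := by
  have h : Realizable d fun I (_ : α) => (I.M.wordAt 3, 0) :=
    (wordAt_const (by norm_num)).pair (const (by norm_num))
  exact h.pair h

theorem realizable_hullRest (c : Bool → Bool) :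
    Realizable (d + 1) fun I x => hullRest I c x :=
  realizable_addRange.comp ((realizable_cutBeyond true (c true)).pair
    (realizable_addRange.comp ((realizable_cutBeyond false (c false)).pair realizable_emptyBox)))

theorem realizable_hullRestRest (c : (Bool → Bool) × (Bool → Bool)) :
    Realizable (d + 1) fun I x => hullRestRest I c x := by
  have hs : Realizable (d + 1) fun _ (x : (Box × Box) × ℝ) => x.2 := snd id
  have hb := fun a a' => (realizable_cutBeyond (d := d) a' (c.2 a')).comp
    (((realizable_cutBeyond a (c.1 a)).pair (realizable_hullRest c.1)).pair hs)
  exact realizable_addRange.comp ((hb true true).pair (realizable_addRange.comp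
    ((hb true false).pair (realizable_addRange.comp ((hb false true).pair
      (realizable_addRange.comp ((hb false false).pair realizable_emptyBox)))))))

theorem realizable_extent : Realizable d fun I h => extent I h :=
  ite_nat (fst (fst id)) (snd (fst id))
    (((realizable_anchor false true id).sub (realizable_anchor false false id)).max_real
      ((realizable_anchor true true id).sub (realizable_anchor true false id))) zero

theorem realizable_leftover (c : (Bool → Bool) × (Bool → Bool)) :
    Realizable (d + 1) fun I x => leftover I c x :=
  realizable_extent.comp (realizable_hullRestRest c)

theorem realizable_candidate (a σ : Bool) : Realizable d fun I x => candidate I a σ x := by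
  cases σ
  · exact (realizable_coordAt a (snd id)).sub (fst id)
  · exact (fst id).sub (realizable_coordAt a ((wordAt_const (by norm_num)).wsub
      ((snd id).wadd (const (by norm_num)))))

/-- The exponent 2 arises here: each of the `L` steps of the binary search makes at most one probe,
itself consisting of loops of `L` rounds. -/
theorem realizable_searchAxis (c : (Bool → Bool) × (Bool → Bool)) (a σ : Bool) :
    Realizable (d + 2) fun I x => searchAxis I c a σ x := by
  have hx : Realizable (d + 2) fun I (x : ((Box × Box) × Box) × (ℝ × ℝ)) =>
      ((x.1.1, anchor I a σ x.1.2), x.2) :=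
    ((fst (fst id)).pair (realizable_anchor a σ (snd (fst id)))).pair (snd id)
  refine comp (g := fun I (y : ((Box × Box) × ℝ) × (ℝ × ℝ)) =>
    ((probeStep I c a σ y.1)^[I.L] (y.2, (0, I.M.wordAt 3))).1) ?_ hx
  refine fst (iterate (f := fun I (y : ((Box × Box) × ℝ) × (ℝ × ℝ)) => probeStep I c a σ y.1) ?_
    ((snd id).pair ((const (by norm_num)).pair (wordAt_const (by norm_num)))))
  have hb : Realizable (d + 1) fun _ (p : (((Box × Box) × ℝ) × (ℝ × ℝ)) × ((ℝ × ℝ) × (ℕ × ℕ))) =>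
    p.1.1.1 := fst (fst (fst id))
  have ht : Realizable (d + 1) fun _ (p : (((Box × Box) × ℝ) × (ℝ × ℝ)) × ((ℝ × ℝ) × (ℕ × ℕ))) =>
    p.1.1.2 := snd (fst (fst id))
  have hs : Realizable (d + 1) fun _ (p : (((Box × Box) × ℝ) × (ℝ × ℝ)) × ((ℝ × ℝ) × (ℕ × ℕ))) =>
    p.2 := snd id
  have hl := fst (snd hs)
  have hr := snd (snd hs)
  have hm := (hl.wadd hr).div (const (k := 2) (by norm_num))
  have hm1 := hm.wadd (const (k := 1) (by norm_num))
  have hc := (realizable_candidate (d := d + 1) a σ).comp (ht.pair hm)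
  exact ite_nat hl hr (ite_real (fst (fst hs)) hc
    (ite_real hc ((realizable_leftover c).comp (hb.pair hc))
      ((hc.pair (snd (fst hs))).pair (hm1.pair hr))
      (((fst (fst hs)).pair ((snd (fst hs)).min_real hc)).pair (hl.pair hm)))
    ((fst hs).pair (hm1.pair hr))) hs

theorem realizable_searchCorner (c : (Bool → Bool) × (Bool → Bool)) (e : Bool → Bool) :
    Realizable (d + 2) fun I x => searchCorner I c e x :=
  (realizable_searchAxis c true (e true)).comp
    ((fst id).pair (realizable_searchAxis c false (e false)))

theorem realizable_searchFirst (c : (Bool → Bool) × (Bool → Bool)) :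
    Realizable (d + 2) fun I x => searchFirst I c x :=
  (realizable_searchCorner c c.1).comp (((fst id).pair (snd (fst id))).pair (zero.pair
    (ite_real zero ((realizable_leftover c).comp ((fst id).pair zero)) (snd id)
      ((snd id).min_real zero))))

theorem realizable_searchSecond (c : (Bool → Bool) × (Bool → Bool)) :
    Realizable (d + 2) fun I x => searchSecond I c x :=
  (realizable_searchCorner c c.2).comp (((fst id).pair ((realizable_hullRest c.1).comp
    ((fst id).pair (fst (realizable_searchFirst c))))).pair (realizable_searchFirst c))

theorem realizable_search (c : (Bool → Bool) × (Bool → Bool)) :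
    Realizable (d + 2) fun I x => search I c x :=
  (snd (realizable_searchSecond c)).min_real ((fst (realizable_searchSecond c)).max_real
    ((realizable_leftover c).comp ((fst id).pair (fst (realizable_searchSecond c)))))

/-- The list of corners does not depend on the memory, so it is unrolled into consecutive code. -/
theorem realizable_searchAll (cs : List ((Bool → Bool) × (Bool → Bool))) :
    Realizable (d + 2) fun I x => searchAll I cs x := by
  induction cs with
  | nil => exact snd id
  | cons c cs ih => exact ih.comp ((fst id).pair (realizable_search c))

theorem realizable_cornerPoint (e : Bool → Bool) {f : Inst → α → Box} {g : Inst → α → ℝ}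
    (hf : Realizable d f) (hg : Realizable d g) :
    Realizable d fun I x => cornerPoint I e (f I x, g I x) := by
  simp only [cornerPoint]
  refine pair ?_ ?_
  · cases e false
    · exact realizable_anchor false false hf
    · exact (realizable_anchor false true hf).sub hg
  · cases e true
    · exact realizable_anchor true false hf
    · exact (realizable_anchor true true hf).sub hg

theorem realizable_squaresAt (c : (Bool → Bool) × (Bool → Bool)) :
    Realizable (d + 1) fun I x => squaresAt I c x :=
  (snd id).pair ((realizable_cornerPoint c.1 (snd (fst id)) (snd id)).pair
    ((realizable_cornerPoint c.2 (realizable_hullRest c.1) (snd id)).pair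
      (realizable_cornerPoint (fun _ => false) (realizable_hullRestRest c) (snd id))))

theorem realizable_noSquares :
    Realizable d fun _ (_ : α) => ((0, (0, 0), (0, 0), (0, 0)) : ℝ × (ℝ × ℝ) × (ℝ × ℝ) × (ℝ × ℝ)) :=
  zero.pair ((zero.pair zero).pair ((zero.pair zero).pair (zero.pair zero)))

theorem realizable_firstSquares (cs : List ((Bool → Bool) × (Bool → Bool))) :
    Realizable (d + 1) fun I x => firstSquares I cs x := by
  induction cs with
  | nil => exact realizable_noSquares
  | cons c cs ih => exact ite_real (snd id) (realizable_leftover c) ih (realizable_squaresAt c)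

theorem realizable_queryBox : Realizable (d + 1) fun I q => queryBox I q := by
  have h : ∀ a σ {f : Inst → (ℝ × ℝ) × (ℝ × ℝ) → ℝ}, Realizable (d + 1) f →
      Realizable (d + 1) fun I q => firstRank I a σ (f I q) :=
    fun a σ _ hf => (realizable_firstRank a σ).comp hf
  exact ((h false true (fst (fst id))).pair (h false false (fst (snd id)))).pair
    ((h true true (snd (fst id))).pair (h true false (snd (snd id))))

theorem realizable_answerBox : Realizable (d + 2) fun I x => answerBox I x :=
  ite_nat (fst (fst (snd id))) (snd (fst (snd id)))
    ((realizable_firstSquares cornerPairs).comp (id.pair ((realizable_searchAll cornerPairs).comp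
      (id.pair (realizable_extent.comp (snd id)))))) realizable_noSquares

theorem realizable_answer : Realizable (d + 2) fun I q => answer I q :=
  realizable_answerBox.comp (realizable_queryBox.pair
    (realizable_addRange.comp (realizable_queryBox.pair realizable_emptyBox)))

end

/-! ### The data structure -/

theorem exists_pointSystem (P : Finset (ℝ × ℝ)) : ∃ D : PointSystem, D.n = P.card ∧
    ∀ p, p ∈ P ↔ ∃ k < D.n, p = (D.val false k, D.val true k) := by
  classical
  set e := P.equivFin.symm
  set f : Bool → Fin P.card → ℝ := fun a i => if a then (e i).1.2 else (e i).1.1 with hf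
  -- Sorting breaks ties, so equal coordinates receive distinct ranks and no general position is
  -- needed.
  set τ : Bool → Equiv.Perm (Fin P.card) := fun a => Tuple.sort (f a)
  refine ⟨{ n := P.card
            perm := fun a k => if h : k < P.card then (τ (!a)).symm (τ a ⟨k, h⟩) else 0
            coord := fun a k => if h : k < P.card then f a (τ a ⟨k, h⟩) else 0
            perm_lt := fun a k hk => by
              rw [dif_pos hk]
              exact Fin.is_lt _
            perm_perm := fun a k hk => by
              rw [dif_pos hk, dif_pos (Fin.is_lt _)]
              simp
            coord_mono := fun a i j hij hj => by
              rw [dif_pos hj, dif_pos (hij.trans_lt hj)]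
              exact Tuple.monotone_sort (f a) (Fin.mk_le_mk.2 hij) }, rfl, fun p => ?_⟩
  have hval : ∀ k (hk : k < P.card), (e (τ false ⟨k, hk⟩)).1 =
      (if h : k < P.card then f false (τ false ⟨k, h⟩) else 0,
        if h : (if h : k < P.card then ((τ true).symm (τ false ⟨k, h⟩) : ℕ) else 0) < P.card then
          f true (τ true ⟨_, h⟩) else 0) := by
    intro k hk
    simp [hk, hf]
  constructor
  · intro hp
    refine ⟨(τ false).symm (e.symm ⟨p, hp⟩), Fin.is_lt _, ?_⟩
    refine Eq.trans ?_ (hval _ (Fin.is_lt _))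
    simp
  · rintro ⟨k, hk, rfl⟩
    have := (e (τ false ⟨k, hk⟩)).2
    rw [hval k hk] at this
    exact this

/-! ### Packing prefix counts into words -/

theorem sum_digits_div_mod {B : ℕ} {d : ℕ → ℕ} {b : ℕ} (hd : ∀ j, j < b → d j < B) (r : ℕ) :
    (∑ j ∈ Finset.range b, d j * B ^ j < B ^ b) ∧
    ∀ j < b, (r * B ^ b + ∑ j ∈ Finset.range b, d j * B ^ j) / B ^ j % B = d j := by
  induction b generalizing r with
  | zero => simp
  | succ b ih =>
    have h0 := (ih (fun j hj => hd j (by omega)) 0).1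
    have hb := hd b (Nat.lt_succ_self b)
    constructor
    · rw [Finset.sum_range_succ, pow_succ]
      have := Nat.mul_le_mul_right (B ^ b) hb
      rw [Nat.succ_mul, Nat.mul_comm B] at this
      omega
    · intro j hj
      -- The leading digit is absorbed into the high part `r`, so the induction hypothesis handles
      -- the lower digits.
      have he : r * B ^ (b + 1) + ∑ j ∈ Finset.range (b + 1), d j * B ^ j =
          (r * B + d b) * B ^ b + ∑ j ∈ Finset.range b, d j * B ^ j := by
        rw [Finset.sum_range_succ, pow_succ]
        ring
      rw [he]
      rcases Nat.lt_succ_iff_lt_or_eq.1 hj with hj | rfl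
      · exact (ih (fun j hj => hd j (by omega)) _).2 j hj
      · rw [Nat.add_comm, Nat.add_mul_div_right _ _ (Nat.zero_lt_of_lt h0),
          Nat.div_eq_of_lt h0, Nat.zero_add, Nat.mul_comm r,
          Nat.mul_add_mod, Nat.mod_eq_of_lt hb]

/-- The number of positions for which the numbers of preceding zeros are packed into one word. -/
def blockLength (L : ℕ) : ℕ := L / L.size

/-- The values of `R` at the positions of block `q`, packed into one number. -/
def packed (b : ℕ) (R : ℕ → ℕ) (q : ℕ) : ℕ :=
  R (q * b) * (b + 1) ^ b +
    ∑ j ∈ Finset.range b, (R (q * b + j) - R (q * b)) * (b + 1) ^ j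

section

variable {b : ℕ} {R : ℕ → ℕ}

/-- Within a block the `j`-th increment is at most `j`, so for `j < b` it is a digit in base `b +
1`. -/
theorem packed_digits (hR : ∀ i j, R (i + j) ≤ R i + j) (q : ℕ) :
    (∑ j ∈ Finset.range b, (R (q * b + j) - R (q * b)) * (b + 1) ^ j < (b + 1) ^ b) ∧
    ∀ j < b, packed b R q / (b + 1) ^ j % (b + 1) = R (q * b + j) - R (q * b) :=
  sum_digits_div_mod (fun j hj => by
    have := hR (q * b) j
    omega) (R (q * b))

/-- Division by `(b + 1) ^ b` recovers the count at the start of the block; the digit adds the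
increment. -/
theorem packed_lookup (hb : 0 < b) (hR : ∀ i j, R (i + j) ≤ R i + j) (hm : Monotone R) (i : ℕ) :
    packed b R (i / b) / (b + 1) ^ b +
      packed b R (i / b) / (b + 1) ^ (i % b) % (b + 1) = R i := by
  obtain ⟨h1, h2⟩ := packed_digits (b := b) hR (i / b)
  rw [h2 _ (Nat.mod_lt i hb), packed, Nat.add_comm (R (i / b * b) * _),
    Nat.add_mul_div_right _ _ (by positivity), Nat.div_eq_of_lt h1, Nat.zero_add]
  have hi : i / b * b + i % b = i := by
    rw [Nat.mul_comm]
    exact Nat.div_add_mod i b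
  rw [hi]
  have := hm (show i / b * b ≤ i by omega)
  omega

theorem packed_lt (hR : ∀ i j, R (i + j) ≤ R i + j) {n : ℕ} (hn : ∀ i, R i ≤ n) (q : ℕ) :
    packed b R q < (n + 1) * (b + 1) ^ b := by
  have h1 := (packed_digits (b := b) hR q).1
  have h2 := Nat.mul_le_mul_right ((b + 1) ^ b) (hn (q * b))
  rw [packed, Nat.succ_mul]
  omega

end

theorem blockLength_pos {L : ℕ} (hL : 0 < L) : 0 < blockLength L :=
  Nat.div_pos (Nat.size_le.2 Nat.lt_two_pow_self) (Nat.size_pos.2 hL)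

theorem blockLength_le (L : ℕ) : blockLength L ≤ L := Nat.div_le_self _ _

/-- Each digit is below `2 ^ L.size`, and `L / L.size` blocks of `L.size` bits fit into `L` bits. -/
theorem blockLength_pow_le (L : ℕ) : (blockLength L + 1) ^ blockLength L ≤ 2 ^ L := by
  have h1 : blockLength L + 1 ≤ 2 ^ L.size := (Nat.lt_size_self L).trans_le' (by
    have := blockLength_le L
    omega)
  calc (blockLength L + 1) ^ blockLength L ≤ (2 ^ L.size) ^ blockLength L :=
        Nat.pow_le_pow_left h1 _
    _ = 2 ^ (L.size * blockLength L) := (pow_mul _ _ _).symm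
    _ ≤ 2 ^ L := Nat.pow_le_pow_right (by norm_num) (Nat.mul_div_le L L.size)

theorem le_blockLength_mul {L : ℕ} (hL : 0 < L) : L ≤ 2 * blockLength L * L.size := by
  have h1 := blockLength_pos hL
  have h2 := Nat.lt_mul_div_succ L (Nat.size_pos.2 hL)
  change L < L.size * (blockLength L + 1) at h2
  nlinarith [Nat.size_pos.2 hL]

theorem zerosBefore_add_le (L : ℕ) (A : List ℕ) (ℓ i j : ℕ) :
    zerosBefore L A ℓ (i + j) ≤ zerosBefore L A ℓ i + j := by
  have := countP_take_add_segment (lowBit (L - 1 - ℓ)) (waveletLevel L A ℓ)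
    (Nat.le_add_right i j)
  rw [zerosBefore, zerosBefore, ← this]
  refine Nat.add_le_add_left (List.countP_le_length.trans ?_) _
  rw [segment, List.length_drop, List.length_take]
  omega

theorem zerosBefore_mono (L : ℕ) (A : List ℕ) (ℓ : ℕ) : Monotone (zerosBefore L A ℓ) := by
  intro i j h
  have := countP_take_add_segment (lowBit (L - 1 - ℓ)) (waveletLevel L A ℓ) h
  rw [zerosBefore, zerosBefore]
  omega

theorem zerosBefore_le_length (L : ℕ) (A : List ℕ) (ℓ i : ℕ) : zerosBefore L A ℓ i ≤ A.length := by
  rw [zerosBefore]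
  refine List.countP_le_length.trans ?_
  rw [List.length_take, length_waveletLevel]
  exact min_le_right _ _

/-! ### Memory layout and size -/

namespace PointSystem

variable (D : PointSystem) (L : ℕ)

/-- The number of words for each level of a wavelet matrix. -/
def stride : ℕ := D.n / blockLength L + 1

/-- The word of the packed table for level `ℓ` and block `q`. -/
def tableEntry (a : Bool) (ℓ q : ℕ) : ℕ :=
  packed (blockLength L) (zerosBefore L (D.ranks a) ℓ) q

/-- The number of words of the data structure. -/
def numWords : ℕ := 11 + blockLength L + 2 * (L * D.stride L)

/-- The words of the data structure. -/
def memWord : ℕ → ℕ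
  | 0 => D.numWords L
  | 1 => 2 * D.n
  | 2 => L
  | 3 => D.n
  | 4 => blockLength L
  | 5 => blockLength L + 1
  | 6 => D.stride L
  | 7 => 11 + blockLength L
  | 8 => 11 + blockLength L + L * D.stride L
  | 9 => 2 ^ L
  | k + 10 =>
    if k ≤ blockLength L then (blockLength L + 1) ^ k
    else if k - (blockLength L + 1) < L * D.stride L then
      D.tableEntry L false ((k - (blockLength L + 1)) / D.stride L)
        ((k - (blockLength L + 1)) % D.stride L)
    else
      D.tableEntry L true ((k - (blockLength L + 1) - L * D.stride L) / D.stride L)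
        ((k - (blockLength L + 1) - L * D.stride L) % D.stride L)

/-- The data structure. -/
noncomputable def memory (w : ℕ) : Memory w where
  numWords := D.numWords L
  numReals := 2 * D.n
  word i := BitVec.ofNat w (D.memWord L i)
  real i := if (i : ℕ) < D.n then D.coord false i else D.coord true (i - D.n)

variable {D L}

theorem stride_le (hn : D.n < 2 ^ L) : D.stride L ≤ 2 ^ L := by
  have := Nat.div_le_self D.n (blockLength L)
  rw [stride]
  omega

theorem numWords_lt (hL : 2 ≤ L) (hn : D.n < 2 ^ L) : D.numWords L < 2 ^ (2 * L + 3) := by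
  have h1 := blockLength_le L
  have h2 : L * D.stride L ≤ 2 ^ L * 2 ^ L :=
    Nat.mul_le_mul Nat.lt_two_pow_self.le (stride_le hn)
  have h3 : 2 ^ 2 * 2 ^ 2 ≤ 2 ^ L * 2 ^ L :=
    Nat.mul_le_mul (Nat.pow_le_pow_right (by norm_num) hL) (Nat.pow_le_pow_right (by norm_num) hL)
  have h4 : L * 1 ≤ 2 ^ L * 2 ^ L := Nat.mul_le_mul Nat.lt_two_pow_self.le Nat.one_le_two_pow
  rw [numWords, pow_add, two_mul L, pow_add]
  omega

theorem tableEntry_lt (hn : D.n < 2 ^ L) (a : Bool) (ℓ q : ℕ) :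
    D.tableEntry L a ℓ q < 2 ^ (2 * L + 3) := by
  have h := packed_lt (b := blockLength L) (zerosBefore_add_le L (D.ranks a) ℓ)
    (zerosBefore_le_length L (D.ranks a) ℓ) q
  rw [D.length_ranks] at h
  have h2 := Nat.mul_le_mul (show D.n + 1 ≤ 2 ^ L from hn) (blockLength_pow_le L)
  rw [tableEntry, pow_add, two_mul L, pow_add]
  omega

theorem memWord_lt (hL : 2 ≤ L) (hn : D.n < 2 ^ L) (k : ℕ) :
    D.memWord L k < 2 ^ (2 * L + 3) := by
  have h0 := numWords_lt hL hn
  have h1 := blockLength_le L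
  have h2 : 2 ^ L * 1 ≤ 2 ^ L * 2 ^ L := Nat.mul_le_mul_left _ Nat.one_le_two_pow
  have h3 : L < 2 ^ L := Nat.lt_two_pow_self
  have h4 := stride_le hn
  have h5 := blockLength_pow_le L
  have h6 : 2 ^ (2 * L + 3) = 2 ^ L * 2 ^ L * 8 := by ring
  have h7 : 11 + blockLength L + L * D.stride L < 2 ^ (2 * L + 3) := by
    refine lt_of_le_of_lt ?_ h0
    rw [numWords]
    omega
  unfold memWord
  split
  case h_11 k =>
    split_ifs with h8
    · have := Nat.pow_le_pow_right (n := blockLength L + 1) (Nat.succ_pos _) h8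
      omega
    · exact tableEntry_lt hn _ _ _
    · exact tableEntry_lt hn _ _ _
  all_goals omega

theorem wordAt_memory (hL : 2 ≤ L) (hn : D.n < 2 ^ L) {w : ℕ} (hw : 2 * L + 3 ≤ w) {k : ℕ}
    (hk : k < D.numWords L) : (D.memory L w).wordAt k = D.memWord L k := by
  rw [Memory.wordAt, dif_pos (show k < (D.memory L w).numWords from hk)]
  exact (BitVec.toNat_ofNat _ _).trans (Nat.mod_eq_of_lt ((memWord_lt hL hn k).trans_le
    (Nat.pow_le_pow_right (by norm_num) hw)))

theorem lt_numWords {k : ℕ} (hk : k < 11) : k < D.numWords L := by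
  rw [numWords]
  omega

/-- The data structure as input for the programs. -/
noncomputable def inst (D : PointSystem) {L w : ℕ} (hL : 2 ≤ L) (hn : D.n < 2 ^ L)
    (hw : 2 * L + 3 ≤ w) : Inst where
  w := w
  M := D.memory L w
  L := L
  four_le := by omega
  two_lt := lt_numWords (by norm_num)
  wordAt_zero := wordAt_memory hL hn hw (lt_numWords (by norm_num))
  wordAt_one := wordAt_memory hL hn hw (lt_numWords (by norm_num))
  wordAt_two := wordAt_memory hL hn hw (lt_numWords (by norm_num))

theorem wordAt_table (hL : 2 ≤ L) (hn : D.n < 2 ^ L) {w : ℕ} (hw : 2 * L + 3 ≤ w) (a : Bool)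
    {ℓ q : ℕ} (hℓ : ℓ < L) (hq : q < D.stride L) :
    (if a then 11 + blockLength L + L * D.stride L else 11 + blockLength L) +
        (ℓ * D.stride L + q) < D.numWords L ∧
      (D.memory L w).wordAt ((if a then 11 + blockLength L + L * D.stride L
        else 11 + blockLength L) + (ℓ * D.stride L + q)) = D.tableEntry L a ℓ q := by
  have h1 := Nat.mul_le_mul_right (D.stride L) (Nat.succ_le_of_lt hℓ)
  rw [Nat.succ_mul] at h1
  have hdiv : (ℓ * D.stride L + q) / D.stride L = ℓ := by
    rw [Nat.add_comm, Nat.add_mul_div_right _ _ (Nat.zero_lt_of_lt hq), Nat.div_eq_of_lt hq,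
      Nat.zero_add]
  have hmod : (ℓ * D.stride L + q) % D.stride L = q := by
    rw [Nat.add_comm, Nat.add_mul_mod_self_right, Nat.mod_eq_of_lt hq]
  have hlt : (if a then 11 + blockLength L + L * D.stride L else 11 + blockLength L) +
        (ℓ * D.stride L + q) < D.numWords L := by
    rw [numWords]
    split_ifs <;> omega
  refine ⟨hlt, ?_⟩
  rw [wordAt_memory hL hn hw hlt]
  cases a
  · simp only [Bool.false_eq_true, if_false]
    rw [show 11 + blockLength L + (ℓ * D.stride L + q) =
      (blockLength L + 1 + (ℓ * D.stride L + q)) + 10 by omega, memWord, if_neg (by omega),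
      Nat.add_sub_cancel_left, if_pos (by omega), hdiv, hmod]
  · simp only [if_true]
    rw [show 11 + blockLength L + L * D.stride L + (ℓ * D.stride L + q) =
      (blockLength L + 1 + (L * D.stride L + (ℓ * D.stride L + q))) + 10 by omega, memWord,
      if_neg (by omega), Nat.add_sub_cancel_left, if_neg (by omega), Nat.add_sub_cancel_left,
      hdiv, hmod]

/-- A word of `2 * L + 3` bits holds every address and every packed entry, so all address arithmetic
is exact and the lookup reduces to `packed_lookup`. -/
theorem represents_inst (hL : 2 ≤ L) (hn : D.n < 2 ^ L) {w : ℕ} (hw : 2 * L + 3 ≤ w) :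
    Represents (D.inst hL hn hw) D := by
  have hpw : 2 ^ (2 * L + 3) ≤ 2 ^ w := Nat.pow_le_pow_right (by norm_num) hw
  have hN := (numWords_lt hL hn).trans_le hpw
  have hword : ∀ k < 11, (D.memory L w).wordAt k = D.memWord L k := fun k hk =>
    wordAt_memory hL hn hw (lt_numWords hk)
  have hb := blockLength_pos (show 0 < L by omega)
  have hn2 : 2 * D.n < 2 ^ w := by
    refine lt_of_lt_of_le ?_ hpw
    have : 2 ^ L * 1 ≤ 2 ^ L * 2 ^ L := Nat.mul_le_mul_left _ Nat.one_le_two_pow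
    have h6 : 2 ^ (2 * L + 3) = 2 ^ L * 2 ^ L * 8 := by ring
    omega
  refine ⟨hword 3 (by norm_num), hword 9 (by norm_num), hn,
    Nat.pow_le_pow_right (by norm_num) (show L + 3 ≤ w by omega), fun a ℓ i hℓ hi => ?_,
    fun a k hk => ?_⟩
  · change ℓ < L at hℓ
    have hq : i / blockLength L < D.stride L :=
      Nat.lt_succ_of_le (Nat.div_le_div_right hi)
    obtain ⟨h1, h2⟩ := wordAt_table (D := D) hL hn hw a hℓ hq
    have hle : ℓ * D.stride L + i / blockLength L < 2 ^ w :=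
      lt_of_le_of_lt (Nat.le_add_left _ _) (h1.trans hN)
    have hbase : (D.memory L w).wordAt (if a then 8 else 7) =
        if a then 11 + blockLength L + L * D.stride L else 11 + blockLength L := by
      cases a
      · exact hword 7 (by norm_num)
      · exact hword 8 (by norm_num)
    have hpow : ∀ j ≤ blockLength L, 10 + j < 2 ^ w ∧
        (D.memory L w).wordAt (10 + j) = (blockLength L + 1) ^ j := by
      intro j hj
      have hlt : 10 + j < D.numWords L := by
        rw [numWords]
        omega
      refine ⟨hlt.trans hN, ?_⟩
      rw [wordAt_memory hL hn hw hlt, Nat.add_comm, memWord, if_pos hj]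
    have hmod := (Nat.mod_lt i hb).le
    have hT : (D.memory L w).wordAt (wadd (D.inst hL hn hw)
        ((D.memory L w).wordAt (if a then 8 else 7)) (wadd (D.inst hL hn hw)
        (wmul (D.inst hL hn hw) ℓ ((D.memory L w).wordAt 6)) (i / (D.memory L w).wordAt 4))) =
        D.tableEntry L a ℓ (i / blockLength L) := by
      rw [hbase, show (D.memory L w).wordAt 6 = D.stride L from hword 6 (by norm_num),
        show (D.memory L w).wordAt 4 = blockLength L from hword 4 (by norm_num),
        wmul_eq (a := ℓ) (b := D.stride L) (lt_of_le_of_lt (Nat.le_add_right _ _) hle),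
        wadd_eq (a := ℓ * D.stride L) (b := i / blockLength L) hle, wadd_eq (h1.trans hN), h2]
    set T := wadd (D.inst hL hn hw) ((D.memory L w).wordAt (if a then 8 else 7))
      (wadd (D.inst hL hn hw) (wmul (D.inst hL hn hw) ℓ ((D.memory L w).wordAt 6))
        (i / (D.memory L w).wordAt 4))
    change wadd (D.inst hL hn hw) ((D.memory L w).wordAt T /
      (D.memory L w).wordAt (wadd (D.inst hL hn hw) 10 ((D.memory L w).wordAt 4)))
      ((D.memory L w).wordAt T / (D.memory L w).wordAt (wadd (D.inst hL hn hw) 10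
        (i % (D.memory L w).wordAt 4)) % (D.memory L w).wordAt 5) = _
    rw [hT, show (D.memory L w).wordAt 4 = blockLength L from hword 4 (by norm_num),
      show (D.memory L w).wordAt 5 = blockLength L + 1 from hword 5 (by norm_num),
      wadd_eq (a := 10) (b := blockLength L) (hpow _ le_rfl).1, (hpow _ le_rfl).2,
      wadd_eq (a := 10) (b := i % blockLength L) (hpow _ hmod).1, (hpow _ hmod).2]
    have hlook := packed_lookup hb (zerosBefore_add_le L (D.ranks a) ℓ)
      (zerosBefore_mono L (D.ranks a) ℓ) i
    rw [tableEntry, wadd_eq]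
    · exact hlook
    · rw [hlook]
      refine (zerosBefore_le_length L (D.ranks a) ℓ i).trans_lt ?_
      rw [D.length_ranks]
      exact lt_of_le_of_lt (Nat.le_mul_of_pos_left _ Nat.two_pos) hn2
  · cases a
    · change (D.memory L w).realAt k = _
      rw [Memory.realAt, dif_pos (show k < (D.memory L w).numReals by change k < 2 * D.n; omega)]
      exact if_pos hk
    · change (D.memory L w).realAt (wadd (D.inst hL hn hw) ((D.memory L w).wordAt 3) k) = _
      rw [show (D.memory L w).wordAt 3 = D.n from hword 3 (by norm_num),
        wadd_eq (show D.n + k < 2 ^ w by omega), Memory.realAt,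
        dif_pos (show D.n + k < (D.memory L w).numReals by change D.n + k < 2 * D.n; omega)]
      change (if D.n + k < D.n then D.coord false (D.n + k) else D.coord true (D.n + k - D.n)) = _
      rw [if_neg (by omega), Nat.add_sub_cancel_left]

theorem realsFrom_memory {P : Finset (ℝ × ℝ)}
    (hP : ∀ p, p ∈ P ↔ ∃ k < D.n, p = (D.val false k, D.val true k)) (L w : ℕ) :
    (D.memory L w).RealsFrom P := by
  have key : ∀ a k, k < D.n → ∃ p ∈ P, D.coord a k = p.1 ∨ D.coord a k = p.2 := by
    intro a k hk
    obtain ⟨k', hk', rfl⟩ := exists_pos_eq a hk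
    refine ⟨_, (hP _).2 ⟨k', hk', rfl⟩, ?_⟩
    cases a
    · exact Or.inl rfl
    · exact Or.inr rfl
  intro i
  have hi : (i : ℕ) < 2 * D.n := i.2
  simp only [memory]
  split_ifs with h
  · exact key false _ h
  · exact key true _ (by omega)

/-- There are `n / b` full blocks per level, and `L / b` is at most `2 * L.size`. The assumption `L
≤ n + 1` absorbs the last block of each level and the header. -/
theorem size_memory_le (hL : 0 < L) (hLn : L ≤ D.n + 1) (hn : 2 ≤ D.n) (w : ℕ) :
    (D.memory L w).size ≤ 20 * (D.n * L.size) := by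
  have h1 := le_blockLength_mul hL
  have h2 := Nat.div_mul_le_self D.n (blockLength L)
  have h3 := blockLength_le L
  have h4 := Nat.size_pos.2 hL
  have h5 : L * (D.n / blockLength L) ≤ 2 * (D.n * L.size) := by
    calc L * (D.n / blockLength L) ≤ 2 * blockLength L * L.size * (D.n / blockLength L) :=
          Nat.mul_le_mul_right _ h1
      _ = 2 * (D.n / blockLength L * blockLength L * L.size) := by ring
      _ ≤ 2 * (D.n * L.size) := Nat.mul_le_mul_left _ (Nat.mul_le_mul_right _ h2)
  have h6 : D.n * 1 ≤ D.n * L.size := Nat.mul_le_mul_left _ h4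
  have h7 : (D.memory L w).size = 11 + blockLength L + 2 * (L * (D.n / blockLength L) + L) +
    2 * D.n := by
    change D.numWords L + 2 * D.n = _
    rw [numWords, stride, Nat.mul_add L, Nat.mul_one]
  omega

end PointSystem

/-! ### Asymptotics -/

theorem clog_add_one_le {n : ℕ} (hn : 2 ≤ n) : (Nat.clog 2 n + 1 : ℝ) ≤ 5 * Real.log n := by
  have h1 := Nat.pow_pred_clog_lt_self Nat.one_lt_two (show 1 < n by omega)
  have hc : 1 ≤ Nat.clog 2 n := Nat.clog_pos Nat.one_lt_two hn
  have h2 : ((2 : ℝ) ^ (Nat.clog 2 n).pred) ≤ n := by exact_mod_cast h1.le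
  have h3 := Real.log_le_log (by positivity) h2
  rw [Real.log_pow, Nat.pred_eq_sub_one, Nat.cast_sub hc, Nat.cast_one] at h3
  have h4 := Real.log_two_gt_d9
  have h5 : Real.log 2 ≤ Real.log n := Real.log_le_log (by norm_num) (by exact_mod_cast hn)
  have h6 : (1 : ℝ) ≤ Nat.clog 2 n := by exact_mod_cast hc
  nlinarith

/-- `L.size - 1` is at most the binary logarithm of `L`, and `log L ≤ log (5 * log n) ≤ (5 * log n)
^ δ / δ`. The remaining 1 is bounded by `(log n / log 2) ^ δ`, which explains the two summands. -/
theorem size_le_rpow {δ : ℝ} (hδ : 0 < δ) {n : ℕ} (hn : 2 ≤ n) :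
    ((Nat.clog 2 n + 1).size : ℝ) ≤
      ((Real.log 2)⁻¹ ^ δ + 5 ^ δ / δ / Real.log 2) * Real.log n ^ δ := by
  set L := Nat.clog 2 n + 1 with hL
  have hlog2 : 0 < Real.log 2 := Real.log_pos one_lt_two
  have h5 : Real.log 2 ≤ Real.log n := Real.log_le_log (by norm_num) (by exact_mod_cast hn)
  have hlog : 0 < Real.log n := hlog2.trans_le h5
  have hs : 0 < L.size := Nat.size_pos.2 (Nat.succ_pos _)
  have h1 : 2 ^ (L.size - 1) ≤ L := Nat.lt_size.1 (by omega)
  have h2 : ((2 : ℝ) ^ (L.size - 1)) ≤ L := by exact_mod_cast h1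
  have h3 := Real.log_le_log (by positivity) h2
  rw [Real.log_pow, Nat.cast_sub hs, Nat.cast_one] at h3
  have h4 : (L : ℝ) ≤ 5 * Real.log n := by
    rw [hL, Nat.cast_add, Nat.cast_one]
    exact clog_add_one_le hn
  have hLpos : (0 : ℝ) < L := by
    rw [hL]
    positivity
  have h6 : Real.log L ≤ 5 ^ δ / δ * Real.log n ^ δ := by
    refine (Real.log_le_log hLpos h4).trans ((Real.log_le_rpow_div (by positivity) hδ).trans ?_)
    rw [Real.mul_rpow (by norm_num) hlog.le]
    exact le_of_eq (by ring)
  have h7 : 1 ≤ (Real.log 2)⁻¹ ^ δ * Real.log n ^ δ := by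
    rw [← Real.mul_rpow (by positivity) hlog.le]
    refine Real.one_le_rpow ?_ hδ.le
    rw [inv_mul_eq_div, le_div_iff₀ hlog2, one_mul]
    exact h5
  have h8 : (L.size : ℝ) - 1 ≤ 5 ^ δ / δ * Real.log n ^ δ / Real.log 2 := by
    rw [le_div_iff₀ hlog2]
    exact h3.trans h6
  calc (L.size : ℝ) ≤ (Real.log 2)⁻¹ ^ δ * Real.log n ^ δ +
        5 ^ δ / δ * Real.log n ^ δ / Real.log 2 := by linarith
    _ = _ := by ring

end RangeCenter

/-! ### Choice of the constants -/

theorem mainTheorem6 (δ : ℝ) (hδ : 0 < δ) :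
    ∃ (prog : RangeCenter.Program) (κ : ℕ) (C : ℝ),
      ∀ (n : ℕ), 2 ≤ n → ∀ (P : Finset (ℝ × ℝ)), P.card = n →
        ∃ M : RangeCenter.Memory (κ * Nat.clog 2 n),
          M.RealsFrom P ∧
          (M.size : ℝ) ≤ C * ((n : ℝ) * Real.log n ^ δ) ∧
          RangeCenter.AnswersCenterQueries 3 prog M P (C * Real.log n ^ 2) := by
  obtain ⟨prog, A, hprog⟩ := (RangeCenter.realizable_answer (d := 0)).exists_program
  set K : ℝ := (Real.log 2)⁻¹ ^ δ + 5 ^ δ / δ / Real.log 2 with hK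
  have hlog2 : 0 < Real.log 2 := Real.log_pos one_lt_two
  have hK0 : 0 ≤ K := by positivity
  -- With `L = clog n + 1`, the `2 * L + 3` bits required are at most `7 * clog n`. The constant `C`
  -- is the sum of one for the size and one for the time, the latter from `L + 1 ≤ 7 * log n`.
  refine ⟨prog, 7, 20 * K + A * 7 ^ 2, fun n hn P hPn => ?_⟩
  obtain ⟨D, hDn, hP⟩ := RangeCenter.exists_pointSystem P
  rw [hPn] at hDn
  have hc : 1 ≤ Nat.clog 2 n := Nat.clog_pos Nat.one_lt_two hn
  -- The extra level makes `n < 2 ^ L` strict also for powers of two; the rank bound `n` itself must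
  -- have `L` digits.
  set L := Nat.clog 2 n + 1 with hL
  have hL2 : 2 ≤ L := by omega
  have hnL : D.n < 2 ^ L := by
    have := Nat.le_pow_clog Nat.one_lt_two n
    rw [hDn, hL, pow_succ]
    omega
  have hw : 2 * L + 3 ≤ 7 * Nat.clog 2 n := by omega
  have hLn : L ≤ D.n + 1 := by
    rw [hDn, hL]
    exact Nat.succ_le_succ ((Nat.clog_le_iff_le_pow Nat.one_lt_two).2 Nat.lt_two_pow_self.le)
  have h5 : Real.log 2 ≤ Real.log n := Real.log_le_log (by norm_num) (by exact_mod_cast hn)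
  have hlog : 0 < Real.log n := hlog2.trans_le h5
  refine ⟨D.memory L (7 * Nat.clog 2 n), D.realsFrom_memory hP _ _, ?_, fun a b hab => ?_⟩
  · have h1 := D.size_memory_le (by omega) hLn (by omega) (7 * Nat.clog 2 n)
    rw [hDn] at h1
    have h2 : ((D.memory L (7 * Nat.clog 2 n)).size : ℝ) ≤ 20 * (n * L.size) := by
      exact_mod_cast h1
    have h3 := RangeCenter.size_le_rpow hδ hn
    have hA : (0 : ℝ) ≤ A * 7 ^ 2 * (n * Real.log n ^ δ) := by positivity
    calc ((D.memory L (7 * Nat.clog 2 n)).size : ℝ) ≤ 20 * (n * L.size) := h2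
      _ ≤ 20 * (n * (K * Real.log n ^ δ)) := by gcongr
      _ ≤ (20 * K + A * 7 ^ 2) * (n * Real.log n ^ δ) := by linarith
  · obtain ⟨t, s, hs, ht, h1, h2⟩ := hprog (D.inst hL2 hnL hw) a b
    refine ⟨t, s, hs, ?_, ?_⟩
    · have h3 : (t : ℝ) ≤ A * ((L : ℝ) + 1) ^ 2 := by
        have : t ≤ A * (L + 1) ^ 2 := ht
        exact_mod_cast this
      have h4 : (L : ℝ) + 1 ≤ 7 * Real.log n := by
        have h6 := RangeCenter.clog_add_one_le hn
        have h7 := Real.log_two_gt_d9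
        rw [hL, Nat.cast_add, Nat.cast_one]
        linarith
      calc (t : ℝ) ≤ A * ((L : ℝ) + 1) ^ 2 := h3
        _ ≤ A * (7 * Real.log n) ^ 2 := by gcongr
        _ = A * 7 ^ 2 * Real.log n ^ 2 := by ring
        _ ≤ (20 * K + A * 7 ^ 2) * Real.log n ^ 2 := by
          gcongr
          linarith
    · have h := RangeCenter.answer_spec (RangeCenter.PointSystem.represents_inst hL2 hnL hw) hP a b
      rw [← h1, ← h2] at h
      exact h
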